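/- **Setting.** On a probability space, let $S>0$ be a stock price process with known $S_0$, let $0=\tau_0<\tau_1<\tau_2<\cdots$ be random trading dates, and let $Z_k=(S_{\tau_k}-S_{\tau_{k-1}})/S_{\tau_{k-1}}$, $k\ge 1$ (with $Z_0$ a fixed constant). Put $\mathcal G_t=\sigma\{(\tau_k,Z_k):\tau_k\le t\}$. For $x\ge 0$ let $\mathcal A(x)$ be the set of pairs $(\alpha,c)$, where $\alpha_k$ ($k\ge1$) is a real $\mathcal G_{\tau_{k-1}}$-measurable random variable, $c=(c_t)_{t\ge0}$ is a nonnegative $(\mathcal G_t)$-predictable process, and for every $k\ge1$, almost surely, $\int_0^{\tau_k}c_t\,dt<\infty$ and $x-\int_0^{\tau_k}c_t\,dt+\sum_{i=1}^k\alpha_iZ_i\ge 0$. Let $$v(x)=\sup_{(\alpha,c)\in\mathcal A(x)}\mathbb E\Big[\int_0^\infty e^{-\rho t}U(c_t)\,dt\Big].$$ **Assumptions on $(\tau_k,Z_k)$.** There are $\lambda>0$, $\underline z\in(0,1]$, $\bar z\in(0,\infty]$, $k,b\ge 0$ and a probability kernel $p(t,dz)$ such that: (a) the $\tau_k$, $k\ge1$,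 are the jump times of a Poisson process of intensity $\lambda$ relative to the observations, i.e. each $\tau_k-\tau_{k-1}$ is exponential with parameter $\lambda$ and independent of $(\tau_i,Z_i)_{i<k}$; (b) conditionally on $\tau_k-\tau_{k-1}=t$, $Z_k$ is independent of $(\tau_i,Z_i)_{i<k}$ and has distribution $p(t,dz)$; for each $t>0$ the support of $p(t,dz)$ is either an interval with interior $(-\underline z,\bar z)$, or a finite set with least element $-\underline z$ and greatest element $\bar z<\infty$; (c) for all $t\ge 0$, $z$ is $p(t,dz)$-integrable, $\int z\,p(t,dz)\ge0$ and $\int(1+z)\,p(t,dz)\le ke^{bt}$; (d) for every continuous $w:\mathbb R\to\mathbb R$ of linear growth, $t\mapsto\int w(z)\,p(t,dz)$ is continuous on $[0,\infty)$. **Assumptions on $U$ and $\rho$.** $U:[0,\infty)\to\mathbb R$ is strictly increasing and strictly concave, $C^1$ on $(0,\infty)$, $U(0)=0$, $U'(0^+)=+\infty$, $U'(+\infty)=0$; there are $\gamma\in(0,1)$ and $K_1>0$ with $U(x)\le K_1x^\gamma$ for $x\ge0$; and $\rho>0$, $\rho>b\gamma+\lambda\big(k^\gamma/\underline z^\gamma-1\big)$.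 **Auxiliary value function.** Let $A=\mathbb R$ if $\bar z<\infty$ and $A=[0,\infty)$ if $\bar z=\infty$; let $l(a)=\max(a\underline z,-a\bar z)$, read as $a\underline z$ if $\bar z=\infty$. For $t\ge 0$, $a\in A$, $x\ge l(a)$ let $$\hat v(t,x,a)=\sup_{c}\int_t^\infty e^{-(\rho+\lambda)(s-t)}\Big[U(c_s)+\lambda\int v(Y_s+az)\,p(s,dz)\Big]ds,\qquad Y_s=x-\int_t^sc_u\,du,$$ the supremum being over the deterministic nonnegative measurable $c=(c_s)_{s\ge t}$ with $\int_t^sc_u\,du\le x-l(a)$ for all $s\ge t$. **Semiconcavity assumption.** A function $u$ on a set $D$ is semiconcave if there is a nondecreasing upper semicontinuous $\omega:[0,\infty)\to[0,\infty)$ with $\omega(r)\to0$ as $r\to0^+$ and $\eta u(x_1)+(1-\eta)u(x_2)-u(\eta x_1+(1-\eta)x_2)\le\eta(1-\eta)|x_1-x_2|\,\omega(|x_1-x_2|)$ whenever $[x_1,x_2]\subset D$ and $\eta\in[0,1]$; it is locally semiconcave if it is semiconcave on every compact subset of its domain. Assume that for every $a\in A\setminus\{0\}$ and every continuous $w:\mathbb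 R\to\mathbb R$ of linear growth, the map $(t,x)\mapsto\lambda\int w(x+az)\,p(t,dz)$ is locally semiconcave on $(0,\infty)\times(l(a),\infty)$. **Proposition.** Under these assumptions, for every $a\in A$, the function $\hat v(\cdot,\cdot,a)$ is finite on $[0,\infty)\times[l(a),\infty)$ and belongs to $C^1\big([0,\infty)\times(l(a),\infty)\big)$ (continuously differentiable up to the boundary $t=0$), and for every $t\ge0$ $$\frac{\partial\hat v}{\partial x}(t,l(a)^+,a)=\lim_{x\downarrow l(a)}\frac{\partial\hat v}{\partial x}(t,x,a)=+\infty.$$ -/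

import Mathlib

open MeasureTheory ProbabilityTheory Filter Topology
open scoped NNReal ENNReal

noncomputable section

/-- An illiquid market: a positive price process `S` with known initial value, and random trading
dates `0 = τ 0 < τ 1 < τ 2 < ...`. The number `z₀` is the conventional value of the zeroth
return. -/
structure IlliquidMarket (Ω : Type*) [MeasurableSpace Ω] where
  S : ℝ≥0 → Ω → ℝ
  τ : ℕ → Ω → ℝ≥0
  z₀ : ℝ
  S_pos : ∀ t ω, 0 < S t ω
  S_zero : ∃ s₀ : ℝ, ∀ ω, S 0 ω = s₀
  τ_zero : ∀ ω, τ 0 ω = 0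
  τ_strictMono : ∀ ω, StrictMono fun k => τ k ω
  measurable_τ : ∀ k, Measurable (τ k)
  measurable_S_τ : ∀ k, Measurable fun ω => S (τ k ω) ω

namespace IlliquidMarket

variable {Ω : Type*} [mΩ : MeasurableSpace Ω] (M : IlliquidMarket Ω)

/-- The observed returns `Z k = (S (τ k) - S (τ (k - 1))) / S (τ (k - 1))`, `k ≥ 1`. -/
def Z : ℕ → Ω → ℝ
  | 0, _ => M.z₀
  | k + 1, ω => (M.S (M.τ (k + 1) ω) ω - M.S (M.τ k ω) ω) / M.S (M.τ k ω) ω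

theorem measurable_Z (k : ℕ) : Measurable (M.Z k) := by
  cases k with
  | zero => exact measurable_const
  | succ k =>
    exact ((M.measurable_S_τ (k + 1)).sub (M.measurable_S_τ k)).div (M.measurable_S_τ k)

/-- The waiting time `τ (k + 1) - τ k`. -/
def wait (k : ℕ) (ω : Ω) : ℝ := (M.τ (k + 1) ω : ℝ) - (M.τ k ω : ℝ)

/-- The trading dates and returns `(τ i, Z i)` for `i ≤ k`. -/
def history (k : ℕ) (ω : Ω) : Fin (k + 1) → ℝ≥0 × ℝ := fun i => (M.τ i ω, M.Z i ω)

/-- The continuous observation filtration `𝒢 t = σ{(τ k, Z k) : τ k ≤ t}`: it is generated by the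
events "`τ k ≤ t` and `(τ k, Z k) ∈ B`". -/
def obs : Filtration ℝ≥0 mΩ where
  seq t := MeasurableSpace.generateFrom
    {E | ∃ (k : ℕ) (B : Set (ℝ≥0 × ℝ)), MeasurableSet B ∧
      E = {ω | M.τ k ω ≤ t ∧ (M.τ k ω, M.Z k ω) ∈ B}}
  mono' := by
    intro s t hst
    refine MeasurableSpace.generateFrom_le ?_
    rintro E ⟨k, B, hB, rfl⟩
    refine MeasurableSpace.measurableSet_generateFrom
      ⟨k, B ∩ (Set.Iic s ×ˢ Set.univ), hB.inter (measurableSet_Iic.prod .univ), ?_⟩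
    ext ω
    simp only [Set.mem_ofPred_eq, Set.mem_inter_iff, Set.mem_prod, Set.mem_Iic, Set.mem_univ,
      and_true]
    exact ⟨fun h => ⟨h.1.trans hst, h.2, h.1⟩, fun h => ⟨h.2.2, h.2.1⟩⟩
  le' := by
    intro t
    refine MeasurableSpace.generateFrom_le ?_
    rintro E ⟨k, B, hB, rfl⟩
    exact (measurableSet_le (M.measurable_τ k) measurable_const).inter
      (((M.measurable_τ k).prodMk (M.measurable_Z k)) hB)

theorem isStoppingTime_τ (k : ℕ) :
    IsStoppingTime M.obs fun ω => (M.τ k ω : WithTop ℝ≥0) := by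
  intro t
  refine MeasurableSpace.measurableSet_generateFrom ⟨k, Set.univ, .univ, ?_⟩
  ext ω
  simp only [Set.mem_ofPred_eq, Set.mem_univ, and_true]
  exact WithTop.coe_le_coe

/-- The discrete observation filtration `k ↦ 𝒢 (τ k)`. -/
abbrev obsAt (k : ℕ) : MeasurableSpace Ω := (M.isStoppingTime_τ k).measurableSpace

/-- The wealth `x - ∫₀^{τ k} c t dt + ∑_{i = 1}^k α i Z i` at the `k`-th trading date. -/
def wealth (x : ℝ) (α : ℕ → Ω → ℝ) (c : ℝ≥0 → Ω → ℝ) (k : ℕ) (ω : Ω) : ℝ :=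
  x - (∫ t in Set.Ioc 0 (M.τ k ω : ℝ), c t.toNNReal ω) + ∑ i ∈ Finset.Icc 1 k, α i ω * M.Z i ω

/-- Admissible policies from the initial capital `x`. The investment `α k`, `k ≥ 1`, is chosen at
`τ (k - 1)` (the value `α 0` is never used). The integrability clause says that the total
consumption up to each trading date is finite, so that the integral in `wealth` is the true one. -/
structure Admissible (P : Measure Ω) (x : ℝ) (α : ℕ → Ω → ℝ) (c : ℝ≥0 → Ω → ℝ) : Prop where
  measurable_α : ∀ k, Measurable[M.obsAt k] (α (k + 1))
  predictable_c : Measurable[M.obs.predictable] fun q : ℝ≥0 × Ω => c q.1 q.2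
  nonneg_c : ∀ t ω, 0 ≤ c t ω
  integrable_c : ∀ k, 1 ≤ k → ∀ᵐ ω ∂P,
    IntegrableOn (fun t : ℝ => c t.toNNReal ω) (Set.Ioc 0 (M.τ k ω : ℝ))
  wealth_nonneg : ∀ k, 1 ≤ k → ∀ᵐ ω ∂P, 0 ≤ M.wealth x α c k ω

/-- The value function `v x = sup 𝔼 ∫₀^∞ exp (-ρ t) U (c t) dt` over the admissible policies, for
a nonnegative utility `U` (so that it is well defined with values in `[0, ∞]`). -/
def value (P : Measure Ω) (ρ : ℝ) (U : ℝ → ℝ) (x : ℝ) : ℝ≥0∞ :=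
  ⨆ (α : ℕ → Ω → ℝ) (c : ℝ≥0 → Ω → ℝ) (_ : M.Admissible P x α c),
    ∫⁻ ω, (∫⁻ t in Set.Ioi (0 : ℝ),
      ENNReal.ofReal (Real.exp (-ρ * t) * U (c t.toNNReal ω))) ∂P

end IlliquidMarket

/-- The conditions on the dates and returns `(τ k, Z k)`: intensity `lam`, conditional return
distributions `p t`, lowest return `-zlo`, highest return `zhi` (possibly `∞`), and the constants
`k`, `b` of the growth condition. -/
structure ReturnAssumption {Ω : Type*} [MeasurableSpace Ω] (M : IlliquidMarket Ω)
    (P : Measure Ω) (lam : ℝ) (p : Kernel ℝ ℝ) (zlo : ℝ) (zhi : EReal) (k b : ℝ) : Prop where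
  lam_pos : 0 < lam
  /-- The trading dates are the jump times of a Poisson process with intensity `lam`: the waiting
  times are exponential, each one independent of the observations made before it starts. -/
  wait_law : ∀ n, HasLaw (M.wait n) (expMeasure lam) P
  wait_indep : ∀ n, IndepFun (M.history n) (M.wait n) P
  /-- Given that the waiting time is `t`, the return is independent of the past observations and
  has distribution `p t`. -/
  return_law : ∀ n, HasCondDistrib (M.Z (n + 1)) (fun ω => (M.history n ω, M.wait n ω))
    (p.prodMkLeft (Fin (n + 1) → ℝ≥0 × ℝ)) P
  zlo_pos : 0 < zlo
  zlo_le : zlo ≤ 1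
  zhi_pos : 0 < zhi
  support : ∀ t : ℝ, 0 < t →
    ((p t).support.OrdConnected ∧
      interior (p t).support = {z : ℝ | -zlo < z ∧ (z : EReal) < zhi}) ∨
    ((p t).support.Finite ∧ IsLeast (p t).support (-zlo) ∧
      ∃ z : ℝ, (z : EReal) = zhi ∧ IsGreatest (p t).support z)
  k_nonneg : 0 ≤ k
  b_nonneg : 0 ≤ b
  integrable : ∀ t : ℝ, 0 ≤ t → Integrable (fun z : ℝ => z) (p t)
  mean_nonneg : ∀ t : ℝ, 0 ≤ t → 0 ≤ ∫ z, z ∂(p t)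
  mean_le : ∀ t : ℝ, 0 ≤ t → ∫ z, (1 + z) ∂(p t) ≤ k * Real.exp (b * t)
  continuity : ∀ w : ℝ → ℝ, Continuous w → (∃ C : ℝ, ∀ z, |w z| ≤ C * (1 + |z|)) →
    ∀ t₀ : ℝ, 0 ≤ t₀ →
      Tendsto (fun t => ∫ z, w z ∂(p t)) (𝓝[Set.Ici 0] t₀) (𝓝 (∫ z, w z ∂(p t₀)))

/-- The conditions on the utility function `U`, and the standing condition on the discount
factor `ρ`. -/
structure UtilityAssumption (U : ℝ → ℝ) (ρ lam zlo k b γ : ℝ) : Prop where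
  strictMono : StrictMonoOn U (Set.Ici 0)
  strictConcave : StrictConcaveOn ℝ (Set.Ici 0) U
  contDiff : ContDiffOn ℝ 1 U (Set.Ioi 0)
  map_zero : U 0 = 0
  inada_zero : Tendsto (deriv U) (𝓝[>] 0) atTop
  inada_top : Tendsto (deriv U) atTop (𝓝 0)
  γ_pos : 0 < γ
  γ_lt_one : γ < 1
  growth : ∃ K₁ : ℝ, 0 < K₁ ∧ ∀ x : ℝ, 0 ≤ x → U x ≤ K₁ * x ^ γ
  ρ_pos : 0 < ρ
  discount : b * γ + lam * (k ^ γ / zlo ^ γ - 1) < ρ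

/-- `l a = max (a zlo) (-a zhi)`, to be read as `a zlo` when `zhi = ∞`. -/
def minWealth (zlo : ℝ) (zhi : EReal) (a : ℝ) : ℝ :=
  if zhi = ⊤ then a * zlo else max (a * zlo) (-a * zhi.toReal)

/-- The set of possible investments: `ℝ` if `zhi < ∞`, and `[0, ∞)` if `zhi = ∞`. -/
def investments (zhi : EReal) : Set ℝ := if zhi = ⊤ then Set.Ici 0 else Set.univ

/-- The deterministic consumption rates `c = (c s)_{s ≥ t}` with `∫_t^s c u du ≤ x - l` for all
`s ≥ t`. -/
def consumptions (l t x : ℝ) : Set (ℝ → ℝ) :=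
  {c | Measurable c ∧ (∀ s, 0 ≤ c s) ∧
    ∀ s, t ≤ s → IntegrableOn c (Set.Ioc t s) ∧ ∫ u in Set.Ioc t s, c u ≤ x - l}

/-- The value function of the auxiliary problem between two trading dates,
`v̂ t x a = sup ∫_t^∞ exp (-(ρ + λ) (s - t)) [U (c s) + λ ∫ v (Y s + a z) p(s, dz)] ds`,
where `Y s = x - ∫_t^s c u du` and the supremum is over the consumption rates that leave enough
wealth to hold the position `a`. -/
def auxValue {Ω : Type*} [MeasurableSpace Ω] (M : IlliquidMarket Ω) (P : Measure Ω)
    (ρ lam : ℝ) (U : ℝ → ℝ) (p : Kernel ℝ ℝ) (zlo : ℝ) (zhi : EReal) (t x a : ℝ) : ℝ≥0∞ :=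
  ⨆ c ∈ consumptions (minWealth zlo zhi a) t x,
    ∫⁻ s in Set.Ioi t, ENNReal.ofReal (Real.exp (-(ρ + lam) * (s - t))) *
      (ENNReal.ofReal (U (c s)) + ENNReal.ofReal lam *
        ∫⁻ z, M.value P ρ U ((x - ∫ u in Set.Ioc t s, c u) + a * z) ∂(p s))

/-- `u` is semiconcave on `D`, with a nondecreasing upper semicontinuous modulus. -/
def SemiconcaveOn {E : Type*} [NormedAddCommGroup E] [NormedSpace ℝ E] (D : Set E)
    (u : E → ℝ) : Prop :=
  ∃ m : ℝ≥0 → ℝ≥0, Monotone m ∧ UpperSemicontinuous m ∧ Tendsto m (𝓝[>] 0) (𝓝 0) ∧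
    ∀ x₁ x₂ : E, segment ℝ x₁ x₂ ⊆ D → ∀ η ∈ Set.Icc (0 : ℝ) 1,
      η * u x₁ + (1 - η) * u x₂ - u (η • x₁ + (1 - η) • x₂) ≤
        η * (1 - η) * ‖x₁ - x₂‖ * m ‖x₁ - x₂‖₊

/-- `u` is semiconcave on every compact subset of `D`. -/
def LocallySemiconcaveOn {E : Type*} [NormedAddCommGroup E] [NormedSpace ℝ E] (D : Set E)
    (u : E → ℝ) : Prop :=
  ∀ K : Set E, K ⊆ D → IsCompact K → SemiconcaveOn K u

/-- The semiconcavity assumption on `p`: for every possible investment `a ≠ 0` and every continuous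
`w` of linear growth, `(t, x) ↦ λ ∫ w (x + a z) p(t, dz)` is locally semiconcave on
`(0, ∞) × (l a, ∞)` (a point `y` of the Euclidean plane is the pair `(t, x) = (y 0, y 1)`). -/
def SemiconcavityAssumption (lam : ℝ) (p : Kernel ℝ ℝ) (zlo : ℝ) (zhi : EReal) : Prop :=
  ∀ a ∈ investments zhi, a ≠ 0 → ∀ w : ℝ → ℝ, Continuous w →
    (∃ C : ℝ, ∀ y, |w y| ≤ C * (1 + |y|)) →
    LocallySemiconcaveOn
      {y : EuclideanSpace ℝ (Fin 2) | 0 < y 0 ∧ minWealth zlo zhi a < y 1}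
      (fun y => lam * ∫ z, w (y 1 + a * z) ∂(p (y 0)))

end

/-! While the position `a` is held, the auxiliary problem is a deterministic consumption problem
with discount rate `β = ρ + lam` and running reward `G s y = lam * ∫ v (y + a z) p(s, dz)`.
`ConsumptionProblem` isolates the properties of `G` that matter. Regularity is proved for every such
problem, and `UtilityAssumption.consumptionProblem` shows that the market produces one.

Wealth: the value is concave in `x`, so it is differentiable once its second differences are `o(z)`.
No optimal rate is needed. A nearly optimal rate `c` lies in a compact `[a, C] ⊆ (0, ∞)` on a set
`A` of times in `(t, t + ε]` with measure at least `m`, uniformly in `c`: the Inada condition makes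
pure waiting strictly suboptimal, and the sublinear growth of `U` prevents large rates from carrying
the gain. Changing `c` by `± z / |A|` on `A` gives admissible rates from `x ± z`, with the same
wealth as `c` after `t + ε`. The utilities lose `o(z)` because `U` is `C¹`, and the running reward
loses `O(ε z)` because `G` is concave (`second_difference_maxReward`). The infinite slope at `l`
comes from the fact that every admissible rate is at most `2 (x - l)` for half of the next unit of
time, so that additional wealth is worth at least `exp (-β) / 2 * U' (2 (x - l))` per unit
(`maxReward_add_le`).

Time: dynamic programming on a short interval identifies the right derivative with `β v̂ - Ũ(∂ₓ v̂)
- G`, where `Ũ` is the conjugate of `U`. Concavity makes `∂ₓ v̂` jointly continuous, so this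
expression is continuous, and a continuous function with a continuous right derivative is `C¹`.

The market: let `δ > 0` be the slack in the discount condition. By Jensen's inequality and a
differential inequality for `K y ^ γ`, the discounted power of wealth pays in expectation for the
consumption of one period (`one_period`). Summing over the periods gives `v x ≤ K x ^ γ`. Since `v`
is also concave, it is Hölder continuous, and the continuity and growth of `G` follow. -/

noncomputable section

/-! ### Deterministic consumption rates -/

section Consumptions

variable {l t x : ℝ} {c : ℝ → ℝ}

theorem setIntegral_Ioc_add {c : ℝ → ℝ} {t r s : ℝ} (htr : t ≤ r) (hrs : r ≤ s)
    (hc : IntegrableOn c (Set.Ioc t s)) :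
    ∫ u in Set.Ioc t s, c u = (∫ u in Set.Ioc t r, c u) + ∫ u in Set.Ioc r s, c u := by
  rw [← Set.Ioc_union_Ioc_eq_Ioc htr hrs]
  exact setIntegral_union (Set.Ioc_disjoint_Ioc_of_le le_rfl) measurableSet_Ioc
    (hc.mono_set (Set.Ioc_subset_Ioc_right hrs)) (hc.mono_set (Set.Ioc_subset_Ioc_left htr))

/-- `c` is an admissible deterministic consumption rate for the wealth `x` at time `t`, when the
wealth `l` must be kept. -/
def IsConsumption (l t x : ℝ) (c : ℝ → ℝ) : Prop := c ∈ consumptions l t x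

namespace IsConsumption

theorem measurable (hc : IsConsumption l t x c) : Measurable c := hc.1

theorem nonneg (hc : IsConsumption l t x c) (s : ℝ) : 0 ≤ c s := hc.2.1 s

theorem integrableOn (hc : IsConsumption l t x c) {s : ℝ} (hs : t ≤ s) :
    IntegrableOn c (Set.Ioc t s) := (hc.2.2 s hs).1

theorem spent_le (hc : IsConsumption l t x c) {s : ℝ} (hs : t ≤ s) :
    ∫ u in Set.Ioc t s, c u ≤ x - l := (hc.2.2 s hs).2

theorem spent_nonneg (hc : IsConsumption l t x c) (r s : ℝ) :
    0 ≤ ∫ u in Set.Ioc r s, c u := integral_nonneg fun u => hc.nonneg u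

theorem integrableOn_Ioi (hc : IsConsumption l t x c) : IntegrableOn c (Set.Ioi t) := by
  refine integrableOn_Ioi_of_intervalIntegral_norm_bounded (l := atTop) (b := fun s : ℝ => max s t)
    (x - l) t (fun s => hc.integrableOn (le_max_right _ _)) (tendsto_atTop_mono (fun s => le_max_left s t) tendsto_id) ?_
  filter_upwards with s
  rw [intervalIntegral.integral_of_le (le_max_right _ _)]
  refine le_trans (le_of_eq ?_) (hc.spent_le (le_max_right s t))
  exact integral_congr_ae (Eventually.of_forall fun u => by simp [abs_of_nonneg (hc.nonneg u)])

theorem total_le (hc : IsConsumption l t x c) : ∫ u in Set.Ioi t, c u ≤ x - l := by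
  refine le_of_tendsto (intervalIntegral_tendsto_integral_Ioi t hc.integrableOn_Ioi tendsto_id) ?_
  filter_upwards [eventually_ge_atTop t] with s hs
  rw [id, intervalIntegral.integral_of_le hs]
  exact hc.spent_le hs

theorem spent_mono (hc : IsConsumption l t x c) {r s : ℝ} (hr : t ≤ r) (hrs : r ≤ s) :
    ∫ u in Set.Ioc t r, c u ≤ ∫ u in Set.Ioc t s, c u :=
  setIntegral_mono_set (hc.integrableOn (hr.trans hrs)) (Eventually.of_forall fun u => hc.nonneg u)
    (Set.Ioc_subset_Ioc_right hrs).eventuallyLE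

theorem restart (hc : IsConsumption l t x c) {r : ℝ} (hr : t ≤ r) :
    IsConsumption l r (x - ∫ u in Set.Ioc t r, c u) c := by
  refine ⟨hc.measurable, hc.nonneg, fun s hs => ⟨?_, ?_⟩⟩
  · exact (hc.integrableOn (hr.trans hs)).mono_set (Set.Ioc_subset_Ioc_left hr)
  · have h1 := setIntegral_Ioc_add hr hs (hc.integrableOn (hr.trans hs))
    have h2 := hc.spent_le (hr.trans hs)
    linarith

theorem spent_congr {c c' : ℝ → ℝ} {t s : ℝ} (h : ∀ u ∈ Set.Ioc t s, c u = c' u) :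
    ∫ u in Set.Ioc t s, c u = ∫ u in Set.Ioc t s, c' u :=
  setIntegral_congr_fun measurableSet_Ioc h

theorem concat {c' : ℝ → ℝ} (hc : IsConsumption l t x c) {r : ℝ} (hr : t ≤ r)
    (hc' : IsConsumption l r (x - ∫ u in Set.Ioc t r, c u) c') :
    IsConsumption l t x (fun s => if s ≤ r then c s else c' s) := by
  refine ⟨Measurable.ite measurableSet_Iic hc.measurable hc'.measurable, fun s => ?_, fun s hs => ?_⟩
  · dsimp only
    split_ifs
    exacts [hc.nonneg s, hc'.nonneg s]
  have key : ∀ s ≤ r, Set.EqOn (fun s => if s ≤ r then c s else c' s) c (Set.Ioc t s) :=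
    fun s hs u hu => if_pos (hu.2.trans hs)
  rcases le_total s r with hsr | hsr
  · exact ⟨(hc.integrableOn hs).congr_fun (key s hsr).symm measurableSet_Ioc,
      (spent_congr (key s hsr)).trans_le (hc.spent_le hs)⟩
  have key' : Set.EqOn (fun s => if s ≤ r then c s else c' s) c' (Set.Ioc r s) :=
    fun u hu => if_neg (not_le.2 hu.1)
  have hi : IntegrableOn (fun s => if s ≤ r then c s else c' s) (Set.Ioc t s) := by
    rw [← Set.Ioc_union_Ioc_eq_Ioc hr hsr]
    exact ((hc.integrableOn hr).congr_fun (key r le_rfl).symm measurableSet_Ioc).union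
      ((hc'.integrableOn hsr).congr_fun key'.symm measurableSet_Ioc)
  refine ⟨hi, ?_⟩
  rw [setIntegral_Ioc_add hr hsr hi, spent_congr (key r le_rfl), spent_congr key']
  linarith [hc'.spent_le hsr]

theorem mono {x' : ℝ} (hc : IsConsumption l t x c) (h : x ≤ x') : IsConsumption l t x' c :=
  ⟨hc.measurable, hc.nonneg, fun _ hs => ⟨hc.integrableOn hs, (hc.spent_le hs).trans (by linarith)⟩⟩

theorem zero_mem (h : l ≤ x) : IsConsumption l t x (fun _ => 0) :=
  ⟨measurable_const, fun _ => le_rfl, fun _ _ => ⟨integrableOn_zero, by simpa using h⟩⟩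

theorem spent_mix {c' : ℝ → ℝ} {x' : ℝ} (hc : IsConsumption l t x c)
    (hc' : IsConsumption l t x' c') (p q : ℝ) {s : ℝ} (hs : t ≤ s) :
    ∫ u in Set.Ioc t s, (p * c u + q * c' u) =
      p * (∫ u in Set.Ioc t s, c u) + q * ∫ u in Set.Ioc t s, c' u := by
  rw [integral_add ((hc.integrableOn hs).const_mul p) ((hc'.integrableOn hs).const_mul q),
    integral_const_mul, integral_const_mul]

theorem mix {c' : ℝ → ℝ} {x' p q : ℝ} (hc : IsConsumption l t x c)
    (hc' : IsConsumption l t x' c') (hp : 0 ≤ p) (hq : 0 ≤ q) (hpq : p + q = 1) :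
    IsConsumption l t (p * x + q * x') (fun s => p * c s + q * c' s) := by
  refine ⟨(hc.measurable.const_mul p).add (hc'.measurable.const_mul q), fun s => ?_, fun s hs => ⟨?_, ?_⟩⟩
  · exact add_nonneg (mul_nonneg hp (hc.nonneg s)) (mul_nonneg hq (hc'.nonneg s))
  · exact ((hc.integrableOn hs).const_mul p).add ((hc'.integrableOn hs).const_mul q)
  · rw [hc.spent_mix hc' p q hs]
    have h1 := mul_le_mul_of_nonneg_left (hc.spent_le hs) hp
    have h2 := mul_le_mul_of_nonneg_left (hc'.spent_le hs) hq
    have : l = p * l + q * l := by rw [← add_mul, hpq, one_mul]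
    linarith

theorem continuousOn_spent (hc : IsConsumption l t x c) :
    ContinuousOn (fun s => ∫ u in Set.Ioc t s, c u) (Set.Ici t) := by
  intro s hs
  have h := intervalIntegral.continuousOn_primitive
    ((integrableOn_Icc_iff_integrableOn_Ioc (by simp) (μ := volume)).2 (hc.integrableOn (s := s + 1) (by linarith [Set.mem_Ici.1 hs])))
  refine (h s ⟨hs, by linarith⟩).mono_of_mem_nhdsWithin ?_
  rw [mem_nhdsWithin]
  exact ⟨Set.Iio (s + 1), isOpen_Iio, by simp, fun u hu => ⟨hu.2, (Set.mem_Iio.1 hu.1).le⟩⟩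

theorem const_mem {h d : ℝ} (hh : 0 ≤ h) (hd : 0 ≤ d) (hx : d * h ≤ x - l) :
    IsConsumption l t x ((Set.Ioc t (t + h)).indicator (fun _ => d)) := by
  refine ⟨measurable_const.indicator measurableSet_Ioc, fun s => Set.indicator_nonneg (fun _ _ => hd) s,
    fun s hs => ⟨?_, ?_⟩⟩
  · exact (integrable_indicator_iff measurableSet_Ioc).2 (by simp) |>.integrableOn
  · rw [setIntegral_indicator measurableSet_Ioc]
    simp only [setIntegral_const, smul_eq_mul]
    refine le_trans ?_ hx
    rw [mul_comm]
    refine mul_le_mul_of_nonneg_left ?_ hd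
    refine (measureReal_mono (s₂ := Set.Ioc t (t + h)) Set.inter_subset_right (by simp)).trans ?_
    simp [hh]

end IsConsumption

end Consumptions

/-! ### The deterministic consumption problem -/

/-- A discounted deterministic consumption problem with utility `U` and running reward `G s y` at
time `s` and wealth `y`, where the wealth must stay above `l`. -/
structure ConsumptionProblem (U : ℝ → ℝ) (G : ℝ → ℝ → ℝ) (β l : ℝ) : Prop where
  β_pos : 0 < β
  strictMono : StrictMonoOn U (Set.Ici 0)
  concave : ConcaveOn ℝ (Set.Ici 0) U
  map_zero : U 0 = 0
  contDiff : ContDiffOn ℝ 1 U (Set.Ioi 0)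
  inada : Tendsto (deriv U) (𝓝[>] 0) atTop
  tendsto_zero : Tendsto U (𝓝[>] 0) (𝓝 0)
  sublinear : Tendsto (fun c => U c / c) atTop (𝓝 0)
  continuous_G : Continuous fun q : ℝ × ℝ => G q.1 q.2
  G_nonneg : ∀ s y, 0 ≤ G s y
  G_mono : ∀ s, Monotone (G s)
  G_concave : ∀ s, ConcaveOn ℝ (Set.Ici l) (G s)
  G_growth : ∃ b < β, ∀ y, ∃ C, ∀ s, 0 ≤ s → G s y ≤ C * Real.exp (b * s)

/-- The discounted rate of reward. -/
def rewardRate (U : ℝ → ℝ) (G : ℝ → ℝ → ℝ) (β t x : ℝ) (c : ℝ → ℝ) (s : ℝ) : ℝ :=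
  Real.exp (-β * (s - t)) * (U (c s) + G s (x - ∫ u in Set.Ioc t s, c u))

/-- The total discounted reward. -/
def reward (U : ℝ → ℝ) (G : ℝ → ℝ → ℝ) (β t x : ℝ) (c : ℝ → ℝ) : ℝ :=
  ∫ s in Set.Ioi t, rewardRate U G β t x c s

/-- The value of the deterministic consumption problem. -/
def maxReward (U : ℝ → ℝ) (G : ℝ → ℝ → ℝ) (β l t x : ℝ) : ℝ :=
  ⨆ c : {c // IsConsumption l t x c}, reward U G β t x c.1

theorem integrableOn_discount {β : ℝ} (hβ : 0 < β) (t : ℝ) :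
    IntegrableOn (fun s => Real.exp (-β * (s - t))) (Set.Ioi t) := by
  have := (integrableOn_exp_mul_Ioi (a := -β) (by linarith) t).const_mul (Real.exp (β * t))
  refine this.congr (Eventually.of_forall fun s => ?_)
  simp only [← Real.exp_add]
  ring_nf

theorem integral_discount {β : ℝ} (hβ : 0 < β) (t : ℝ) :
    ∫ s in Set.Ioi t, Real.exp (-β * (s - t)) = 1 / β := by
  have h : ∀ s, Real.exp (-β * (s - t)) = Real.exp (β * t) * Real.exp (-β * s) := fun s => by
    rw [← Real.exp_add]; ring_nf
  simp_rw [h]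
  rw [integral_const_mul, integral_exp_mul_Ioi (by linarith), mul_div_assoc', mul_neg,
    ← Real.exp_add]
  simp [neg_div_neg_eq]

theorem discount_le_one {β t s : ℝ} (hβ : 0 < β) (hs : t ≤ s) : Real.exp (-β * (s - t)) ≤ 1 :=
  Real.exp_le_one_iff.2 (by nlinarith)

/-- The chord slope beyond `y` is at most the one over `[l, y]`, which `0 ≤ f l` bounds by `f y / (y
- l)`. Local Lipschitz constants are thus controlled by the size of the function alone. -/
theorem ConcaveOn.sub_le_mul_div {f : ℝ → ℝ} {l x y : ℝ} (hf : ConcaveOn ℝ (Set.Ici l) f)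
    (h0 : 0 ≤ f l) (hy : l < y) (hyx : y ≤ x) : f x - f y ≤ (x - y) * (f y / (y - l)) := by
  rcases hyx.eq_or_lt with rfl | hyx
  · simp
  have h := hf.slope_anti_adjacent (Set.self_mem_Ici) (Set.mem_Ici.2 (hy.trans hyx).le) hy hyx
  rw [div_le_iff₀ (by linarith)] at h
  refine h.trans ?_
  rw [mul_comm]
  refine mul_le_mul_of_nonneg_left ?_ (by linarith)
  gcongr
  · linarith

/-! ### Finiteness, concavity and dynamic programming -/

namespace ConsumptionProblem

variable {U : ℝ → ℝ} {G : ℝ → ℝ → ℝ} {β l : ℝ} (h : ConsumptionProblem U G β l)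
include h

theorem U_mono {c d : ℝ} (hc : 0 ≤ c) (hcd : c ≤ d) : U c ≤ U d :=
  h.strictMono.monotoneOn hc (hc.trans hcd : (0 : ℝ) ≤ d) hcd

theorem U_nonneg {c : ℝ} (hc : 0 ≤ c) : 0 ≤ U c :=
  h.map_zero.symm.le.trans (h.U_mono le_rfl hc)

theorem U_pos {c : ℝ} (hc : 0 < c) : 0 < U c := by
  have := h.strictMono (Set.self_mem_Ici) (Set.mem_Ici.2 hc.le) hc
  rwa [h.map_zero] at this

theorem U_div_anti {r c : ℝ} (hr : 0 < r) (hrc : r ≤ c) : U c / c ≤ U r / r := by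
  rcases hrc.eq_or_lt with rfl | hrc
  · exact le_rfl
  have := h.concave.antitoneOn_slope_gt (Set.self_mem_Ici)
    (show r ∈ _ from ⟨hr.le, hr⟩) (show c ∈ _ from ⟨(hr.trans hrc).le, hr.trans hrc⟩) hrc.le
  simpa [slope_def_field, h.map_zero] using this

/-- Monotonicity covers small rates, the decrease of `U c / c` the large ones. For large `r` the
slope `U r / r` is tiny, so a bounded budget buys little utility in a short time. -/
theorem U_le_line {r c : ℝ} (hr : 0 < r) (hc : 0 ≤ c) : U c ≤ U r + U r / r * c := by
  have h0 : 0 ≤ U r / r := div_nonneg (h.U_nonneg hr.le) hr.le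
  rcases le_total c r with hcr | hrc
  · have := h.U_mono hc hcr
    have := mul_nonneg h0 hc
    linarith
  · have hc' : 0 < c := hr.trans_le hrc
    have := h.U_div_anti hr hrc
    rw [div_le_iff₀ hc'] at this
    linarith [h.U_nonneg hr.le]

theorem measurable_U_comp {c : ℝ → ℝ} (hc : Measurable c) (h0 : ∀ s, 0 ≤ c s) :
    Measurable fun s => U (c s) := by
  -- `U` is monotone only on `[0, ∞)`; the truncation is monotone on the whole line.
  have hm : Monotone fun y : ℝ => U (max y 0) := fun a b hab =>
    h.U_mono (le_max_right _ _) (max_le_max_right _ hab)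
  have := hm.measurable.comp hc
  simpa [Function.comp_def, max_eq_left (h0 _)] using this

section

variable {t x : ℝ} {c : ℝ → ℝ}

theorem integrableOn_utility (hc : IsConsumption l t x c) :
    IntegrableOn (fun s => Real.exp (-β * (s - t)) * U (c s)) (Set.Ioi t) := by
  have h1 : IntegrableOn (fun s => Real.exp (-β * (s - t)) * U 1 + U 1 * c s) (Set.Ioi t) :=
    ((integrableOn_discount h.β_pos t).mul_const _).add (hc.integrableOn_Ioi.const_mul _)
  refine h1.mono' ?_ ?_
  · exact ((by fun_prop : Measurable fun s => Real.exp (-β * (s - t))).mul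
      (h.measurable_U_comp hc.measurable hc.nonneg)).aestronglyMeasurable
  · filter_upwards [ae_restrict_mem measurableSet_Ioi] with s hs
    have h2 := h.U_nonneg (hc.nonneg s)
    have h3 := h.U_le_line one_pos (hc.nonneg s)
    have h4 := discount_le_one h.β_pos (Set.mem_Ioi.1 hs).le
    have h5 := Real.exp_pos (-β * (s - t))
    rw [Real.norm_of_nonneg (by positivity)]
    have h6 := mul_le_mul_of_nonneg_left h3 h5.le
    have h7 : 0 ≤ U 1 * c s := mul_nonneg (h.U_nonneg zero_le_one) (hc.nonneg s)
    rw [div_one] at h6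
    nlinarith

theorem integrableOn_discount_G (ht : 0 ≤ t) {Y : ℝ → ℝ} (hY : ContinuousOn Y (Set.Ioi t))
    (hYx : ∀ s, t < s → Y s ≤ x) :
    IntegrableOn (fun s => Real.exp (-β * (s - t)) * G s (Y s)) (Set.Ioi t) := by
  obtain ⟨b, hb, hC⟩ := h.G_growth
  obtain ⟨C, hC⟩ := hC x
  have h1 := ((integrableOn_exp_mul_Ioi (a := b - β) (by linarith) t).const_mul
    (Real.exp (β * t) * C))
  refine h1.mono' ?_ ?_
  · refine ContinuousOn.aestronglyMeasurable ?_ measurableSet_Ioi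
    refine ContinuousOn.mul (by fun_prop) ?_
    exact h.continuous_G.comp_continuousOn (continuousOn_id.prodMk hY)
  · filter_upwards [ae_restrict_mem measurableSet_Ioi] with s hs
    rw [Real.norm_of_nonneg (mul_nonneg (Real.exp_pos _).le (h.G_nonneg _ _))]
    have h2 : G s (Y s) ≤ C * Real.exp (b * s) :=
      (h.G_mono s (hYx s hs)).trans (hC s (ht.trans (Set.mem_Ioi.1 hs).le))
    refine (mul_le_mul_of_nonneg_left h2 (Real.exp_pos _).le).trans (le_of_eq ?_)
    rw [show Real.exp (-β * (s - t)) * (C * Real.exp (b * s)) =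
      C * (Real.exp (-β * (s - t)) * Real.exp (b * s)) by ring,
      show Real.exp (β * t) * C * Real.exp ((b - β) * s) =
      C * (Real.exp (β * t) * Real.exp ((b - β) * s)) by ring, ← Real.exp_add, ← Real.exp_add]
    ring_nf

theorem integrableOn_G_const (ht : 0 ≤ t) (x : ℝ) :
    IntegrableOn (fun s => Real.exp (-β * (s - t)) * G s x) (Set.Ioi t) :=
  h.integrableOn_discount_G ht continuousOn_const fun _ _ => le_rfl

theorem integrableOn_G_wealth (ht : 0 ≤ t) (hc : IsConsumption l t x c) :
    IntegrableOn (fun s => Real.exp (-β * (s - t)) * G s (x - ∫ u in Set.Ioc t s, c u))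
      (Set.Ioi t) :=
  h.integrableOn_discount_G ht
    (continuousOn_const.sub (hc.continuousOn_spent.mono Set.Ioi_subset_Ici_self))
    fun s _ => sub_le_self _ (hc.spent_nonneg t s)

theorem integrableOn_rewardRate (ht : 0 ≤ t) (hc : IsConsumption l t x c) :
    IntegrableOn (rewardRate U G β t x c) (Set.Ioi t) := by
  refine ((h.integrableOn_utility hc).add (h.integrableOn_G_wealth ht hc)).congr
    (Eventually.of_forall fun s => ?_)
  simp [rewardRate, mul_add]

theorem rewardRate_nonneg (hc : IsConsumption l t x c) (s : ℝ) : 0 ≤ rewardRate U G β t x c s :=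
  mul_nonneg (Real.exp_pos _).le (add_nonneg (h.U_nonneg (hc.nonneg s)) (h.G_nonneg _ _))

theorem reward_nonneg (hc : IsConsumption l t x c) : 0 ≤ reward U G β t x c :=
  integral_nonneg fun s => h.rewardRate_nonneg hc s

theorem rewardRate_le {r : ℝ} (hr : 0 < r) (hc : IsConsumption l t x c) {s : ℝ} (hs : t ≤ s) :
    rewardRate U G β t x c s ≤
      Real.exp (-β * (s - t)) * U r + U r / r * c s + Real.exp (-β * (s - t)) * G s x := by
  have h1 := h.U_le_line hr (hc.nonneg s)
  have h2 := h.G_mono s (sub_le_self x (hc.spent_nonneg t s))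
  have h3 := discount_le_one h.β_pos hs
  have h4 := Real.exp_pos (-β * (s - t))
  have h5 : 0 ≤ U r / r * c s :=
    mul_nonneg (div_nonneg (h.U_nonneg hr.le) hr.le) (hc.nonneg s)
  have h6 := mul_le_mul_of_nonneg_left (add_le_add h1 h2) h4.le
  rw [rewardRate]
  nlinarith

theorem reward_le (ht : 0 ≤ t) {r : ℝ} (hr : 0 < r) (hc : IsConsumption l t x c) :
    reward U G β t x c ≤
      1 / β * U r + U r / r * (x - l) + ∫ s in Set.Ioi t, Real.exp (-β * (s - t)) * G s x := by
  have i1 := (integrableOn_discount h.β_pos t).mul_const (U r)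
  have i2 := hc.integrableOn_Ioi.const_mul (U r / r)
  have i3 := h.integrableOn_G_const ht x
  have h1 : reward U G β t x c ≤ ∫ s in Set.Ioi t, (Real.exp (-β * (s - t)) * U r + U r / r * c s +
      Real.exp (-β * (s - t)) * G s x) :=
    setIntegral_mono_on (h.integrableOn_rewardRate ht hc) ((i1.add i2).add i3) measurableSet_Ioi
      fun s hs => h.rewardRate_le hr hc (Set.mem_Ioi.1 hs).le
  have i12 : IntegrableOn (fun s => Real.exp (-β * (s - t)) * U r + U r / r * c s) (Set.Ioi t) :=
    i1.add i2
  rw [integral_add i12 i3, integral_add i1 i2, integral_mul_const, integral_const_mul,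
    integral_discount h.β_pos] at h1
  have := mul_le_mul_of_nonneg_left hc.total_le (div_nonneg (h.U_nonneg hr.le) hr.le)
  linarith

theorem bddAbove_reward (ht : 0 ≤ t) :
    BddAbove (Set.range fun c : {c // IsConsumption l t x c} => reward U G β t x c.1) :=
  ⟨_, by rintro _ ⟨c, rfl⟩; exact h.reward_le ht one_pos c.2⟩

theorem reward_le_maxReward (ht : 0 ≤ t) (hc : IsConsumption l t x c) :
    reward U G β t x c ≤ maxReward U G β l t x :=
  le_ciSup (h.bddAbove_reward ht) (⟨c, hc⟩ : {c // IsConsumption l t x c})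

omit h in
theorem maxReward_le (hx : l ≤ x) {B : ℝ} (hB : ∀ c, IsConsumption l t x c → reward U G β t x c ≤ B) :
    maxReward U G β l t x ≤ B :=
  have : Nonempty {c // IsConsumption l t x c} := ⟨⟨_, IsConsumption.zero_mem hx⟩⟩
  ciSup_le fun c => hB c.1 c.2

omit h in
theorem exists_lt_reward (hx : l ≤ x) {δ : ℝ} (hδ : 0 < δ) :
    ∃ c, IsConsumption l t x c ∧ maxReward U G β l t x - δ < reward U G β t x c := by
  have : Nonempty {c // IsConsumption l t x c} := ⟨⟨_, IsConsumption.zero_mem hx⟩⟩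
  obtain ⟨c, hc⟩ := exists_lt_of_lt_ciSup (sub_lt_self (maxReward U G β l t x) hδ)
  exact ⟨c.1, c.2, hc⟩

theorem maxReward_nonneg : 0 ≤ maxReward U G β l t x :=
  Real.iSup_nonneg fun c => h.reward_nonneg c.2

theorem maxReward_mono (ht : 0 ≤ t) {x' : ℝ} (hx : l ≤ x) (hxx : x ≤ x') :
    maxReward U G β l t x ≤ maxReward U G β l t x' := by
  refine maxReward_le hx fun c hc => le_trans ?_ (h.reward_le_maxReward ht (hc.mono hxx))
  refine setIntegral_mono_on (h.integrableOn_rewardRate ht hc)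
    (h.integrableOn_rewardRate ht (hc.mono hxx)) measurableSet_Ioi fun s _ => ?_
  unfold rewardRate
  have := h.G_mono s (sub_le_sub_right hxx (∫ u in Set.Ioc t s, c u))
  gcongr

/-- A mixture of two rates produces the same mixture of the wealth paths, so concavity of `U` and of
`G s` passes to the reward, and then to the supremum through nearly optimal rates. -/
theorem concaveOn_maxReward (ht : 0 ≤ t) :
    ConcaveOn ℝ (Set.Ici l) (maxReward U G β l t) := by
  refine ⟨convex_Ici l, fun x hx y hy p q hp hq hpq => ?_⟩
  simp only [smul_eq_mul]
  refine le_of_forall_pos_le_add fun δ hδ => ?_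
  obtain ⟨c, hc, hcx⟩ := exists_lt_reward (U := U) (G := G) (β := β) (t := t) (Set.mem_Ici.1 hx) hδ
  obtain ⟨d, hd, hdy⟩ := exists_lt_reward (U := U) (G := G) (β := β) (t := t) (Set.mem_Ici.1 hy) hδ
  have hm := hc.mix hd hp hq hpq
  have h1 : p * reward U G β t x c + q * reward U G β t y d ≤
      reward U G β t (p * x + q * y) fun s => p * c s + q * d s := by
    have i1 := (h.integrableOn_rewardRate ht hc).const_mul p
    have i2 := (h.integrableOn_rewardRate ht hd).const_mul q
    rw [reward, reward, reward, ← integral_const_mul, ← integral_const_mul, ← integral_add i1 i2]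
    refine setIntegral_mono_on (i1.add i2) (h.integrableOn_rewardRate ht hm) measurableSet_Ioi
      fun s hs => ?_
    have hs := (Set.mem_Ioi.1 hs).le
    unfold rewardRate
    rw [hc.spent_mix hd p q hs]
    have e1 := h.concave.2 (Set.mem_Ici.2 (hc.nonneg s)) (Set.mem_Ici.2 (hd.nonneg s)) hp hq hpq
    have e2 := (h.G_concave s).2 (x := x - ∫ u in Set.Ioc t s, c u)
      (y := y - ∫ u in Set.Ioc t s, d u)
      (Set.mem_Ici.2 (by linarith [hc.spent_le hs])) (Set.mem_Ici.2 (by linarith [hd.spent_le hs]))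
      hp hq hpq
    simp only [smul_eq_mul] at e1 e2
    rw [show p * x + q * y - (p * (∫ u in Set.Ioc t s, c u) + q * ∫ u in Set.Ioc t s, d u) =
      p * (x - ∫ u in Set.Ioc t s, c u) + q * (y - ∫ u in Set.Ioc t s, d u) by ring]
    have := mul_le_mul_of_nonneg_left (add_le_add e1 e2) (Real.exp_pos (-β * (s - t))).le
    linarith
  have h2 := h.reward_le_maxReward ht hm
  have h3 : p * maxReward U G β l t x ≤ p * (reward U G β t x c + δ) := by gcongr; linarith
  have h4 : q * maxReward U G β l t y ≤ q * (reward U G β t y d + δ) := by gcongr; linarith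
  have h5 : p * δ + q * δ = δ := by rw [← add_mul, hpq, one_mul]
  linarith

/-- Splitting of the reward at an intermediate time. -/
theorem reward_eq_add (ht : 0 ≤ t) (hc : IsConsumption l t x c) {r : ℝ} (hr : t ≤ r) :
    reward U G β t x c = (∫ s in Set.Ioc t r, rewardRate U G β t x c s) +
      Real.exp (-β * (r - t)) * reward U G β r (x - ∫ u in Set.Ioc t r, c u) c := by
  have hi := h.integrableOn_rewardRate ht hc
  rw [reward, ← Set.Ioc_union_Ioi_eq_Ioi hr, setIntegral_union
    Set.Ioc_disjoint_Ioi_same measurableSet_Ioi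
    (hi.mono_set Set.Ioc_subset_Ioi_self) (hi.mono_set (Set.Ioi_subset_Ioi hr))]
  congr 1
  rw [reward, ← integral_const_mul]
  refine setIntegral_congr_fun measurableSet_Ioi fun s hs => ?_
  have hs := (Set.mem_Ioi.1 hs).le
  simp only [rewardRate]
  rw [← mul_assoc, ← Real.exp_add, setIntegral_Ioc_add hr hs (hc.integrableOn (hr.trans hs)),
    sub_add_eq_sub_sub]
  ring_nf

/-- Together with `add_maxReward_le` this is the dynamic programming principle, as two inequalities
that do not require the supremum to be attained. -/
theorem reward_le_add_maxReward (ht : 0 ≤ t) (hc : IsConsumption l t x c) {r : ℝ} (hr : t ≤ r) :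
    reward U G β t x c ≤ (∫ s in Set.Ioc t r, rewardRate U G β t x c s) +
      Real.exp (-β * (r - t)) * maxReward U G β l r (x - ∫ u in Set.Ioc t r, c u) := by
  rw [h.reward_eq_add ht hc hr]
  gcongr
  exact h.reward_le_maxReward (ht.trans hr) (hc.restart hr)

theorem add_maxReward_le (ht : 0 ≤ t) (hc : IsConsumption l t x c) {r : ℝ} (hr : t ≤ r) :
    (∫ s in Set.Ioc t r, rewardRate U G β t x c s) +
      Real.exp (-β * (r - t)) * maxReward U G β l r (x - ∫ u in Set.Ioc t r, c u) ≤
      maxReward U G β l t x := by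
  have he : 0 < Real.exp (-β * (r - t)) := Real.exp_pos _
  rw [← le_sub_iff_add_le', ← le_div_iff₀' he]
  refine maxReward_le (by linarith [hc.spent_le hr]) fun d hd => ?_
  rw [le_div_iff₀' he, le_sub_iff_add_le']
  have hcd := hc.concat hr hd
  refine le_trans (le_of_eq ?_) (h.reward_le_maxReward ht hcd)
  have e1 : ∀ s ≤ r, ∫ u in Set.Ioc t s, (if u ≤ r then c u else d u) = ∫ u in Set.Ioc t s, c u :=
    fun s hs => IsConsumption.spent_congr fun u hu => if_pos (hu.2.trans hs)
  rw [h.reward_eq_add ht hcd hr, e1 r le_rfl]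
  congr 1
  · refine setIntegral_congr_fun measurableSet_Ioc fun s hs => ?_
    simp only [rewardRate]
    rw [e1 s hs.2, if_pos hs.2]
  · congr 1
    refine setIntegral_congr_fun measurableSet_Ioi fun s hs => ?_
    simp only [rewardRate]
    rw [if_neg (not_le.2 (Set.mem_Ioi.1 hs))]
    congr 3
    congr 1
    exact (IsConsumption.spent_congr fun u hu => if_neg (not_le.2 hu.1)).symm

/-- Waiting without consuming is not better than the optimum. -/
theorem wait_le_maxReward (ht : 0 ≤ t) (hx : l ≤ x) {r : ℝ} (hr : t ≤ r) :
    (∫ s in Set.Ioc t r, Real.exp (-β * (s - t)) * G s x) +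
      Real.exp (-β * (r - t)) * maxReward U G β l r x ≤ maxReward U G β l t x := by
  have := h.add_maxReward_le ht (IsConsumption.zero_mem (t := t) hx) hr
  simpa [rewardRate, h.map_zero] using this

end

end ConsumptionProblem

theorem ConcaveOn.add_sub_anti {f : ℝ → ℝ} {S : Set ℝ} (hf : ConcaveOn ℝ S f) {a b d : ℝ}
    (ha : a ∈ S) (hbd : b + d ∈ S) (hab : a ≤ b) (hd : 0 ≤ d) :
    f (b + d) - f b ≤ f (a + d) - f a := by
  rcases (add_nonneg (sub_nonneg.2 hab) hd).eq_or_lt with h0 | hD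
  · have h1 : a = b := by linarith
    rw [h1]
  have hD' : b - a + d ≠ 0 := hD.ne'
  have e : (b - a) / (b - a + d) + d / (b - a + d) = 1 := by field_simp
  have h1 := hf.2 ha hbd (div_nonneg (sub_nonneg.2 hab) hD.le) (div_nonneg hd hD.le) e
  have h2 := hf.2 ha hbd (div_nonneg hd hD.le) (div_nonneg (sub_nonneg.2 hab) hD.le)
    ((add_comm _ _).trans e)
  simp only [smul_eq_mul] at h1 h2
  rw [show (b - a) / (b - a + d) * a + d / (b - a + d) * (b + d) = a + d by field_simp; ring] at h1
  rw [show d / (b - a + d) * a + (b - a) / (b - a + d) * (b + d) = b by field_simp; ring] at h2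
  have e1 : f a + f (b + d) = ((b - a) / (b - a + d) + d / (b - a + d)) * (f a + f (b + d)) := by
    rw [e, one_mul]
  linarith

namespace IsConsumption

variable {l t x : ℝ} {c : ℝ → ℝ}

theorem add {e : ℝ → ℝ} {d : ℝ} (hc : IsConsumption l t x c) (he : IsConsumption 0 t d e) :
    IsConsumption l t (x + d) (fun s => c s + e s) := by
  refine ⟨hc.measurable.add he.measurable, fun s => add_nonneg (hc.nonneg s) (he.nonneg s),
    fun s hs => ⟨(hc.integrableOn hs).add (he.integrableOn hs), ?_⟩⟩
  rw [integral_add (hc.integrableOn hs) (he.integrableOn hs)]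
  linarith [hc.spent_le hs, he.spent_le hs]

theorem measure_mul_le (hc : IsConsumption l t x c) {r C : ℝ} (hr : t ≤ r) :
    volume.real {s | s ∈ Set.Ioc t r ∧ C < c s} * C ≤ x - l := by
  have hm : MeasurableSet {s | s ∈ Set.Ioc t r ∧ C < c s} :=
    measurableSet_Ioc.inter (measurableSet_lt measurable_const hc.measurable)
  have hsub : {s | s ∈ Set.Ioc t r ∧ C < c s} ⊆ Set.Ioc t r := fun s hs => hs.1
  calc volume.real {s | s ∈ Set.Ioc t r ∧ C < c s} * C
      = ∫ _ in {s | s ∈ Set.Ioc t r ∧ C < c s}, C := by rw [setIntegral_const, smul_eq_mul]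
    _ ≤ ∫ s in {s | s ∈ Set.Ioc t r ∧ C < c s}, c s := by
        refine setIntegral_mono_on ?_ ((hc.integrableOn hr).mono_set hsub) hm fun s hs => hs.2.le
        exact integrableOn_const ((measure_mono hsub).trans_lt (by simp)).ne
    _ ≤ ∫ s in Set.Ioc t r, c s := setIntegral_mono_set (hc.integrableOn hr)
        (Eventually.of_forall fun u => hc.nonneg u) hsub.eventuallyLE
    _ ≤ x - l := hc.spent_le hr

end IsConsumption

/-! ### Value of additional wealth and strict gain from consuming -/

namespace ConsumptionProblem

variable {U : ℝ → ℝ} {G : ℝ → ℝ → ℝ} {β l : ℝ} (h : ConsumptionProblem U G β l)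
include h

variable {t x : ℝ}

/-- A uniform lower bound for the increments of the value. -/
theorem maxReward_add_le (ht : 0 ≤ t) {y : ℝ} (hy : l < y) (hyx : y ≤ x) :
    maxReward U G β l t y +
      Real.exp (-β) * (1 / 2) * (U (2 * (y - l) + (x - y)) - U (2 * (y - l))) ≤
      maxReward U G β l t x := by
  rw [← le_sub_iff_add_le]
  refine maxReward_le hy.le fun c hc => ?_
  rw [le_sub_iff_add_le]
  -- By Markov's inequality the rate `c` exceeds `C` for a time at most `1 / 2` within `(t, t + 1]`.
  -- The surplus `d`, consumed at constant rate over that interval, therefore earns at least `U (C +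
  -- d) - U C` on a set `B` of measure at least `1 / 2`.
  set C := 2 * (y - l)
  set d := x - y
  have hC : 0 < C := by simp only [C]; linarith
  have hd : 0 ≤ d := sub_nonneg.2 hyx
  have he : IsConsumption 0 t d ((Set.Ioc t (t + 1)).indicator fun _ => d) :=
    IsConsumption.const_mem zero_le_one hd (by simp)
  have hce := hc.add he
  rw [show y + d = x by simp [d]] at hce
  refine le_trans ?_ (h.reward_le_maxReward ht hce)
  set B := {s | s ∈ Set.Ioc t (t + 1) ∧ c s ≤ C}
  have hB : MeasurableSet B :=
    measurableSet_Ioc.inter (measurableSet_le hc.measurable measurable_const)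
  have hBm : 1 / 2 ≤ volume.real B := by
    have h1 := hc.measure_mul_le (r := t + 1) (C := C) (by linarith)
    have h2 : volume.real (Set.Ioc t (t + 1)) = 1 := by simp
    have h3 : B ∪ {s | s ∈ Set.Ioc t (t + 1) ∧ C < c s} = Set.Ioc t (t + 1) := by
      ext s
      simp only [B, Set.mem_union, Set.mem_ofPred_eq]
      constructor
      · rintro (hs | hs) <;> exact hs.1
      · intro hs
        rcases le_or_gt (c s) C with h | h
        exacts [Or.inl ⟨hs, h⟩, Or.inr ⟨hs, h⟩]
    have h4 := measureReal_union_le (μ := volume) B {s | s ∈ Set.Ioc t (t + 1) ∧ C < c s}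
    rw [h3, h2] at h4
    have h5 : volume.real {s | s ∈ Set.Ioc t (t + 1) ∧ C < c s} ≤ 1 / 2 := by
      simp only [C] at h1 ⊢
      nlinarith
    linarith
  set g := U (C + d) - U C
  have hg : 0 ≤ g := sub_nonneg.2 (h.U_mono hC.le (by linarith))
  have hBi : IntegrableOn (B.indicator fun _ => Real.exp (-β) * g) (Set.Ioi t) := by
    refine ((integrable_indicator_iff hB).2 (integrableOn_const ?_)).integrableOn
    exact ((measure_mono (fun s hs => hs.1 : B ⊆ Set.Ioc t (t + 1))).trans_lt (by simp)).ne
  have hi := h.integrableOn_rewardRate ht hc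
  calc reward U G β t y c + Real.exp (-β) * (1 / 2) * g
      ≤ reward U G β t y c + ∫ s in Set.Ioi t, B.indicator (fun _ => Real.exp (-β) * g) s := by
        rw [setIntegral_indicator hB, Set.inter_eq_right.2 (show B ⊆ Set.Ioi t from fun s hs => hs.1.1),
          setIntegral_const, smul_eq_mul]
        have := mul_le_mul_of_nonneg_right hBm (mul_nonneg (Real.exp_pos (-β)).le hg)
        linarith
    _ = ∫ s in Set.Ioi t, (rewardRate U G β t y c s +
          B.indicator (fun _ => Real.exp (-β) * g) s) := (integral_add hi hBi).symm
    _ ≤ _ := by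
        refine setIntegral_mono_on (hi.add hBi) (h.integrableOn_rewardRate ht hce)
          measurableSet_Ioi fun s hs => ?_
        have hs := (Set.mem_Ioi.1 hs).le
        have hG : G s (y - ∫ u in Set.Ioc t s, c u) ≤ G s (x - ∫ u in Set.Ioc t s,
            (c u + (Set.Ioc t (t + 1)).indicator (fun _ => d) u)) := by
          refine h.G_mono s ?_
          rw [integral_add (hc.integrableOn hs) (he.integrableOn hs)]
          have h6 := he.spent_le hs
          simp only [d] at h6 ⊢
          linarith
        have hU : U (c s) ≤ U (c s + (Set.Ioc t (t + 1)).indicator (fun _ => d) s) :=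
          h.U_mono (hc.nonneg s) (le_add_of_nonneg_right (he.nonneg s))
        simp only [rewardRate]
        by_cases hsB : s ∈ B
        · rw [Set.indicator_of_mem hsB, Set.indicator_of_mem hsB.1]
          have e1 := h.concave.add_sub_anti (hc.nonneg s) (add_nonneg hC.le hd : C + d ∈ Set.Ici 0)
            hsB.2 hd
          have e2 : Real.exp (-β) ≤ Real.exp (-β * (s - t)) := by
            refine Real.exp_le_exp.2 ?_
            nlinarith [hsB.1.2, h.β_pos]
          rw [Set.indicator_of_mem hsB.1] at hU
          have e3 : Real.exp (-β) * g ≤ Real.exp (-β * (s - t)) * (U (c s + d) - U (c s)) :=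
            mul_le_mul e2 e1 hg (Real.exp_pos _).le
          have e4 := mul_le_mul_of_nonneg_left hG (Real.exp_pos (-β * (s - t))).le
          linarith
        · rw [Set.indicator_of_notMem hsB, add_zero]
          gcongr

/-- By the Inada condition, waiting without consuming is not optimal. -/
theorem wait_lt_maxReward (ht : 0 ≤ t) (hx : l < x) {ε : ℝ} (hε : 0 < ε) :
    (∫ s in Set.Ioc t (t + ε), Real.exp (-β * (s - t)) * G s x) +
      Real.exp (-β * ε) * maxReward U G β l (t + ε) x < maxReward U G β l t x := by
  set I := ∫ s in Set.Ioc t (t + ε), Real.exp (-β * (s - t)) * G s x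
  set W := Real.exp (-β * ε) * maxReward U G β l (t + ε) x
  have hI : 0 ≤ I := setIntegral_nonneg measurableSet_Ioc fun s _ =>
    mul_nonneg (Real.exp_pos _).le (h.G_nonneg _ _)
  have hW : 0 ≤ W := mul_nonneg (Real.exp_pos _).le h.maxReward_nonneg
  have hlx : 0 < x - l := sub_pos.2 hx
  -- Consuming at a small rate `r` during `(t, t + ε]` costs at most the fraction `r * ε * (2 / (x -
  -- l))` of `I + W` and earns at least `exp (-β * ε) * ε * U r`. Since `U r / r ≥ deriv U r → ∞`,
  -- the gain wins for small `r`.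
  obtain ⟨r, hr0, hrx, hrU⟩ : ∃ r, 0 < r ∧ r * ε ≤ (x - l) / 2 ∧
      r * ε * (2 / (x - l)) * (I + W) < Real.exp (-β * ε) * ε * U r := by
    set M := ε * (2 / (x - l)) * (I + W) / (Real.exp (-β * ε) * ε) with hM
    have e1 : ∀ᶠ r in 𝓝[>] (0 : ℝ), M + 1 ≤ deriv U r := h.inada.eventually_ge_atTop _
    obtain ⟨r₀, hr₀, hr₀'⟩ := (mem_nhdsGT_iff_exists_Ioo_subset).1 e1
    set r := min (r₀ / 2) ((x - l) / 2 / ε)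
    have hr₀ : 0 < r₀ := hr₀
    have hr : 0 < r := lt_min (by positivity) (by positivity)
    refine ⟨r, hr, ?_, ?_⟩
    · calc r * ε ≤ (x - l) / 2 / ε * ε := by gcongr; exact min_le_right _ _
        _ = (x - l) / 2 := by field_simp
    · have hrr : r < r₀ := (min_le_left _ _).trans_lt (by linarith)
      have hd : DifferentiableAt ℝ U r :=
        ((h.contDiff.differentiableOn (by norm_num)) r hr).differentiableAt (Ioi_mem_nhds hr)
      have h1 := h.concave.deriv_le_slope (Set.self_mem_Ici) hr.le hr hd
      have h2 : M + 1 ≤ deriv U r := hr₀' ⟨hr, hrr⟩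
      rw [slope_def_field, h.map_zero, sub_zero, sub_zero] at h1
      have h3 : M < U r / r := by linarith
      rw [hM, lt_div_iff₀ hr, div_mul_eq_mul_div, div_lt_iff₀ (by positivity)] at h3
      linarith
  have hc : IsConsumption l t x ((Set.Ioc t (t + ε)).indicator fun _ => r) :=
    IsConsumption.const_mem hε.le hr0.le (by linarith)
  have hte : t ≤ t + ε := by linarith
  have key := h.add_maxReward_le ht hc hte
  have hsp : ∀ s ∈ Set.Ioc t (t + ε),
      ∫ u in Set.Ioc t s, (Set.Ioc t (t + ε)).indicator (fun _ => r) u = r * (s - t) := by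
    intro s hs
    rw [IsConsumption.spent_congr (c' := fun _ => r)
      (fun u hu => Set.indicator_of_mem (show u ∈ Set.Ioc t (t + ε) from
        ⟨hu.1, hu.2.trans hs.2⟩) _)]
    simp [mul_comm, hs.1.le]
  rw [hsp (t + ε) ⟨by linarith, le_rfl⟩, add_sub_cancel_left] at key
  set θ := r * ε * (2 / (x - l))
  -- One estimate for both `G s` and the continuation value: a nonnegative, nondecreasing concave
  -- function loses at most the fraction `θ` when the wealth drops by at most `r * ε ≤ (x - l) / 2`.
  have bound : ∀ {f : ℝ → ℝ}, ConcaveOn ℝ (Set.Ici l) f → Monotone f ∨ MonotoneOn f (Set.Ici l) →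
      0 ≤ f l → ∀ d, 0 ≤ d → d ≤ r * ε → f x * (1 - θ) ≤ f (x - d) := by
    intro f hf hm h0 d hd hdr
    have hm' : MonotoneOn f (Set.Ici l) := hm.elim (fun hm => hm.monotoneOn _) id
    have hd2 : (x - l) / 2 ≤ x - d - l := by linarith
    have h1 := hf.sub_le_mul_div h0 (y := x - d) (x := x) (by linarith) (by linarith)
    have h2 : f (x - d) ≤ f x := hm' (by simp; linarith) (by simp; linarith) (by linarith)
    have h3 : 0 ≤ f (x - d) := h0.trans (hm' (by simp) (by simp; linarith) (by linarith))
    have h4 : f (x - d) / (x - d - l) ≤ f x / ((x - l) / 2) := by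
      gcongr
      linarith
    have h5 : (x - (x - d)) * (f (x - d) / (x - d - l)) ≤ r * ε * (f x / ((x - l) / 2)) := by
      refine mul_le_mul (by linarith) h4 (div_nonneg h3 (by linarith)) (by positivity)
    have h6 : r * ε * (f x / ((x - l) / 2)) = θ * f x := by
      simp only [θ]; field_simp
    linarith
  have b2 : W * (1 - θ) ≤ Real.exp (-β * ε) * maxReward U G β l (t + ε) (x - r * ε) := by
    have := bound (h.concaveOn_maxReward (t := t + ε) (by linarith)) (Or.inr fun a ha b _ hab =>
      h.maxReward_mono (by linarith) ha hab) h.maxReward_nonneg (r * ε) (by positivity) le_rfl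
    simp only [W]
    rw [mul_assoc]
    gcongr
  have iG : IntegrableOn (fun s => Real.exp (-β * (s - t)) * G s x) (Set.Ioc t (t + ε)) :=
    (h.integrableOn_G_const ht x).mono_set Set.Ioc_subset_Ioi_self
  have iC : IntegrableOn (fun _ => Real.exp (-β * ε) * U r) (Set.Ioc t (t + ε)) :=
    integrableOn_const (by simp)
  have b1 : I * (1 - θ) + Real.exp (-β * ε) * ε * U r ≤ ∫ s in Set.Ioc t (t + ε),
      rewardRate U G β t x ((Set.Ioc t (t + ε)).indicator fun _ => r) s := by
    have e0 : I * (1 - θ) + Real.exp (-β * ε) * ε * U r = ∫ s in Set.Ioc t (t + ε),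
        (Real.exp (-β * (s - t)) * G s x * (1 - θ) + Real.exp (-β * ε) * U r) := by
      rw [integral_add (iG.mul_const _) iC, integral_mul_const]
      simp [hε.le, I]
      ring
    rw [e0]
    refine setIntegral_mono_on ((iG.mul_const _).add iC)
      ((h.integrableOn_rewardRate ht hc).mono_set Set.Ioc_subset_Ioi_self) measurableSet_Ioc
      fun s hs => ?_
    rw [rewardRate, hsp s hs, Set.indicator_of_mem hs]
    have e1 := bound (h.G_concave s) (Or.inl (h.G_mono s)) (h.G_nonneg _ _) (r * (s - t))
      (mul_nonneg hr0.le (by linarith [hs.1])) (by gcongr; linarith [hs.2])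
    have e2 : Real.exp (-β * ε) ≤ Real.exp (-β * (s - t)) :=
      Real.exp_le_exp.2 (by nlinarith [hs.2, h.β_pos])
    have e3 := mul_le_mul_of_nonneg_right e2 (h.U_nonneg hr0.le)
    have e4 := mul_le_mul_of_nonneg_left e1 (Real.exp_pos (-β * (s - t))).le
    linarith
  have : (I + W) * (1 - θ) = I + W - θ * (I + W) := by ring
  linarith

end ConsumptionProblem

/-- A concave function with small second differences is differentiable. -/
theorem ConcaveOn.differentiableAt_of_second_difference {f : ℝ → ℝ} {S : Set ℝ}
    (hf : ConcaveOn ℝ S f) {x : ℝ} (hx : x ∈ interior S)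
    (h2 : ∀ η > 0, ∃ h₀ > 0, ∀ h, 0 < h → h < h₀ → 2 * f x - η * h ≤ f (x + h) + f (x - h)) :
    DifferentiableAt ℝ f x := by
  have hn : ConvexOn ℝ S (-f) := hf.neg
  obtain ⟨p, hp⟩ : ∃ p, HasDerivWithinAt f p (Set.Ioi x) x := by
    have := (hn.hasDerivWithinAt_rightDeriv_of_mem_interior hx).neg
    rw [neg_neg] at this
    exact ⟨_, this⟩
  obtain ⟨q, hq⟩ : ∃ q, HasDerivWithinAt f q (Set.Iio x) x := by
    have := (hn.hasDerivWithinAt_leftDeriv_of_mem_interior hx).neg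
    rw [neg_neg] at this
    exact ⟨_, this⟩
  have hpq : p ≤ q := by
    have h1 := hn.leftDeriv_le_rightDeriv_of_mem_interior hx
    rw [hp.neg.derivWithin (uniqueDiffWithinAt_Ioi x),
      hq.neg.derivWithin (uniqueDiffWithinAt_Iio x)] at h1
    linarith
  have t1 : Tendsto (fun h : ℝ => (f (x + h) - f x) / h) (𝓝[>] 0) (𝓝 p) := by
    have := hasDerivWithinAt_iff_tendsto_slope.1 hp
    rw [Set.sdiff_singleton_eq_self (by simp)] at this
    have hg : Tendsto (fun h : ℝ => x + h) (𝓝[>] 0) (𝓝[>] x) := by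
      refine tendsto_nhdsWithin_iff.2 ⟨?_, ?_⟩
      · exact (Continuous.tendsto' (by fun_prop) _ _ (by simp)).mono_left nhdsWithin_le_nhds
      · filter_upwards [self_mem_nhdsWithin] with h hh
        simpa using hh
    refine (this.comp hg).congr fun h => ?_
    simp [slope_def_field]
  have t2 : Tendsto (fun h : ℝ => (f x - f (x - h)) / h) (𝓝[>] 0) (𝓝 q) := by
    have := hasDerivWithinAt_iff_tendsto_slope.1 hq
    rw [Set.sdiff_singleton_eq_self (by simp)] at this
    have hg : Tendsto (fun h : ℝ => x - h) (𝓝[>] 0) (𝓝[<] x) := by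
      refine tendsto_nhdsWithin_iff.2 ⟨?_, ?_⟩
      · exact (Continuous.tendsto' (by fun_prop) _ _ (by simp)).mono_left nhdsWithin_le_nhds
      · filter_upwards [self_mem_nhdsWithin] with h hh
        simpa using hh
    refine (this.comp hg).congr fun h => ?_
    simp only [Function.comp, slope_def_field, sub_sub_cancel_left, div_neg, ← neg_div]
    ring
  -- Concavity has given `p ≤ q` for the right derivative `p` and the left derivative `q`. The
  -- second difference divided by `h` tends to `p - q`, which gives the converse.
  have hqp : q ≤ p := by
    refine le_of_forall_pos_le_add fun η hη => ?_
    obtain ⟨h₀, hh₀, hh⟩ := h2 η hη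
    have : 0 ≤ p - q + η := by
      refine ge_of_tendsto ((t1.sub t2).add_const η) ?_
      filter_upwards [Ioo_mem_nhdsGT hh₀] with h hm
      have h3 := hh h hm.1 hm.2
      have h4 := hm.1
      rw [← sub_div, ← sub_le_iff_le_add, zero_sub, le_div_iff₀ hm.1]
      linarith
    linarith
  obtain rfl : p = q := le_antisymm hpq hqp
  have := (hasDerivWithinAt_Ioi_iff_Ici.1 hp).union (hasDerivWithinAt_Iio_iff_Iic.1 hq)
  rw [Set.Ici_union_Iic] at this
  exact (hasDerivWithinAt_univ.1 this).differentiableAt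

/-! ### Differentiability in the wealth -/

namespace ConsumptionProblem

variable {U : ℝ → ℝ} {G : ℝ → ℝ → ℝ} {β l : ℝ} (h : ConsumptionProblem U G β l)
include h

variable {t x : ℝ}

/-- The running reward is evaluated at the full wealth `x`, so that spending enters only through its
utility and through the loss of final value. -/
theorem reward_le_utility_add (ht : 0 ≤ t) {c : ℝ → ℝ} (hc : IsConsumption l t x c) {r : ℝ}
    (hr : t ≤ r) :
    reward U G β t x c ≤ (∫ s in Set.Ioc t r, Real.exp (-β * (s - t)) * U (c s)) +
      (∫ s in Set.Ioc t r, Real.exp (-β * (s - t)) * G s x) +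
      Real.exp (-β * (r - t)) * maxReward U G β l r (x - ∫ u in Set.Ioc t r, c u) := by
  refine (h.reward_le_add_maxReward ht hc hr).trans (add_le_add_left ?_ _)
  have i1 := (h.integrableOn_utility hc).mono_set (show Set.Ioc t r ⊆ _ from Set.Ioc_subset_Ioi_self)
  have i2 := (h.integrableOn_G_const ht x).mono_set (show Set.Ioc t r ⊆ _ from Set.Ioc_subset_Ioi_self)
  rw [← integral_add i1 i2]
  refine setIntegral_mono_on ((h.integrableOn_rewardRate ht hc).mono_set Set.Ioc_subset_Ioi_self)
    (i1.add i2) measurableSet_Ioc fun s _ => ?_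
  rw [rewardRate, mul_add]
  have := h.G_mono s (sub_le_self x (hc.spent_nonneg t s))
  gcongr

theorem integral_utility_le {c : ℝ → ℝ} (hc : IsConsumption l t x c) {a r : ℝ} (ha : 0 < a)
    (hr : t ≤ r) : ∫ s in Set.Ioc t r, Real.exp (-β * (s - t)) * U (c s) ≤
      (r - t) * U a + U a / a * (x - l) := by
  have i1 := (h.integrableOn_utility hc).mono_set (show Set.Ioc t r ⊆ _ from Set.Ioc_subset_Ioi_self)
  have i2 : IntegrableOn (fun _ : ℝ => U a) (Set.Ioc t r) := integrableOn_const (by simp)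
  have i3 : IntegrableOn (fun s => U a / a * c s) (Set.Ioc t r) := (hc.integrableOn hr).const_mul _
  have h0 : 0 ≤ U a / a := div_nonneg (h.U_nonneg ha.le) ha.le
  calc ∫ s in Set.Ioc t r, Real.exp (-β * (s - t)) * U (c s)
      ≤ ∫ s in Set.Ioc t r, (U a + U a / a * c s) := by
        refine setIntegral_mono_on i1 (i2.add i3) measurableSet_Ioc fun s hs => ?_
        exact (mul_le_of_le_one_left (h.U_nonneg (hc.nonneg s))
          (discount_le_one h.β_pos hs.1.le)).trans (h.U_le_line ha (hc.nonneg s))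
    _ = (r - t) * U a + U a / a * ∫ s in Set.Ioc t r, c s := by
        rw [integral_add i2 i3, integral_const_mul]
        simp [hr]
    _ ≤ _ := by gcongr; exact hc.spent_le hr

theorem exists_U_div_mul_lt (K : ℝ) {ε : ℝ} (hε : 0 < ε) (B : ℝ) :
    ∃ a, B < a ∧ 0 < a ∧ U a / a * K < ε := by
  have : Tendsto (fun a => U a / a * K) atTop (𝓝 0) := by simpa using h.sublinear.mul_const K
  obtain ⟨a, h1, h2, h3⟩ := ((this.eventually_lt_const hε).and
    ((eventually_gt_atTop B).and (eventually_gt_atTop 0))).exists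
  exact ⟨a, h2, h3, h1⟩

/-- Nearly optimal consumption rates spend little in a short time. -/
theorem exists_spent_le_of_nearly_optimal (ht : 0 ≤ t) (hx : l < x) :
    ∃ ε₁ > 0, ∃ δ > 0, ∀ ε, 0 ≤ ε → ε ≤ ε₁ → ∀ c, IsConsumption l t x c →
      maxReward U G β l t x - δ < reward U G β t x c →
      ∫ u in Set.Ioc t (t + ε), c u ≤ (x - l) / 2 := by
  set y := (x + l) / 2 with hy
  -- Spending more than half of `x - l` leaves less than the midpoint `y`, which costs at least `g₀`
  -- of value at any later date. The utility earned meanwhile is at most `ε * U a + U a / a * (x -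
  -- l)`; both terms are at most `g / 4` for a large `a` and then a small `ε`.
  set g₀ := Real.exp (-β) * (1 / 2) * (U (2 * (y - l) + (x - y)) - U (2 * (y - l))) with hg₀
  have hg₀pos : 0 < g₀ := by
    have := h.strictMono (show 2 * (y - l) ∈ Set.Ici 0 by simp; linarith)
      (show 2 * (y - l) + (x - y) ∈ Set.Ici 0 by simp; linarith) (by linarith)
    have := sub_pos.2 this
    positivity
  set g := Real.exp (-β) * g₀
  have hg : 0 < g := by positivity
  obtain ⟨a, -, ha, haU⟩ := h.exists_U_div_mul_lt (x - l) (ε := g / 4) (by positivity) 0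
  have hUa := h.U_pos ha
  refine ⟨min 1 (g / 4 / U a), by positivity, g / 4, by positivity, fun ε h0 hε c hc hopt => ?_⟩
  by_contra! hlt
  have hte : t ≤ t + ε := by linarith
  have h1 := h.reward_le_utility_add ht hc hte
  have h2 := h.integral_utility_le hc ha hte
  have h3 := h.wait_le_maxReward ht hx.le hte
  have h4 : maxReward U G β l (t + ε) (x - ∫ u in Set.Ioc t (t + ε), c u) ≤
      maxReward U G β l (t + ε) x - g₀ := by
    have h5 := h.maxReward_mono (t := t + ε) (x := x - ∫ u in Set.Ioc t (t + ε), c u) (x' := y)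
      (by linarith) (by linarith [hc.spent_le hte]) (by linarith)
    have h6 := h.maxReward_add_le (t := t + ε) (x := x) (y := y) (by linarith) (by linarith)
      (by linarith)
    linarith
  have hε1 := hε.trans (min_le_left _ _)
  have h7 : ε * U a ≤ g / 4 := (le_div_iff₀ hUa).1 (hε.trans (min_le_right _ _))
  rw [add_sub_cancel_left] at h1 h2 h3
  have h8 : Real.exp (-β) ≤ Real.exp (-β * ε) := Real.exp_le_exp.2 (by nlinarith [h.β_pos])
  have h9 := mul_le_mul_of_nonneg_right h8 hg₀pos.le
  have h10 := mul_le_mul_of_nonneg_left h4 (Real.exp_pos (-β * ε)).le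
  have h11 : Real.exp (-β) * g₀ = g := rfl
  linarith

/-- Nearly optimal consumption rates are bounded and bounded away from zero during a
non-negligible time. -/
theorem exists_le_measure_of_nearly_optimal (ht : 0 ≤ t) (hx : l < x) {ε : ℝ} (hε : 0 < ε) :
    ∃ a > 0, ∃ C, a < C ∧ ∃ m > 0, ∃ δ > 0, ∀ c, IsConsumption l t x c →
      maxReward U G β l t x - δ < reward U G β t x c →
      m ≤ volume.real {s | s ∈ Set.Ioc t (t + ε) ∧ c s ∈ Set.Icc a C} := by
  -- `Δ` is the strict gain over waiting. Rates below `a` contribute at most `ε * U a < Δ / 4`,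
  -- rates above `C` at most `U C / C * (x - l) < Δ / 4`, and near optimality gives away `Δ / 4`. At
  -- least `Δ / 4` must be earned on `A`, where the utility is at most `U C`.
  set Δ := maxReward U G β l t x - ((∫ s in Set.Ioc t (t + ε), Real.exp (-β * (s - t)) * G s x) +
      Real.exp (-β * ε) * maxReward U G β l (t + ε) x) with hΔdef
  have hΔ : 0 < Δ := sub_pos.2 (h.wait_lt_maxReward ht hx hε)
  obtain ⟨a, haU, ha⟩ : ∃ a, ε * U a < Δ / 4 ∧ 0 < a := by
    have : Tendsto (fun a => ε * U a) (𝓝[>] 0) (𝓝 0) := by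
      simpa using h.tendsto_zero.const_mul ε
    exact ((this.eventually_lt_const (by positivity)).and self_mem_nhdsWithin).exists
  obtain ⟨C, haC, hC, hCU⟩ := h.exists_U_div_mul_lt (x - l) (ε := Δ / 4) (by positivity) a
  have hUC := h.U_pos hC
  refine ⟨a, ha, C, haC, Δ / 4 / U C, by positivity, Δ / 4, by positivity, fun c hc hopt => ?_⟩
  set A := {s | s ∈ Set.Ioc t (t + ε) ∧ c s ∈ Set.Icc a C}
  have hA : MeasurableSet A := measurableSet_Ioc.inter (hc.measurable measurableSet_Icc)
  have hte : t ≤ t + ε := by linarith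
  have h1 := h.reward_le_utility_add ht hc hte
  rw [add_sub_cancel_left] at h1
  have h2 : maxReward U G β l (t + ε) (x - ∫ u in Set.Ioc t (t + ε), c u) ≤
      maxReward U G β l (t + ε) x :=
    h.maxReward_mono (by linarith) (by linarith [hc.spent_le hte])
      (sub_le_self _ (hc.spent_nonneg _ _))
  have h2' := mul_le_mul_of_nonneg_left h2 (Real.exp_pos (-β * ε)).le
  have h3 : ∫ s in Set.Ioc t (t + ε), Real.exp (-β * (s - t)) * U (c s) ≤
      ε * U a + volume.real A * U C + U C / C * (x - l) := by
    have i1 := (h.integrableOn_utility hc).mono_set (show Set.Ioc t (t + ε) ⊆ _ from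
      Set.Ioc_subset_Ioi_self)
    have i2 : IntegrableOn (fun _ : ℝ => U a) (Set.Ioc t (t + ε)) := integrableOn_const (by simp)
    have i3 : IntegrableOn (fun s => U C / C * c s) (Set.Ioc t (t + ε)) :=
      (hc.integrableOn hte).const_mul _
    have i4 : IntegrableOn (A.indicator fun _ => U C) (Set.Ioc t (t + ε)) :=
      (integrableOn_const (by simp)).indicator hA
    have i24 : IntegrableOn (fun s => U a + A.indicator (fun _ => U C) s) (Set.Ioc t (t + ε)) :=
      i2.add i4
    have h0 : 0 ≤ U C / C := by positivity
    calc ∫ s in Set.Ioc t (t + ε), Real.exp (-β * (s - t)) * U (c s)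
        ≤ ∫ s in Set.Ioc t (t + ε), (U a + A.indicator (fun _ => U C) s + U C / C * c s) := by
          refine setIntegral_mono_on i1 (i24.add i3) measurableSet_Ioc fun s hs => ?_
          refine (mul_le_of_le_one_left (h.U_nonneg (hc.nonneg s))
            (discount_le_one h.β_pos hs.1.le)).trans ?_
          have e1 := mul_nonneg h0 (hc.nonneg s)
          have e2 := h.U_nonneg ha.le
          by_cases hsA : s ∈ A
          · rw [Set.indicator_of_mem hsA]
            linarith [h.U_mono (hc.nonneg s) hsA.2.2]
          · rw [Set.indicator_of_notMem hsA]
            rcases le_total (c s) a with h4 | h4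
            · linarith [h.U_mono (hc.nonneg s) h4]
            · have h5 : C < c s := by
                by_contra! h5
                exact hsA ⟨hs, h4, h5⟩
              have h6 := h.U_div_anti hC h5.le
              rw [div_le_iff₀ (hC.trans h5)] at h6
              linarith
      _ = ε * U a + volume.real A * U C + U C / C * ∫ s in Set.Ioc t (t + ε), c s := by
          rw [integral_add i24 i3, integral_add i2 i4, integral_const_mul,
            setIntegral_indicator hA,
            Set.inter_eq_right.2 (show A ⊆ Set.Ioc t (t + ε) from fun s hs => hs.1)]
          simp [hε.le]
      _ ≤ _ := by gcongr; exact hc.spent_le hte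
  rw [div_le_iff₀ hUC]
  linarith

/-- By concavity `U (c + d) - U c ≥ d * deriv U (c + d)` and `U c - U (c - d) ≤ d * deriv U (c -
d)`; uniform continuity of `deriv U` on `[a / 2, C + 1]` compares the two slopes. -/
theorem second_difference_U {a C η ρ : ℝ}
    (hρ : ∀ u ∈ Set.Icc (a / 2) (C + 1), ∀ v ∈ Set.Icc (a / 2) (C + 1), dist u v < ρ →
      dist (deriv U u) (deriv U v) < η) {c d : ℝ} (hc : c ∈ Set.Icc a C) (hd : 0 < d)
    (hda : d ≤ a / 2) (hd1 : d ≤ 1) (hdρ : 2 * d < ρ) :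
    2 * U c - d * η ≤ U (c + d) + U (c - d) := by
  have hdiff : ∀ u, 0 < u → DifferentiableAt ℝ U u := fun u hu =>
    ((h.contDiff.differentiableOn (by norm_num)) u hu).differentiableAt (Ioi_mem_nhds hu)
  have hc1 := hc.1
  have hc2 := hc.2
  have h1 := h.concave.deriv_le_slope (x := c) (y := c + d) (by simp; linarith)
    (by simp; linarith) (by linarith) (hdiff _ (by linarith))
  have h2 := h.concave.slope_le_deriv (x := c - d) (y := c) (by simp; linarith)
    (by simp; linarith) (by linarith) (hdiff _ (by linarith))
  rw [slope_def_field, add_sub_cancel_left, le_div_iff₀ hd] at h1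
  rw [slope_def_field, sub_sub_cancel, div_le_iff₀ hd] at h2
  have h3 := hρ (c - d) ⟨by linarith, by linarith⟩ (c + d) ⟨by linarith, by linarith⟩ (by
    rw [Real.dist_eq, abs_of_nonpos (by linarith)]; linarith)
  rw [Real.dist_eq, abs_lt] at h3
  have h4 := mul_lt_mul_of_pos_left h3.2 hd
  linarith

/-- A nearly optimal `c` from `x` is raised and lowered by `d = z / |A|` on the set `A` of times
where it lies in `[a, C]`. The total change is exactly `z`, so `c ± e` start from `x ± z` and share
the wealth of `c` after `t + ε`. The measure bound `m` is uniform over nearly optimal rates, hence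
`d ≤ z / m` is small with `z`, although `c` depends on `z`. -/
theorem second_difference_maxReward (ht : 0 ≤ t) (hx : l < x) {η : ℝ} (hη : 0 < η) :
    ∃ h₀ > 0, ∀ z, 0 < z → z < h₀ → 2 * maxReward U G β l t x - η * z ≤
      maxReward U G β l t (x + z) + maxReward U G β l t (x - z) := by
  set κ := (x - l) / 2 with hκdef
  have hκ : 0 < κ := by simp only [κ]; linarith
  obtain ⟨M, hM0, hM⟩ : ∃ M > 0, ∀ s ∈ Set.Icc t (t + 1), G s x ≤ M := by
    obtain ⟨M, hM⟩ := (isCompact_Icc (a := t) (b := t + 1)).bddAbove_image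
      (f := fun s => G s x) (h.continuous_G.comp (by fun_prop : Continuous fun s : ℝ => (s, x))).continuousOn
    exact ⟨max M 1, by positivity, fun s hs => (hM ⟨s, hs, rfl⟩).trans (le_max_left _ _)⟩
  obtain ⟨ε₁, hε₁, δ₁, hδ₁, hspent⟩ := h.exists_spent_le_of_nearly_optimal ht hx
  -- Up to `t + ε` the lowered path loses running reward at a rate of at most `z * (2 * M / κ)`;
  -- this `ε` makes the total at most `η * z / 2`.
  set ε := min (min ε₁ 1) (η * κ / (4 * M)) with hεdef
  have hε : 0 < ε := by positivity
  have hεM : ε * (2 * M / κ) ≤ η / 2 := by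
    calc ε * (2 * M / κ) ≤ η * κ / (4 * M) * (2 * M / κ) := by gcongr; exact min_le_right _ _
      _ = η / 2 := by field_simp; ring
  have hεε₁ : ε ≤ ε₁ := (min_le_left _ _).trans (min_le_left _ _)
  have hε1 : ε ≤ 1 := (min_le_left _ _).trans (min_le_right _ _)
  obtain ⟨a, ha, C, haC, m, hm, δ₂, hδ₂, hmeas⟩ := h.exists_le_measure_of_nearly_optimal ht hx hε
  obtain ⟨ρ, hρ0, hρ⟩ : ∃ ρ > 0, ∀ u ∈ Set.Icc (a / 2) (C + 1), ∀ v ∈ Set.Icc (a / 2) (C + 1),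
      dist u v < ρ → dist (deriv U u) (deriv U v) < η / 4 := by
    have hco : ContinuousOn (deriv U) (Set.Icc (a / 2) (C + 1)) :=
      (h.contDiff.continuousOn_deriv_of_isOpen isOpen_Ioi (by norm_num)).mono fun u hu =>
        lt_of_lt_of_le (by positivity : (0 : ℝ) < a / 2) hu.1
    exact Metric.uniformContinuousOn_iff.1
      (isCompact_Icc.uniformContinuousOn_of_continuous hco) (η / 4) (by positivity)
  -- `z ≤ κ / 2` keeps the lowered wealth at least `κ / 2` above `l` until `t + ε`. The other bound
  -- yields `d ≤ a / 2`, `d ≤ 1` and `d ≤ ρ / 4`, so that `c s ± d` stays in `[a / 2, C + 1]` and `2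
  -- * d < ρ`.
  refine ⟨min (κ / 2) (m * min (a / 2) (min 1 (ρ / 4))), by positivity, fun z hz hzlt => ?_⟩
  have hzκ : z ≤ κ / 2 := hzlt.le.trans (min_le_left _ _)
  obtain ⟨c, hc, hcopt⟩ := exists_lt_reward (U := U) (G := G) (β := β) (t := t) hx.le
    (δ := min (min δ₁ δ₂) (z * η / 8)) (by positivity)
  set δ := min (min δ₁ δ₂) (z * η / 8) with hδdef
  have hδ1 : δ ≤ δ₁ := (min_le_left _ _).trans (min_le_left _ _)
  have hδ2 : δ ≤ δ₂ := (min_le_left _ _).trans (min_le_right _ _)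
  have hδ3 : δ ≤ z * η / 8 := min_le_right _ _
  have hsp := hspent ε hε.le hεε₁ c hc (by linarith)
  have hmA := hmeas c hc (by linarith)
  set A := {s | s ∈ Set.Ioc t (t + ε) ∧ c s ∈ Set.Icc a C}
  have hA : MeasurableSet A := measurableSet_Ioc.inter (hc.measurable measurableSet_Icc)
  have hAsub : A ⊆ Set.Ioc t (t + ε) := fun s hs => hs.1
  have hA0 : 0 < volume.real A := hm.trans_le hmA
  set d := z / volume.real A
  have hd : 0 < d := by positivity
  have hdA : volume.real A * d = z := by simp only [d]; field_simp
  have hdm : d ≤ min (a / 2) (min 1 (ρ / 4)) := by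
    rw [div_le_iff₀' hA0]
    refine (hzlt.le.trans (min_le_right _ _)).trans ?_
    gcongr
  have hda : d ≤ a / 2 := hdm.trans (min_le_left _ _)
  have hd1 : d ≤ 1 := hdm.trans ((min_le_right _ _).trans (min_le_left _ _))
  have hdρ : d ≤ ρ / 4 := hdm.trans ((min_le_right _ _).trans (min_le_right _ _))
  have hte : t ≤ t + ε := by linarith
  set e : ℝ → ℝ := A.indicator fun _ => d
  have he_int : ∀ s, ∫ u in Set.Ioc t s, e u = volume.real (Set.Ioc t s ∩ A) * d := fun s => by
    rw [setIntegral_indicator hA, setIntegral_const, smul_eq_mul]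
  have he : IsConsumption 0 t z e := by
    refine ⟨measurable_const.indicator hA, fun s => Set.indicator_nonneg (fun _ _ => hd.le) s,
      fun s hs => ⟨(integrableOn_const (by simp)).indicator hA, ?_⟩⟩
    rw [he_int, sub_zero, ← hdA]
    gcongr
    · exact ((measure_mono hAsub).trans_lt (by simp)).ne
    · exact Set.inter_subset_right
  have he_end : ∀ s, t + ε ≤ s → ∫ u in Set.Ioc t s, e u = z := fun s hs => by
    rw [he_int, Set.inter_eq_right.2 (hAsub.trans (Set.Ioc_subset_Ioc_right hs)), hdA]
  have hce : ∀ s, 0 ≤ c s - e s := fun s => by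
    by_cases hsA : s ∈ A
    · simp only [e, Set.indicator_of_mem hsA]
      linarith [hsA.2.1]
    · simp only [e, Set.indicator_of_notMem hsA]
      linarith [hc.nonneg s]
  have hsub_int : ∀ s, t ≤ s → ∫ u in Set.Ioc t s, (c u - e u) =
      (∫ u in Set.Ioc t s, c u) - ∫ u in Set.Ioc t s, e u := fun s hs =>
    integral_sub (hc.integrableOn hs) (he.integrableOn hs)
  have hcp : IsConsumption l t (x + z) (fun s => c s + e s) := hc.add he
  have hcm : IsConsumption l t (x - z) (fun s => c s - e s) := by
    refine ⟨hc.measurable.sub he.measurable, hce, fun s hs =>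
      ⟨(hc.integrableOn hs).sub (he.integrableOn hs), ?_⟩⟩
    rcases le_total (t + ε) s with hs' | hs'
    · rw [hsub_int s hs, he_end s hs']
      linarith [hc.spent_le hs]
    · refine (setIntegral_mono_set ((hc.integrableOn hte).sub (he.integrableOn hte))
        (Eventually.of_forall hce) (Set.Ioc_subset_Ioc_right hs').eventuallyLE).trans ?_
      have := hsub_int _ hte
      rw [he_end _ le_rfl] at this
      simp only [Pi.sub_apply]
      linarith [hc.spent_le hte]
  have ip := h.integrableOn_rewardRate ht hcp
  have im := h.integrableOn_rewardRate ht hcm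
  have i0 := h.integrableOn_rewardRate ht hc
  have i1 : IntegrableOn (A.indicator fun _ => d * (η / 4)) (Set.Ioi t) :=
    ((integrable_indicator_iff hA).2 (integrableOn_const
      ((measure_mono hAsub).trans_lt (by simp)).ne)).integrableOn
  have i2 : IntegrableOn ((Set.Ioc t (t + ε)).indicator fun _ => z * (2 * M / κ)) (Set.Ioi t) :=
    ((integrable_indicator_iff measurableSet_Ioc).2 (integrableOn_const (by simp))).integrableOn
  have i3 : IntegrableOn (fun s => 2 * rewardRate U G β t x c s - A.indicator (fun _ => d * (η / 4)) s)
    (Set.Ioi t) := (i0.const_mul 2).sub i1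
  have key : 2 * reward U G β t x c - z * (η / 4) - ε * (z * (2 * M / κ)) ≤
      reward U G β t (x + z) (fun s => c s + e s) + reward U G β t (x - z) (fun s => c s - e s) := by
    calc 2 * reward U G β t x c - z * (η / 4) - ε * (z * (2 * M / κ))
        = ∫ s in Set.Ioi t, (2 * rewardRate U G β t x c s - A.indicator (fun _ => d * (η / 4)) s -
            (Set.Ioc t (t + ε)).indicator (fun _ => z * (2 * M / κ)) s) := by
          rw [integral_sub i3 i2, integral_sub (i0.const_mul 2) i1, integral_const_mul,
            setIntegral_indicator hA, setIntegral_indicator measurableSet_Ioc,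
            Set.inter_eq_right.2 (hAsub.trans Set.Ioc_subset_Ioi_self),
            Set.inter_eq_right.2 (Set.Ioc_subset_Ioi_self), setIntegral_const, setIntegral_const,
            smul_eq_mul, smul_eq_mul, ← mul_assoc (volume.real A), hdA]
          simp [hε.le, reward]
      _ ≤ ∫ s in Set.Ioi t, (rewardRate U G β t (x + z) (fun s => c s + e s) s +
            rewardRate U G β t (x - z) (fun s => c s - e s) s) := by
          refine setIntegral_mono_on (i3.sub i2) (ip.add im) measurableSet_Ioi fun s hs => ?_
          have hs := Set.mem_Ioi.1 hs
          simp only [rewardRate]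
          rw [hsub_int s hs.le, integral_add (hc.integrableOn hs.le) (he.integrableOn hs.le)]
          have hU : Real.exp (-β * (s - t)) * (2 * U (c s)) - A.indicator (fun _ => d * (η / 4)) s ≤
              Real.exp (-β * (s - t)) * (U (c s + e s) + U (c s - e s)) := by
            by_cases hsA : s ∈ A
            · simp only [e, Set.indicator_of_mem hsA]
              have e1 := h.second_difference_U hρ hsA.2 hd hda hd1 (by linarith)
              have e2 := discount_le_one h.β_pos hs.le
              have e3 := mul_le_mul_of_nonneg_left e1 (Real.exp_pos (-β * (s - t))).le
              have e4 : Real.exp (-β * (s - t)) * (d * (η / 4)) ≤ d * (η / 4) :=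
                mul_le_of_le_one_left (by positivity) e2
              linarith
            · simp only [e, Set.indicator_of_notMem hsA]
              simp [two_mul]
          rcases le_or_gt s (t + ε) with hs' | hs'
          · rw [Set.indicator_of_mem (show s ∈ Set.Ioc t (t + ε) from ⟨hs, hs'⟩)]
            have n0 := he.spent_nonneg t s
            have n1 := he.spent_le hs.le
            rw [sub_zero] at n1
            set N := ∫ u in Set.Ioc t s, e u
            set Y := x - ∫ u in Set.Ioc t s, c u with hY
            have hYκ : l + κ ≤ Y := by
              have := hc.spent_mono hs.le hs'
              simp only [Y]; linarith
            -- The raised path is never below `Y`, because the additional spending `N` so far is at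
            -- most `z`. Only the lowered path `Y - (z - N)` can lose running reward.
            have g1 : G s Y ≤ G s (x + z - ((∫ u in Set.Ioc t s, c u) + N)) :=
              h.G_mono s (by simp only [Y]; linarith)
            rw [show x - z - ((∫ u in Set.Ioc t s, c u) - N) = Y - (z - N) by simp only [Y]; ring]
            have g2 := (h.G_concave s).sub_le_mul_div (h.G_nonneg _ _) (y := Y - (z - N)) (x := Y)
              (by linarith) (by linarith)
            have g3 : G s (Y - (z - N)) ≤ M :=
              (h.G_mono s (by linarith [hc.spent_nonneg t s])).trans
                (hM s ⟨hs.le, by linarith⟩)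
            have g4 : (Y - (Y - (z - N))) * (G s (Y - (z - N)) / (Y - (z - N) - l)) ≤
                z * (M / (κ / 2)) := by
              refine mul_le_mul (by linarith) ?_ (div_nonneg (h.G_nonneg _ _) (by linarith)) hz.le
              gcongr
              linarith
            have g5 : M / (κ / 2) = 2 * M / κ := by field_simp
            rw [g5] at g4
            have g6 := mul_le_mul_of_nonneg_left (g2.trans g4) (Real.exp_pos (-β * (s - t))).le
            have g7 : Real.exp (-β * (s - t)) * (z * (2 * M / κ)) ≤ z * (2 * M / κ) :=
              mul_le_of_le_one_left (by positivity) (discount_le_one h.β_pos hs.le)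
            have g8 := mul_le_mul_of_nonneg_left g1 (Real.exp_pos (-β * (s - t))).le
            linarith
          · rw [Set.indicator_of_notMem (fun hm : s ∈ Set.Ioc t (t + ε) => absurd hm.2 (not_le.2 hs')),
              he_end s hs'.le, show x + z - ((∫ u in Set.Ioc t s, c u) + z) =
                x - ∫ u in Set.Ioc t s, c u by ring,
              show x - z - ((∫ u in Set.Ioc t s, c u) - z) = x - ∫ u in Set.Ioc t s, c u by ring]
            linarith
      _ = _ := integral_add ip im
  have r1 := h.reward_le_maxReward ht hcp
  have r2 := h.reward_le_maxReward ht hcm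
  -- The losses sum to at most `η * z`: `η * z / 4` from utility, `η * z / 2` from running reward,
  -- and `2 * δ ≤ η * z / 4` from near optimality.
  have r3 := mul_le_mul_of_nonneg_left hεM hz.le
  linarith

theorem differentiableAt_maxReward (ht : 0 ≤ t) (hx : l < x) :
    DifferentiableAt ℝ (maxReward U G β l t) x :=
  (h.concaveOn_maxReward ht).differentiableAt_of_second_difference (by simpa using hx)
    fun _ hη => h.second_difference_maxReward ht hx hη

end ConsumptionProblem

/-! ### Calculus of functions of two variables -/

/-- A jointly continuous function that is concave and differentiable in the second variable has a
jointly continuous partial derivative. -/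
theorem continuousOn_deriv_of_concaveOn {f : ℝ → ℝ → ℝ} {T : Set ℝ} {l : ℝ}
    (hf : ∀ t ∈ T, ConcaveOn ℝ (Set.Ici l) (f t))
    (hd : ∀ t ∈ T, ∀ x, l < x → DifferentiableAt ℝ (f t) x)
    (hc : ContinuousOn (fun q : ℝ × ℝ => f q.1 q.2) (T ×ˢ Set.Ioi l)) :
    ContinuousOn (fun q : ℝ × ℝ => deriv (f q.1) q.2) (T ×ˢ Set.Ioi l) := by
  rintro ⟨t, x⟩ ⟨ht, hx⟩
  simp only at ht hx
  have hx : l < x := hx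
  have hslope := (hasDerivAt_iff_tendsto_slope.1 (hd t ht x hx).hasDerivAt)
  -- Chords of fixed increment `y - x` are carried along with the base point `q`. Their slopes vary
  -- continuously with `q`, and concavity makes them lower bounds (`y > x`) or upper bounds (`y <
  -- x`) of the derivative at `q`.
  have hshift : ∀ y, l < y → Tendsto (fun q : ℝ × ℝ => f q.1 (q.2 + (y - x)))
      (𝓝[T ×ˢ Set.Ioi l] (t, x)) (𝓝 (f t y)) := by
    intro y hy
    have h1 : Tendsto (fun q : ℝ × ℝ => (q.1, q.2 + (y - x))) (𝓝[T ×ˢ Set.Ioi l] (t, x))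
        (𝓝[T ×ˢ Set.Ioi l] (t, y)) := by
      refine tendsto_nhdsWithin_iff.2 ⟨?_, ?_⟩
      · exact (Continuous.tendsto' (by fun_prop) _ _ (by simp)).mono_left nhdsWithin_le_nhds
      · have h2 : ∀ᶠ q : ℝ × ℝ in 𝓝 (t, x), l < q.2 + (y - x) :=
          (Continuous.tendsto' (by fun_prop : Continuous fun q : ℝ × ℝ => q.2 + (y - x)) (t, x) y
            (by simp)).eventually_const_lt hy
        filter_upwards [self_mem_nhdsWithin, nhdsWithin_le_nhds h2] with q hq hq2
        exact ⟨hq.1, hq2⟩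
    exact (hc (t, y) ⟨ht, hy⟩).tendsto.comp h1
  have hmain : ∀ y, l < y → Tendsto (fun q : ℝ × ℝ => (f q.1 (q.2 + (y - x)) - f q.1 q.2) / (y - x))
      (𝓝[T ×ˢ Set.Ioi l] (t, x)) (𝓝 (slope (f t) x y)) := by
    intro y hy
    rw [slope_def_field]
    have := hshift x hx
    simp only [sub_self, add_zero] at this
    exact ((hshift y hy).sub this).div_const _
  have hev : ∀ y, l < y → ∀ᶠ q : ℝ × ℝ in 𝓝[T ×ˢ Set.Ioi l] (t, x),
      q.1 ∈ T ∧ l < q.2 ∧ l < q.2 + (y - x) := by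
    intro y hy
    have h2 : ∀ᶠ q : ℝ × ℝ in 𝓝 (t, x), l < q.2 + (y - x) :=
      (Continuous.tendsto' (by fun_prop : Continuous fun q : ℝ × ℝ => q.2 + (y - x)) (t, x) y
        (by simp)).eventually_const_lt hy
    filter_upwards [self_mem_nhdsWithin, nhdsWithin_le_nhds h2] with q hq hq2
    exact ⟨hq.1, hq.2, hq2⟩
  refine tendsto_order.2 ⟨fun B hB => ?_, fun B hB => ?_⟩
  · have h1 : ∀ᶠ y in 𝓝[>] x, B < slope (f t) x y :=
      (hslope.mono_left (nhdsWithin_mono _ fun y hy => ne_of_gt hy)).eventually_const_lt hB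
    obtain ⟨y, hBy, hxy⟩ := (h1.and self_mem_nhdsWithin).exists
    have hxy : x < y := hxy
    filter_upwards [(hmain y (hx.trans hxy)).eventually_const_lt hBy, hev y (hx.trans hxy)]
      with q h2 h3
    have h4 := (hf q.1 h3.1).slope_le_deriv (x := q.2) (y := q.2 + (y - x)) h3.2.1.le h3.2.2.le
      (by linarith) (hd q.1 h3.1 q.2 h3.2.1)
    rw [slope_def_field, add_sub_cancel_left] at h4
    exact h2.trans_le h4
  · have h1 : ∀ᶠ y in 𝓝[<] x, slope (f t) x y < B :=
      (hslope.mono_left (nhdsWithin_mono _ fun y hy => ne_of_lt hy)).eventually_lt_const hB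
    obtain ⟨y, ⟨hBy, hyx⟩, hly⟩ := ((h1.and self_mem_nhdsWithin).and
      (nhdsWithin_le_nhds (lt_mem_nhds hx))).exists
    have hyx : y < x := hyx
    filter_upwards [(hmain y hly).eventually_lt_const hBy, hev y hly] with q h2 h3
    have h4 := (hf q.1 h3.1).deriv_le_slope (x := q.2 + (y - x)) (y := q.2) h3.2.2.le h3.2.1.le
      (by linarith) (hd q.1 h3.1 q.2 h3.2.1)
    rw [slope_def_field, sub_add_cancel_left, ← neg_sub (f q.1 (q.2 + (y - x))),
      neg_div_neg_eq] at h4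
    exact h4.trans_lt h2

/-- A continuous function on `[0, ∞)` with a continuous right derivative is the primitive of this
derivative. -/
theorem eq_add_integral_of_hasDerivWithinAt_Ici {f g : ℝ → ℝ} (hf : ContinuousOn f (Set.Ici 0))
    (hg : ContinuousOn g (Set.Ici 0)) (hd : ∀ t, 0 ≤ t → HasDerivWithinAt f (g t) (Set.Ici t) t)
    {t : ℝ} (ht : 0 ≤ t) : f t = f 0 + ∫ s in (0 : ℝ)..t, g |s| := by
  -- `g |s|` extends `g` continuously to the line, so its primitive is differentiable at `0` as
  -- well.
  have hg' : Continuous fun s => g |s| :=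
    hg.comp_continuous continuous_abs fun s => abs_nonneg s
  refine eq_of_has_deriv_right_eq (a := 0) (b := t) (f := f)
    (g := fun t => f 0 + ∫ s in (0 : ℝ)..t, g |s|) (f' := g) (fun s hs => hd s hs.1) (fun s hs => ?_)
    (hf.mono Set.Icc_subset_Ici_self) ?_ (by simp) t ⟨ht, le_rfl⟩
  · have := (hg'.integral_hasStrictDerivAt 0 s).hasDerivAt.const_add (f 0)
    rw [abs_of_nonneg hs.1] at this
    exact this.hasDerivWithinAt
  · exact (Continuous.add continuous_const
      (intervalIntegral.continuous_primitive (fun a b => hg'.intervalIntegrable a b) 0)).continuousOn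

/-- Continuous partial derivatives on `[0, ∞) × (l, ∞)`, one-sided in the first variable, give a
continuously differentiable function. -/
theorem contDiffOn_Ici_prod_Ioi {f fx ft : ℝ → ℝ → ℝ} {l : ℝ}
    (hf : ContinuousOn (fun q : ℝ × ℝ => f q.1 q.2) (Set.Ici 0 ×ˢ Set.Ioi l))
    (hx : ∀ t, 0 ≤ t → ∀ x, l < x → HasDerivAt (f t) (fx t x) x)
    (ht : ∀ t, 0 ≤ t → ∀ x, l < x → HasDerivWithinAt (fun s => f s x) (ft t x) (Set.Ici t) t)
    (hfx : ContinuousOn (fun q : ℝ × ℝ => fx q.1 q.2) (Set.Ici 0 ×ˢ Set.Ioi l))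
    (hft : ContinuousOn (fun q : ℝ × ℝ => ft q.1 q.2) (Set.Ici 0 ×ˢ Set.Ioi l)) :
    ContDiffOn ℝ 1 (fun q : ℝ × ℝ => f q.1 q.2) (Set.Ici 0 ×ˢ Set.Ioi l) := by
  -- Reflection in time: `F t x` is `f t x` for `t ≥ 0` and `2 f 0 x - f (-t) x` for `t ≤ 0`. Its
  -- time derivative is the even extension of `ft`, so `F` is `C¹` across `t = 0` and the usual
  -- criterion on an open set applies.
  set F : ℝ → ℝ → ℝ := fun t x => f (max t 0) x + f 0 x - f (max (-t) 0) x with hF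
  set F₁ : ℝ → ℝ → ℝ := fun t x => ft |t| x
  set F₂ : ℝ → ℝ → ℝ := fun t x => fx (max t 0) x + fx 0 x - fx (max (-t) 0) x
  have hsec : ∀ {g : ℝ → ℝ → ℝ}, ContinuousOn (fun q : ℝ × ℝ => g q.1 q.2) (Set.Ici 0 ×ˢ Set.Ioi l) →
      ∀ x, l < x → ContinuousOn (fun t => g t x) (Set.Ici 0) := fun hg x hx =>
    hg.comp (f := fun t : ℝ => (t, x)) (by fun_prop) fun t ht => ⟨ht, hx⟩
  have hcomp : ∀ {g : ℝ → ℝ → ℝ}, ContinuousOn (fun q : ℝ × ℝ => g q.1 q.2) (Set.Ici 0 ×ˢ Set.Ioi l) →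
      ∀ φ : ℝ → ℝ, Continuous φ → (∀ t, 0 ≤ φ t) →
      ContinuousOn (fun q : ℝ × ℝ => g (φ q.1) q.2) (Set.univ ×ˢ Set.Ioi l) := fun hg φ hφ h0 =>
    hg.comp (f := fun q : ℝ × ℝ => (φ q.1, q.2)) (by fun_prop) fun q hq => ⟨h0 _, hq.2⟩
  have hF₁ : ∀ t x, l < x → HasDerivAt (F · x) (F₁ t x) t := by
    intro t x hlx
    have hcont := hsec hft x hlx
    have key : ∀ s, F s x = f 0 x + ∫ u in (0 : ℝ)..s, ft |u| x := by
      have h0 := @eq_add_integral_of_hasDerivWithinAt_Ici (fun s => f s x) (fun s => ft s x)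
        (hsec hf x hlx) hcont (fun t h0 => ht t h0 x hlx)
      intro s
      rcases le_total 0 s with hs | hs
      · simp only [hF, max_eq_left hs, max_eq_right (neg_nonpos.2 hs)]
        rw [h0 hs]
        ring
      · simp only [hF, max_eq_right hs, max_eq_left (neg_nonneg.2 hs)]
        rw [h0 (neg_nonneg.2 hs)]
        have h1 := intervalIntegral.integral_comp_neg (a := 0) (b := s) (fun u => ft |u| x)
        simp only [abs_neg, neg_zero] at h1
        rw [h1, intervalIntegral.integral_symm (-s) 0]
        ring
    have hg' : Continuous fun s => ft |s| x :=
      hcont.comp_continuous continuous_abs fun s => abs_nonneg s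
    have := (hg'.integral_hasStrictDerivAt 0 t).hasDerivAt.const_add (f 0 x)
    exact this.congr_of_eventuallyEq (Eventually.of_forall key)
  have hF₂ : ∀ t x, l < x → HasDerivAt (F t) (F₂ t x) x := fun t x hlx =>
    ((hx _ (le_max_right _ _) x hlx).add (hx 0 le_rfl x hlx)).sub (hx _ (le_max_right _ _) x hlx)
  have c₁ : ContinuousOn (fun q : ℝ × ℝ => F₁ q.1 q.2) (Set.univ ×ˢ Set.Ioi l) :=
    hcomp hft _ continuous_abs abs_nonneg
  have c₂ : ContinuousOn (fun q : ℝ × ℝ => F₂ q.1 q.2) (Set.univ ×ˢ Set.Ioi l) :=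
    ((hcomp hfx (max · 0) (by fun_prop) fun _ => le_max_right _ _).add
      (hcomp hfx (fun _ => 0) (by fun_prop) fun _ => le_rfl)).sub
      (hcomp hfx (fun t => max (-t) 0) (by fun_prop) fun _ => le_max_right _ _)
  have ho : IsOpen ((Set.univ : Set ℝ) ×ˢ Set.Ioi l) := isOpen_univ.prod isOpen_Ioi
  set D : ℝ × ℝ → (ℝ × ℝ →L[ℝ] ℝ) := fun q =>
    (ContinuousLinearMap.toSpanSingleton ℝ (F₁ q.1 q.2)).coprod
      (ContinuousLinearMap.toSpanSingleton ℝ (F₂ q.1 q.2))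
  have hD : ∀ q ∈ (Set.univ : Set ℝ) ×ˢ Set.Ioi l,
      HasFDerivAt (fun q : ℝ × ℝ => F q.1 q.2) (D q) q := by
    intro q hq
    have hev : ∀ᶠ v : ℝ × ℝ in 𝓝 q, v ∈ (Set.univ : Set ℝ) ×ˢ Set.Ioi l := ho.mem_nhds hq
    have hS : Continuous fun r : ℝ => ContinuousLinearMap.toSpanSingleton ℝ r :=
      (ContinuousLinearMap.toSpanSingletonCLE (𝕜 := ℝ) (E := ℝ)).continuous
    exact (hasStrictFDerivAt_uncurry_coprod (f := F)
      (f₁ := fun t x => ContinuousLinearMap.toSpanSingleton ℝ (F₁ t x))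
      (f₂ := fun t x => ContinuousLinearMap.toSpanSingleton ℝ (F₂ t x))
      (by filter_upwards [hev] with v hv using (hF₁ v.1 v.2 hv.2).hasFDerivAt)
      (by filter_upwards [hev] with v hv using (hF₂ v.1 v.2 hv.2).hasFDerivAt)
      (hS.continuousAt.comp (c₁.continuousAt (ho.mem_nhds hq)))
      (hS.continuousAt.comp (c₂.continuousAt (ho.mem_nhds hq)))).hasFDerivAt
  have hCD : ContDiffOn ℝ 1 (fun q : ℝ × ℝ => F q.1 q.2) (Set.univ ×ˢ Set.Ioi l) := by
    have h1 := contDiffOn_succ_iff_fderiv_of_isOpen (𝕜 := ℝ) (n := 0)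
      (f := fun q : ℝ × ℝ => F q.1 q.2) ho
    rw [zero_add] at h1
    refine h1.2 ⟨fun q hq => (hD q hq).differentiableAt.differentiableWithinAt, by simp, ?_⟩
    rw [contDiffOn_zero]
    have hDc : ContinuousOn D (Set.univ ×ˢ Set.Ioi l) := by
      rw [continuousOn_clm_apply]
      intro v
      simp only [D, ContinuousLinearMap.coprod_apply, ContinuousLinearMap.toSpanSingleton_apply,
        smul_eq_mul]
      exact (continuousOn_const.mul c₁).add (continuousOn_const.mul c₂)
    exact hDc.congr fun q hq => (hD q hq).fderiv
  refine (hCD.mono (Set.prod_mono_left (Set.subset_univ _))).congr fun q hq => ?_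
  have h0 : (0 : ℝ) ≤ q.1 := hq.1
  simp [hF, max_eq_left h0, max_eq_right (neg_nonpos.2 h0)]

/-- Averages over short intervals converge. -/
theorem tendsto_average_Ioc {φ : ℝ → ℝ → ℝ} {t L : ℝ}
    (hφ : ∀ η > 0, ∀ᶠ r in 𝓝[>] t, ∀ s ∈ Set.Ioc t r, |φ r s - L| ≤ η)
    (hi : ∀ᶠ r in 𝓝[>] t, IntegrableOn (φ r) (Set.Ioc t r)) :
    Tendsto (fun r => (∫ s in Set.Ioc t r, φ r s) / (r - t)) (𝓝[>] t) (𝓝 L) := by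
  rw [Metric.tendsto_nhds]
  intro η hη
  filter_upwards [hφ (η / 2) (by positivity), hi, self_mem_nhdsWithin] with r h1 h2 h3
  have h3 : 0 < r - t := sub_pos.2 h3
  have h4 : (∫ s in Set.Ioc t r, φ r s) / (r - t) - L = (∫ s in Set.Ioc t r, (φ r s - L)) / (r - t) := by
    rw [integral_sub h2 (integrableOn_const (by simp))]
    simp [(sub_nonneg.1 h3.le)]
    field_simp
  rw [Real.dist_eq, h4, abs_div, abs_of_pos h3, div_lt_iff₀ h3]
  have h5 := norm_setIntegral_le_of_norm_le_const (μ := volume) (s := Set.Ioc t r)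
    (f := fun s => φ r s - L) (C := η / 2) (by simp) h1
  rw [Real.norm_eq_abs] at h5
  simp [sub_nonneg.1 h3.le] at h5
  nlinarith

/-- The convex conjugate `q ↦ sup_{c ≥ 0} (U c - c q)` of a utility function. -/
def utilityConjugate (U : ℝ → ℝ) (q : ℝ) : ℝ := ⨆ c : ℝ≥0, (U c - c * q)

/-! ### Joint continuity, slope at the boundary and the Hamilton–Jacobi equation -/

namespace ConsumptionProblem

variable {U : ℝ → ℝ} {G : ℝ → ℝ → ℝ} {β l : ℝ} (h : ConsumptionProblem U G β l)
include h

variable {t x : ℝ}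

theorem exp_mul_maxReward_le (ht : 0 ≤ t) (hx : l ≤ x) {r : ℝ} (hr : t ≤ r) :
    Real.exp (-β * (r - t)) * maxReward U G β l r x ≤ maxReward U G β l t x := by
  refine le_trans (le_add_of_nonneg_left ?_) (h.wait_le_maxReward ht hx hr)
  exact setIntegral_nonneg measurableSet_Ioc fun s _ =>
    mul_nonneg (Real.exp_pos _).le (h.G_nonneg _ _)

theorem integral_discount_G_le {M r : ℝ} (ht : 0 ≤ t) (hr : t ≤ r)
    (hM : ∀ s ∈ Set.Icc t r, G s x ≤ M) :
    ∫ s in Set.Ioc t r, Real.exp (-β * (s - t)) * G s x ≤ (r - t) * M := by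
  calc ∫ s in Set.Ioc t r, Real.exp (-β * (s - t)) * G s x ≤ ∫ _ in Set.Ioc t r, M := by
        refine setIntegral_mono_on ((h.integrableOn_G_const ht x).mono_set Set.Ioc_subset_Ioi_self)
          (integrableOn_const (by simp)) measurableSet_Ioc fun s hs => ?_
        exact (mul_le_of_le_one_left (h.G_nonneg _ _)
          (discount_le_one h.β_pos hs.1.le)).trans (hM s ⟨hs.1.le, hs.2⟩)
    _ = (r - t) * M := by simp [hr]

theorem maxReward_le_add (ht : 0 ≤ t) (hx : l ≤ x) {r : ℝ} (hr : t ≤ r) {a M : ℝ} (ha : 0 < a)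
    (hM : ∀ s ∈ Set.Icc t r, G s x ≤ M) :
    maxReward U G β l t x ≤
      maxReward U G β l r x + (r - t) * (U a + M) + U a / a * (x - l) := by
  refine maxReward_le hx fun c hc => ?_
  have h1 := h.reward_le_utility_add ht hc hr
  have h2 := h.integral_utility_le hc ha hr
  have h3 := h.integral_discount_G_le ht hr hM
  have h4 : Real.exp (-β * (r - t)) * maxReward U G β l r (x - ∫ u in Set.Ioc t r, c u) ≤
      maxReward U G β l r x := by
    refine (mul_le_of_le_one_left h.maxReward_nonneg (discount_le_one h.β_pos hr)).trans ?_
    exact h.maxReward_mono (ht.trans hr) (by linarith [hc.spent_le hr])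
      (sub_le_self _ (hc.spent_nonneg _ _))
  linarith

/-- Waiting bounds the earlier value below by the discounted later one. Conversely
`maxReward_le_add` bounds it above by the later one, plus a term that vanishes with the time step
and `U a / a * (x - l)`, which is small for large `a`. -/
theorem continuousWithinAt_maxReward_time (ht : 0 ≤ t) (hx : l ≤ x) :
    ContinuousWithinAt (fun s => maxReward U G β l s x) (Set.Ici 0) t := by
  obtain ⟨M, hM⟩ := (isCompact_Icc (a := 0) (b := t + 1)).bddAbove_image (f := fun s => G s x)
    (h.continuous_G.comp (by fun_prop : Continuous fun s : ℝ => (s, x))).continuousOn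
  have hM' : ∀ s, 0 ≤ s → s ≤ t + 1 → G s x ≤ M := fun s h0 h1 => hM ⟨s, ⟨h0, h1⟩, rfl⟩
  set w := maxReward U G β l t x
  have near : ∀ᶠ s in 𝓝[Set.Ici 0] t, 0 ≤ s ∧ s ≤ t + 1 := by
    filter_upwards [self_mem_nhdsWithin, nhdsWithin_le_nhds (gt_mem_nhds (lt_add_one t))]
      with s h1 h2 using ⟨h1, h2.le⟩
  have lim1 : ∀ σ : ℝ, Tendsto (fun s => Real.exp (σ * |s - t|) * w) (𝓝[Set.Ici 0] t) (𝓝 w) :=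
    fun σ => (Continuous.tendsto' (by fun_prop) _ _ (by simp)).mono_left nhdsWithin_le_nhds
  have lim2 : ∀ σ K C : ℝ, Tendsto (fun s => w + σ * |s - t| * K + C) (𝓝[Set.Ici 0] t) (𝓝 (w + C)) :=
    fun σ K C => (Continuous.tendsto' (by fun_prop) _ _ (by simp)).mono_left nhdsWithin_le_nhds
  refine tendsto_order.2 ⟨fun B hB => ?_, fun B hB => ?_⟩
  · obtain ⟨a, -, ha, haU⟩ := h.exists_U_div_mul_lt (x - l) (sub_pos.2 hB) 0
    filter_upwards [(lim1 (-β)).eventually_const_lt hB,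
      (lim2 (-1) (U a + M) (-(U a / a * (x - l)))).eventually_const_lt
        (show B < w + -(U a / a * (x - l)) by linarith), near] with s h1 h2 h3
    rcases le_total t s with hs | hs
    · have h4 := h.maxReward_le_add ht hx hs ha fun u hu => hM' u (ht.trans hu.1) (hu.2.trans h3.2)
      rw [abs_of_nonneg (sub_nonneg.2 hs)] at h2
      linarith
    · have h4 := h.exp_mul_maxReward_le h3.1 hx hs
      rw [abs_of_nonpos (sub_nonpos.2 hs), neg_sub] at h1
      exact h1.trans_le h4
  · obtain ⟨a, -, ha, haU⟩ := h.exists_U_div_mul_lt (x - l) (sub_pos.2 hB) 0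
    filter_upwards [(lim1 β).eventually_lt_const hB,
      (lim2 1 (U a + M) (U a / a * (x - l))).eventually_lt_const
        (show w + U a / a * (x - l) < B by linarith), near] with s h1 h2 h3
    rcases le_total t s with hs | hs
    · have h4 := h.exp_mul_maxReward_le ht hx hs
      rw [abs_of_nonneg (sub_nonneg.2 hs)] at h1
      refine lt_of_le_of_lt ?_ h1
      have h5 := mul_le_mul_of_nonneg_left h4 (Real.exp_pos (β * (s - t))).le
      rw [← mul_assoc, ← Real.exp_add] at h5
      simpa using h5
    · have h4 := h.maxReward_le_add h3.1 hx hs ha fun u hu => hM' u (h3.1.trans hu.1) (by linarith [hu.2])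
      rw [abs_of_nonpos (sub_nonpos.2 hs), neg_sub] at h2
      linarith

/-- Continuity in time at fixed wealth extends to joint continuity because concavity gives a
Lipschitz bound in the wealth, locally uniform in time. -/
theorem continuousOn_maxReward :
    ContinuousOn (fun q : ℝ × ℝ => maxReward U G β l q.1 q.2) (Set.Ici 0 ×ˢ Set.Ioi l) := by
  rintro ⟨t, x⟩ ⟨ht, hx⟩
  simp only [Set.mem_Ici, Set.mem_Ioi] at ht hx
  have h1 : Tendsto (fun q : ℝ × ℝ => maxReward U G β l q.1 x) (𝓝[Set.Ici 0 ×ˢ Set.Ioi l] (t, x))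
      (𝓝 (maxReward U G β l t x)) :=
    (h.continuousWithinAt_maxReward_time ht hx.le).tendsto.comp
      (tendsto_nhdsWithin_iff.2 ⟨(continuous_fst.tendsto' _ _ rfl).mono_left nhdsWithin_le_nhds,
        by filter_upwards [self_mem_nhdsWithin] with q hq using hq.1⟩)
  have h2 : Tendsto (fun q : ℝ × ℝ => |q.2 - x| * (maxReward U G β l q.1 x / ((x - l) / 2)))
      (𝓝[Set.Ici 0 ×ˢ Set.Ioi l] (t, x)) (𝓝 0) := by
    have h3 : Tendsto (fun q : ℝ × ℝ => |q.2 - x|) (𝓝[Set.Ici 0 ×ˢ Set.Ioi l] (t, x)) (𝓝 0) :=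
      (Continuous.tendsto' (by fun_prop) _ _ (by simp)).mono_left nhdsWithin_le_nhds
    simpa using h3.mul (h1.div_const ((x - l) / 2))
  have h4 : ∀ᶠ q : ℝ × ℝ in 𝓝[Set.Ici 0 ×ˢ Set.Ioi l] (t, x),
      |maxReward U G β l q.1 q.2 - maxReward U G β l q.1 x| ≤
        |q.2 - x| * (maxReward U G β l q.1 x / ((x - l) / 2)) := by
    have h5 : ∀ᶠ q : ℝ × ℝ in 𝓝 (t, x), (x + l) / 2 < q.2 :=
      (continuous_snd.tendsto' (t, x) x rfl).eventually_const_lt (by linarith)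
    filter_upwards [self_mem_nhdsWithin, nhdsWithin_le_nhds h5] with q hq hq2
    have hq0 : 0 ≤ q.1 := hq.1
    have hc := h.concaveOn_maxReward hq0
    rcases le_total x q.2 with hxq | hxq
    · have h6 := h.maxReward_mono hq0 hx.le hxq
      have h7 := hc.sub_le_mul_div h.maxReward_nonneg hx hxq
      rw [abs_of_nonneg (sub_nonneg.2 h6), abs_of_nonneg (sub_nonneg.2 hxq)]
      refine h7.trans ?_
      have := h.maxReward_nonneg (t := q.1) (x := x)
      gcongr
      linarith
    · have h6 := h.maxReward_mono hq0 (le_of_lt hq.2) hxq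
      have h7 := hc.sub_le_mul_div h.maxReward_nonneg hq.2 hxq
      rw [abs_of_nonpos (sub_nonpos.2 h6), abs_of_nonpos (sub_nonpos.2 hxq), neg_sub, neg_sub]
      refine h7.trans ?_
      have := h.maxReward_nonneg (t := q.1) (x := x)
      have := h.maxReward_nonneg (t := q.1) (x := q.2)
      gcongr
      linarith
  have h8 : Tendsto (fun q : ℝ × ℝ => maxReward U G β l q.1 q.2 - maxReward U G β l q.1 x)
      (𝓝[Set.Ici 0 ×ˢ Set.Ioi l] (t, x)) (𝓝 0) := squeeze_zero_norm' h4 h2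
  have := h8.add h1
  simpa [ContinuousWithinAt] using this

theorem continuousOn_deriv_maxReward :
    ContinuousOn (fun q : ℝ × ℝ => deriv (maxReward U G β l q.1) q.2)
      (Set.Ici 0 ×ˢ Set.Ioi l) :=
  continuousOn_deriv_of_concaveOn (fun _ ht => h.concaveOn_maxReward ht)
    (fun _ ht _ hx => h.differentiableAt_maxReward ht hx) h.continuousOn_maxReward

/-- `maxReward_add_le` divided by the increment of wealth. Letting `x` decrease to `l`, the Inada
condition yields the infinite slope. -/
theorem deriv_U_le_deriv_maxReward (ht : 0 ≤ t) (hx : l < x) :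
    Real.exp (-β) * (1 / 2) * deriv U (2 * (x - l)) ≤ deriv (maxReward U G β l t) x := by
  set C := 2 * (x - l)
  have hC : 0 < C := by simp only [C]; linarith
  have hdiff : DifferentiableAt ℝ U C :=
    ((h.contDiff.differentiableOn (by norm_num)) C hC).differentiableAt (Ioi_mem_nhds hC)
  have t1 : Tendsto (fun z => z⁻¹ • (U (C + z) - U C)) (𝓝[>] 0) (𝓝 (deriv U C)) :=
    (hasDerivAt_iff_tendsto_slope_zero.1 hdiff.hasDerivAt).mono_left
      (nhdsWithin_mono _ fun y hy => ne_of_gt hy)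
  have t2 : Tendsto (fun z => z⁻¹ • (maxReward U G β l t (x + z) - maxReward U G β l t x)) (𝓝[>] 0)
      (𝓝 (deriv (maxReward U G β l t) x)) :=
    (hasDerivAt_iff_tendsto_slope_zero.1 (h.differentiableAt_maxReward ht hx).hasDerivAt).mono_left
      (nhdsWithin_mono _ fun y hy => ne_of_gt hy)
  refine le_of_tendsto_of_tendsto (t1.const_mul _) t2 ?_
  filter_upwards [self_mem_nhdsWithin] with z hz
  have hz : 0 < z := hz
  have h1 := h.maxReward_add_le ht hx (show x ≤ x + z by linarith)
  rw [add_sub_cancel_left] at h1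
  have h2 := inv_pos.2 hz
  simp only [smul_eq_mul]
  have h3 : Real.exp (-β) * (1 / 2) * (U (C + z) - U C) ≤
      maxReward U G β l t (x + z) - maxReward U G β l t x := by linarith
  have h4 := mul_le_mul_of_nonneg_left h3 h2.le
  linarith

theorem tendsto_deriv_maxReward (ht : 0 ≤ t) :
    Tendsto (deriv (maxReward U G β l t)) (𝓝[>] l) atTop := by
  have h1 : Tendsto (fun x => Real.exp (-β) * (1 / 2) * deriv U (2 * (x - l))) (𝓝[>] l) atTop := by
    refine Tendsto.const_mul_atTop (by positivity) (h.inada.comp ?_)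
    refine tendsto_nhdsWithin_iff.2 ⟨?_, ?_⟩
    · exact (Continuous.tendsto' (by fun_prop) _ _ (by simp)).mono_left nhdsWithin_le_nhds
    · filter_upwards [self_mem_nhdsWithin] with x hx
      simpa using hx
  refine tendsto_atTop_mono' _ ?_ h1
  filter_upwards [self_mem_nhdsWithin] with x hx using h.deriv_U_le_deriv_maxReward ht hx

/-- The conjugate of `U` is controlled only at positive slopes, and it will be evaluated at this
derivative. -/
theorem deriv_maxReward_pos (ht : 0 ≤ t) (hx : l < x) : 0 < deriv (maxReward U G β l t) x := by
  have h1 := (h.concaveOn_maxReward ht).slope_le_deriv (x := x) (y := x + 1) hx.le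
    (show l ≤ x + 1 by linarith) (by linarith) (h.differentiableAt_maxReward ht hx)
  refine lt_of_lt_of_le ?_ h1
  rw [slope_def_field, add_sub_cancel_left, div_one]
  have h2 := h.maxReward_add_le ht hx (show x ≤ x + 1 by linarith)
  have h3 := h.strictMono (show 2 * (x - l) ∈ Set.Ici 0 by simp; linarith)
    (show 2 * (x - l) + (x + 1 - x) ∈ Set.Ici 0 by simp; linarith) (by linarith)
  have h4 := mul_pos (by positivity : 0 < Real.exp (-β) * (1 / 2)) (sub_pos.2 h3)
  linarith

theorem bddAbove_utilityConjugate {q : ℝ} (hq : 0 < q) :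
    BddAbove (Set.range fun c : ℝ≥0 => U c - c * q) := by
  obtain ⟨a, -, ha, haq⟩ := h.exists_U_div_mul_lt 1 hq 0
  refine ⟨U a, ?_⟩
  rintro _ ⟨c, rfl⟩
  have h1 := h.U_le_line ha c.2
  have h2 := mul_le_mul_of_nonneg_right haq.le c.2
  simp only [NNReal.val_eq_coe] at h1 h2
  linarith

theorem U_le_utilityConjugate {q : ℝ} (hq : 0 < q) {c : ℝ} (hc : 0 ≤ c) :
    U c ≤ utilityConjugate U q + q * c := by
  have := le_ciSup (h.bddAbove_utilityConjugate hq) ⟨c, hc⟩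
  change U c - c * q ≤ utilityConjugate U q at this
  linarith

theorem continuousOn_utilityConjugate : ContinuousOn (utilityConjugate U) (Set.Ioi 0) := by
  refine ConvexOn.continuousOn isOpen_Ioi ⟨convex_Ioi 0, fun p hp q hq a b ha hb hab => ?_⟩
  refine ciSup_le fun c => ?_
  have h1 := h.U_le_utilityConjugate hp c.2
  have h2 := h.U_le_utilityConjugate hq c.2
  have h3 := mul_le_mul_of_nonneg_left h1 ha
  have h4 := mul_le_mul_of_nonneg_left h2 hb
  simp only [smul_eq_mul, NNReal.val_eq_coe] at h1 h2 h3 h4 ⊢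
  have h5 : U c = a * U c + b * U c := by rw [← add_mul, hab, one_mul]
  linarith

/-- Upper bound from dynamic programming. -/
theorem maxReward_le_conjugate (ht : 0 ≤ t) (hx : l < x) {r : ℝ} (hr : t ≤ r) :
    maxReward U G β l t x ≤
      (r - t) * utilityConjugate U (Real.exp (-β * (r - t)) * deriv (maxReward U G β l r) x) +
      (∫ s in Set.Ioc t r, Real.exp (-β * (s - t)) * G s x) +
      Real.exp (-β * (r - t)) * maxReward U G β l r x := by
  have hr0 := ht.trans hr
  set q := deriv (maxReward U G β l r) x
  have hq : 0 < q := h.deriv_maxReward_pos hr0 hx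
  -- The slope is discounted so that the term `p * spent` in Fenchel's inequality cancels exactly
  -- the linear loss of final value given by concavity.
  set p := Real.exp (-β * (r - t)) * q
  have hp : 0 < p := by positivity
  refine maxReward_le hx.le fun c hc => ?_
  have h1 := h.reward_le_utility_add ht hc hr
  have h2 : ∫ s in Set.Ioc t r, Real.exp (-β * (s - t)) * U (c s) ≤
      (r - t) * utilityConjugate U p + p * ∫ s in Set.Ioc t r, c s := by
    have i1 := (h.integrableOn_utility hc).mono_set
      (show Set.Ioc t r ⊆ _ from Set.Ioc_subset_Ioi_self)
    have i2 : IntegrableOn (fun _ : ℝ => utilityConjugate U p) (Set.Ioc t r) :=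
      integrableOn_const (by simp)
    have i3 : IntegrableOn (fun s => p * c s) (Set.Ioc t r) := (hc.integrableOn hr).const_mul _
    calc ∫ s in Set.Ioc t r, Real.exp (-β * (s - t)) * U (c s)
        ≤ ∫ s in Set.Ioc t r, (utilityConjugate U p + p * c s) := by
          refine setIntegral_mono_on i1 (i2.add i3) measurableSet_Ioc fun s hs => ?_
          exact (mul_le_of_le_one_left (h.U_nonneg (hc.nonneg s))
            (discount_le_one h.β_pos hs.1.le)).trans (h.U_le_utilityConjugate hp (hc.nonneg s))
      _ = _ := by
          rw [integral_add i2 i3, integral_const_mul]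
          simp [hr]
  have h3 : maxReward U G β l r (x - ∫ u in Set.Ioc t r, c u) ≤
      maxReward U G β l r x - q * ∫ u in Set.Ioc t r, c u := by
    rcases (hc.spent_nonneg t r).eq_or_lt with h0 | h0
    · rw [← h0]; simp
    · have h4 := (h.concaveOn_maxReward hr0).deriv_le_slope
        (x := x - ∫ u in Set.Ioc t r, c u) (y := x)
        (show l ≤ _ by linarith [hc.spent_le hr]) hx.le (by linarith)
        (h.differentiableAt_maxReward hr0 hx)
      rw [slope_def_field, sub_sub_cancel, le_div_iff₀ h0] at h4
      linarith
  have h5 := mul_le_mul_of_nonneg_left h3 (Real.exp_pos (-β * (r - t))).le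
  have h6 : p * (∫ s in Set.Ioc t r, c s) =
    Real.exp (-β * (r - t)) * (q * ∫ s in Set.Ioc t r, c s) := by simp only [p]; ring
  linarith

/-- Lower bound from dynamic programming, with a constant consumption rate. -/
theorem le_maxReward_of_const (ht : 0 ≤ t) {r c : ℝ} (hr : t ≤ r) (hc : 0 ≤ c)
    (hx : c * (r - t) < x - l) :
    Real.exp (-β * (r - t)) * ((r - t) * U c) +
      (∫ s in Set.Ioc t r, Real.exp (-β * (s - t)) * G s (x - c * (r - t))) +
      Real.exp (-β * (r - t)) * (maxReward U G β l r x -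
        c * (r - t) * deriv (maxReward U G β l r) (x - c * (r - t))) ≤ maxReward U G β l t x := by
  have hr' : 0 ≤ r - t := sub_nonneg.2 hr
  have hcons : IsConsumption l t x ((Set.Ioc t (t + (r - t))).indicator fun _ => c) :=
    IsConsumption.const_mem hr' hc hx.le
  rw [add_sub_cancel] at hcons
  have key := h.add_maxReward_le ht hcons hr
  have hsp : ∀ s, t ≤ s → s ≤ r →
      ∫ u in Set.Ioc t s, (Set.Ioc t r).indicator (fun _ => c) u = c * (s - t) := by
    intro s hs hsr
    rw [IsConsumption.spent_congr (c' := fun _ => c) (fun u hu => Set.indicator_of_mem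
      (show u ∈ Set.Ioc t r from ⟨hu.1, hu.2.trans hsr⟩) _)]
    simp [mul_comm, hs]
  rw [hsp r hr le_rfl] at key
  refine le_trans (add_le_add ?_ ?_) key
  · have i1 : IntegrableOn (fun _ => Real.exp (-β * (r - t)) * U c) (Set.Ioc t r) :=
      integrableOn_const (by simp)
    have i2 := (h.integrableOn_G_const ht (x - c * (r - t))).mono_set
      (show Set.Ioc t r ⊆ _ from Set.Ioc_subset_Ioi_self)
    have e1 : Real.exp (-β * (r - t)) * ((r - t) * U c) =
        ∫ _ in Set.Ioc t r, Real.exp (-β * (r - t)) * U c := by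
      simp [hr]; ring
    rw [e1, ← integral_add i1 i2]
    refine setIntegral_mono_on (i1.add i2)
      ((h.integrableOn_rewardRate ht hcons).mono_set Set.Ioc_subset_Ioi_self) measurableSet_Ioc
      fun s hs => ?_
    rw [rewardRate, hsp s hs.1.le hs.2, Set.indicator_of_mem hs, mul_add]
    have e2 : Real.exp (-β * (r - t)) ≤ Real.exp (-β * (s - t)) :=
      Real.exp_le_exp.2 (by nlinarith [hs.2, h.β_pos])
    refine add_le_add (mul_le_mul_of_nonneg_right e2 (h.U_nonneg hc)) ?_
    refine mul_le_mul_of_nonneg_left (h.G_mono s ?_) (Real.exp_pos _).le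
    have := mul_le_mul_of_nonneg_left (sub_le_sub_right hs.2 t) hc
    linarith
  · refine mul_le_mul_of_nonneg_left ?_ (Real.exp_pos _).le
    rcases (mul_nonneg hc hr').eq_or_lt with h0 | h0
    · rw [← h0]; simp
    · have h4 := (h.concaveOn_maxReward (ht.trans hr)).slope_le_deriv (x := x - c * (r - t)) (y := x)
        (show l ≤ _ by linarith) (show l ≤ x by linarith) (by linarith)
        (h.differentiableAt_maxReward (ht.trans hr) (by linarith))
      rw [slope_def_field, sub_sub_cancel, div_le_iff₀ h0] at h4
      linarith

theorem tendsto_average_G (ht : 0 ≤ t) (c : ℝ) :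
    Tendsto (fun r => (∫ s in Set.Ioc t r, Real.exp (-β * (s - t)) * G s (x - c * (r - t))) / (r - t))
      (𝓝[>] t) (𝓝 (G t x)) := by
  refine tendsto_average_Ioc (φ := fun r s => Real.exp (-β * (s - t)) * G s (x - c * (r - t)))
    (fun η hη => ?_) ?_
  · have hcont : Continuous fun q : ℝ × ℝ => Real.exp (-β * (q.2 - t)) * G q.2 (x - c * (q.1 - t)) :=
      (by fun_prop : Continuous fun q : ℝ × ℝ => Real.exp (-β * (q.2 - t))).mul
        (h.continuous_G.comp (by fun_prop : Continuous fun q : ℝ × ℝ => (q.2, x - c * (q.1 - t))))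
    obtain ⟨δ, hδ, hball⟩ := Metric.continuousAt_iff.1 (hcont.continuousAt (x := (t, t))) η hη
    filter_upwards [Ioo_mem_nhdsGT (show t < t + δ by linarith)] with r hr s hs
    have h1 := @hball (r, s) (by
      rw [Prod.dist_eq, max_lt_iff, Real.dist_eq, Real.dist_eq, abs_of_pos (sub_pos.2 hr.1),
        abs_of_pos (sub_pos.2 hs.1)]
      exact ⟨by linarith [hr.2], by linarith [hr.2, hs.2]⟩)
    rw [Real.dist_eq] at h1
    simpa using h1.le
  · exact Eventually.of_forall fun r =>
      (h.integrableOn_G_const ht (x - c * (r - t))).mono_set Set.Ioc_subset_Ioi_self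

theorem tendsto_deriv_maxReward_path (ht : 0 ≤ t) (hx : l < x) (c : ℝ) :
    Tendsto (fun r => deriv (maxReward U G β l r) (x - c * (r - t))) (𝓝[>] t)
      (𝓝 (deriv (maxReward U G β l t) x)) := by
  refine (h.continuousOn_deriv_maxReward (t, x) ⟨ht, hx⟩).tendsto.comp
    (f := fun r : ℝ => (r, x - c * (r - t))) (tendsto_nhdsWithin_iff.2 ⟨?_, ?_⟩)
  · exact (Continuous.tendsto' (by fun_prop) _ _ (by simp)).mono_left nhdsWithin_le_nhds
  · have h2 : ∀ᶠ r : ℝ in 𝓝 t, l < x - c * (r - t) :=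
      (Continuous.tendsto' (by fun_prop : Continuous fun r : ℝ => x - c * (r - t)) t x
        (by simp)).eventually_const_lt hx
    filter_upwards [self_mem_nhdsWithin, nhdsWithin_le_nhds h2] with r hr hr2
    exact ⟨ht.trans (le_of_lt hr), hr2⟩

theorem tendsto_maxReward_time (ht : 0 ≤ t) (hx : l < x) :
    Tendsto (fun r => maxReward U G β l r x) (𝓝[>] t) (𝓝 (maxReward U G β l t x)) :=
  (h.continuousWithinAt_maxReward_time ht hx.le).tendsto.mono_left
    (nhdsWithin_mono t fun _ hr => ht.trans (le_of_lt hr))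

omit h in
theorem tendsto_exp_discount (β t : ℝ) :
    Tendsto (fun r => Real.exp (-β * (r - t))) (𝓝[>] t) (𝓝 1) :=
  (Continuous.tendsto' (by fun_prop) _ _ (by simp)).mono_left nhdsWithin_le_nhds

omit h in
theorem tendsto_one_sub_discount_div (β t : ℝ) :
    Tendsto (fun r => (1 - Real.exp (-β * (r - t))) / (r - t)) (𝓝[>] t) (𝓝 β) := by
  have h1 : HasDerivAt (fun r => -Real.exp (-β * (r - t))) β t := by
    have := ((((hasDerivAt_id t).sub_const t).const_mul (-β)).exp).fun_neg
    simpa using this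
  have h2 := (hasDerivAt_iff_tendsto_slope.1 h1).mono_left
    (nhdsWithin_mono t fun y (hy : t < y) => ne_of_gt hy)
  refine h2.congr fun r => ?_
  rw [slope_def_field]
  simp
  ring

/-- The upper bound `maxReward_le_conjugate` on the value at `t`, divided by `r - t`, becomes a
lower bound on the time slope. -/
theorem eventually_lt_slope_maxReward (ht : 0 ≤ t) (hx : l < x) {B : ℝ}
    (hB : B < β * maxReward U G β l t x - utilityConjugate U (deriv (maxReward U G β l t) x) -
      G t x) :
    ∀ᶠ r in 𝓝[>] t, B < slope (fun s => maxReward U G β l s x) t r := by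
  have limQ := h.tendsto_deriv_maxReward_path ht hx 0
  simp only [zero_mul, sub_zero] at limQ
  have limP := (tendsto_exp_discount β t).mul limQ
  rw [one_mul] at limP
  have limC : Tendsto (fun r => utilityConjugate U
      (Real.exp (-β * (r - t)) * deriv (maxReward U G β l r) x)) (𝓝[>] t)
      (𝓝 (utilityConjugate U (deriv (maxReward U G β l t) x))) :=
    ((h.continuousOn_utilityConjugate.continuousAt
      (Ioi_mem_nhds (h.deriv_maxReward_pos ht hx))).tendsto).comp limP
  have limG := h.tendsto_average_G (x := x) ht 0
  simp only [zero_mul, sub_zero] at limG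
  have limL := (((tendsto_one_sub_discount_div β t).mul (h.tendsto_maxReward_time ht hx)).sub
    limC).sub limG
  filter_upwards [limL.eventually_const_lt hB, self_mem_nhdsWithin] with r h1 hr
  have hr : 0 < r - t := sub_pos.2 hr
  refine h1.trans_le ?_
  have h2 := h.maxReward_le_conjugate ht hx (sub_nonneg.1 hr.le)
  rw [slope_def_field, div_mul_eq_mul_div, le_div_iff₀ hr, sub_mul, sub_mul,
    div_mul_cancel₀ _ hr.ne', div_mul_cancel₀ _ hr.ne']
  linarith

theorem eventually_slope_maxReward_lt (ht : 0 ≤ t) (hx : l < x) {B : ℝ}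
    (hB : β * maxReward U G β l t x - utilityConjugate U (deriv (maxReward U G β l t) x) -
      G t x < B) :
    ∀ᶠ r in 𝓝[>] t, slope (fun s => maxReward U G β l s x) t r < B := by
  -- A constant rate `c` that nearly attains the conjugate. The factors `1` are the limits of the
  -- discount, so the inequality has the form of the limit in `limU`.
  obtain ⟨c, hc0, hc⟩ : ∃ c : ℝ, 0 ≤ c ∧ β * maxReward U G β l t x - 1 * U c +
      c * (1 * deriv (maxReward U G β l t) x) - G t x < B := by
    obtain ⟨c, hc⟩ := exists_lt_of_lt_ciSup
      (show β * maxReward U G β l t x - G t x - B <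
        utilityConjugate U (deriv (maxReward U G β l t) x) by linarith)
    exact ⟨c, c.2, by linarith⟩
  have limU := (((((tendsto_one_sub_discount_div β t).mul (h.tendsto_maxReward_time ht hx)).sub
    ((tendsto_exp_discount β t).mul_const (U c)))).add
    (((tendsto_exp_discount β t).mul (h.tendsto_deriv_maxReward_path ht hx c)).const_mul c)).sub
    (h.tendsto_average_G (x := x) ht c)
  have hev : ∀ᶠ r : ℝ in 𝓝[>] t, c * (r - t) < x - l :=
    ((Continuous.tendsto' (by fun_prop : Continuous fun r : ℝ => c * (r - t)) t 0
      (by simp)).mono_left nhdsWithin_le_nhds).eventually_lt_const (sub_pos.2 hx)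
  filter_upwards [limU.eventually_lt_const hc, self_mem_nhdsWithin, hev] with r h1 hr hr2
  have hr : 0 < r - t := sub_pos.2 hr
  refine lt_of_le_of_lt ?_ h1
  have h2 := h.le_maxReward_of_const ht (sub_nonneg.1 hr.le) hc0 hr2
  rw [slope_def_field, div_mul_eq_mul_div, div_le_iff₀ hr, sub_mul, add_mul, sub_mul,
    div_mul_cancel₀ _ hr.ne', div_mul_cancel₀ _ hr.ne']
  linarith

/-- The Hamilton–Jacobi equation, for the right derivative in time. -/
theorem hasDerivWithinAt_maxReward_time (ht : 0 ≤ t) (hx : l < x) :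
    HasDerivWithinAt (fun s => maxReward U G β l s x)
      (β * maxReward U G β l t x - utilityConjugate U (deriv (maxReward U G β l t) x) - G t x)
      (Set.Ici t) t := by
  rw [← hasDerivWithinAt_Ioi_iff_Ici, hasDerivWithinAt_iff_tendsto_slope,
    Set.sdiff_singleton_eq_self (by simp)]
  exact tendsto_order.2 ⟨fun _ hB => h.eventually_lt_slope_maxReward ht hx hB,
    fun _ hB => h.eventually_slope_maxReward_lt ht hx hB⟩

theorem contDiffOn_maxReward :
    ContDiffOn ℝ 1 (fun q : ℝ × ℝ => maxReward U G β l q.1 q.2) (Set.Ici 0 ×ˢ Set.Ioi l) := by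
  refine contDiffOn_Ici_prod_Ioi h.continuousOn_maxReward
    (fun t ht x hx => (h.differentiableAt_maxReward ht hx).hasDerivAt)
    (fun t ht x hx => h.hasDerivWithinAt_maxReward_time ht hx) h.continuousOn_deriv_maxReward ?_
  refine ((continuousOn_const.mul h.continuousOn_maxReward).sub ?_).sub h.continuous_G.continuousOn
  exact h.continuousOn_utilityConjugate.comp h.continuousOn_deriv_maxReward fun q hq =>
    h.deriv_maxReward_pos hq.1 hq.2

end ConsumptionProblem

/-! ### Observations made before a trading date -/

/-- The sets whose trace on `D` is a preimage under `F` form a σ-algebra, so it suffices to check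
generators. -/
theorem exists_trace_of_generateFrom {X Y : Type*} [MeasurableSpace Y] {C : Set (Set X)} {D : Set X}
    {F : X → Y} (hC : ∀ A ∈ C, ∃ B, MeasurableSet B ∧ ∀ x ∈ D, x ∈ A ↔ F x ∈ B) {A : Set X}
    (hA : MeasurableSet[MeasurableSpace.generateFrom C] A) :
    ∃ B, MeasurableSet B ∧ ∀ x ∈ D, x ∈ A ↔ F x ∈ B := by
  induction A, hA using MeasurableSpace.generateFrom_induction with
  | hC t ht => exact hC t ht
  | empty => exact ⟨∅, .empty, by simp⟩
  | compl t _ ih =>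
    obtain ⟨B, hB, h⟩ := ih
    exact ⟨Bᶜ, hB.compl, fun x hx => not_congr (h x hx)⟩
  | iUnion s _ ih =>
    choose B hB h using ih
    refine ⟨⋃ i, B i, .iUnion hB, fun x hx => ?_⟩
    simp only [Set.mem_iUnion]
    exact exists_congr fun i => h i x hx

/-- If a function is measurable up to a trace, it agrees on the trace with a measurable function
of `F`. -/
theorem exists_measurable_eqOn_of_trace {X Y : Type*} [MeasurableSpace Y] {D : Set X} {F : X → Y}
    {g : X → ℝ} (hg : ∀ s : Set ℝ, MeasurableSet s →
      ∃ B, MeasurableSet B ∧ ∀ x ∈ D, x ∈ g ⁻¹' s ↔ F x ∈ B) :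
    ∃ f : Y → ℝ, Measurable f ∧ ∀ x ∈ D, g x = f (F x) := by
  have h1 : Measurable[MeasurableSpace.comap (fun x : D => F x) inferInstance]
      (fun x : D => g x) := by
    intro s hs
    obtain ⟨B, hB, h⟩ := hg s hs
    exact ⟨B, hB, by ext x; exact (h x x.2).symm⟩
  obtain ⟨f, hf, hfg⟩ := h1.exists_eq_measurable_comp
  exact ⟨f, hf, fun x hx => congrFun hfg ⟨x, hx⟩⟩

namespace IlliquidMarket

variable {Ω : Type*} [mΩ : MeasurableSpace Ω] (M : IlliquidMarket Ω)

theorem measurable_history (n : ℕ) : Measurable (M.history n) :=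
  measurable_pi_lambda _ fun i => (M.measurable_τ i).prodMk (M.measurable_Z i)

theorem measurable_wait (n : ℕ) : Measurable (M.wait n) :=
  (M.measurable_τ (n + 1)).coe_nnreal_real.sub (M.measurable_τ n).coe_nnreal_real

/-- Before `τ (n + 1)`, the generating events with index above `n` have not occurred, and those with
index at most `n` are read off the history. -/
theorem exists_trace_obs (n : ℕ) (s : ℝ≥0) {A : Set Ω} (hA : MeasurableSet[M.obs s] A) :
    ∃ B, MeasurableSet B ∧ ∀ ω, s < M.τ (n + 1) ω → (ω ∈ A ↔ M.history n ω ∈ B) := by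
  refine exists_trace_of_generateFrom (D := {ω | s < M.τ (n + 1) ω}) ?_ hA
  rintro _ ⟨k, B, hB, rfl⟩
  rcases lt_or_ge n k with hk | hk
  · refine ⟨∅, .empty, fun ω hω => ?_⟩
    have h1 : M.τ (n + 1) ω ≤ M.τ k ω := (M.τ_strictMono ω).monotone hk
    simp only [Set.mem_ofPred_eq, Set.mem_empty_iff_false, iff_false, not_and] at hω ⊢
    exact fun h => absurd (h1.trans h) (not_le.2 hω)
  · refine ⟨{h | (h ⟨k, Nat.lt_succ_of_le hk⟩).1 ≤ s ∧ h ⟨k, Nat.lt_succ_of_le hk⟩ ∈ B}, ?_, ?_⟩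
    · have hp : Measurable fun h : Fin (n + 1) → ℝ≥0 × ℝ => h ⟨k, Nat.lt_succ_of_le hk⟩ :=
        measurable_pi_apply _
      exact (measurableSet_le hp.fst measurable_const).inter (hp hB)
    · exact fun ω _ => Iff.rfl

/-- Between two trading dates, a predictable process depends only on the past observations. -/
theorem exists_predictable_eq (n : ℕ) {c : ℝ≥0 → Ω → ℝ}
    (hc : Measurable[M.obs.predictable] fun q : ℝ≥0 × Ω => c q.1 q.2) :
    ∃ f : ℝ≥0 × (Fin (n + 1) → ℝ≥0 × ℝ) → ℝ, Measurable f ∧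
      ∀ t ω, M.τ n ω < t → t ≤ M.τ (n + 1) ω → c t ω = f (t, M.history n ω) := by
  obtain ⟨f, hf, h⟩ := exists_measurable_eqOn_of_trace
    (D := {q : ℝ≥0 × Ω | M.τ n q.2 < q.1 ∧ q.1 ≤ M.τ (n + 1) q.2})
    (F := fun q => (q.1, M.history n q.2)) (g := fun q : ℝ≥0 × Ω => c q.1 q.2) (fun s hs => by
      refine exists_trace_of_generateFrom ?_ (hc hs)
      -- Generators at time `0` miss the interval `(τ n, τ (n + 1)]`. For `(i, ∞) × A` with `A`
      -- known at time `i`, points of the interval satisfy `i < t ≤ τ (n + 1)`, so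
      -- `exists_trace_obs` applies.
      rintro _ (⟨A, hA, rfl⟩ | ⟨i, A, hA, rfl⟩)
      · refine ⟨∅, .empty, fun q hq => ?_⟩
        simp only [Set.mem_prod, Set.mem_singleton_iff, Set.mem_empty_iff_false, iff_false, not_and]
        intro h0
        exact absurd hq.1 (by rw [h0]; simp)
      · obtain ⟨B, hB, h⟩ := M.exists_trace_obs n i hA
        refine ⟨Set.Ioi i ×ˢ B, measurableSet_Ioi.prod hB, fun q hq => ?_⟩
        simp only [Set.mem_prod, Set.mem_Ioi]
        exact and_congr_right fun hi => h q.2 (lt_of_lt_of_le hi hq.2))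
  exact ⟨f, hf, fun t ω h1 h2 => h (t, ω) ⟨h1, h2⟩⟩

/-- What is known at a trading date depends only on the past observations. -/
theorem exists_obsAt_eq (n : ℕ) {α : Ω → ℝ} (hα : Measurable[M.obsAt n] α) :
    ∃ f : (Fin (n + 1) → ℝ≥0 × ℝ) → ℝ, Measurable f ∧ ∀ ω, α ω = f (M.history n ω) := by
  obtain ⟨f, hf, h⟩ := exists_measurable_eqOn_of_trace (D := Set.univ) (F := M.history n) (g := α)
    (fun s hs => by
      have hE := hα hs
      have hq : ∀ q : ℝ≥0, ∃ B, MeasurableSet B ∧ ∀ ω, q < M.τ (n + 1) ω →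
          (ω ∈ (α ⁻¹' s) ∩ {ω | M.τ n ω ≤ q} ↔ M.history n ω ∈ B) := fun q => by
        refine M.exists_trace_obs n q ?_
        have := hE.2 q
        simpa only [WithTop.coe_le_coe] using this
      choose B hB h using hq
      -- A grid of mesh `1 / (m + 1)`. Its point `ρ m (idx m (τ n))` is at least `τ n` and exceeds
      -- it by at most the mesh, hence precedes `τ (n + 1)` for large `m`; what is known at that
      -- deterministic time is a function of the history.
      let ρ : ℕ → ℕ → ℝ≥0 := fun m j => (j + 1) / (m + 1)
      let idx : ℕ → ℝ≥0 → ℕ := fun m t => ⌊t * (m + 1)⌋₊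
      have hidx : ∀ m, Measurable (idx m) := fun m =>
        Nat.measurable_floor.comp (measurable_id.mul_const _)
      let B' : ℕ → Set (Fin (n + 1) → ℝ≥0 × ℝ) := fun m =>
        ⋃ j, {y | idx m (y (Fin.last n)).1 = j} ∩ B (ρ m j)
      have hB' : ∀ m, MeasurableSet (B' m) := fun m => .iUnion fun j =>
        (((hidx m).comp (measurable_pi_apply (Fin.last n)).fst) (measurableSet_singleton j)).inter
          (hB _)
      have hev : ∀ ω, ∀ᶠ m in atTop, (ω ∈ α ⁻¹' s ↔ M.history n ω ∈ B' m) := by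
        intro ω
        have hlt : M.τ n ω < M.τ (n + 1) ω := M.τ_strictMono ω n.lt_succ_self
        have hlim : Tendsto (fun m : ℕ => M.τ n ω + 1 / ((m : ℝ≥0) + 1)) atTop
            (𝓝 (M.τ n ω + 0)) := tendsto_const_nhds.add tendsto_one_div_add_atTop_nhds_zero_nat
        rw [add_zero] at hlim
        filter_upwards [hlim.eventually_lt_const hlt] with m hm
        have hpos : (0 : ℝ≥0) < m + 1 := by positivity
        have h1 : ρ m (idx m (M.τ n ω)) ≤ M.τ n ω + 1 / ((m : ℝ≥0) + 1) := by
          simp only [ρ, idx]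
          rw [add_div]
          gcongr
          rw [div_le_iff₀ hpos]
          exact Nat.floor_le zero_le
        have h2 : M.τ n ω ≤ ρ m (idx m (M.τ n ω)) := by
          simp only [ρ, idx]
          rw [le_div_iff₀ hpos]
          exact (Nat.lt_floor_add_one _).le
        have h3 := h (ρ m (idx m (M.τ n ω))) ω (h1.trans_lt hm)
        simp only [B', Set.mem_iUnion, Set.mem_inter_iff, Set.mem_ofPred_eq, history,
          Fin.val_last] at h3 ⊢
        constructor
        · intro hω
          exact ⟨_, rfl, h3.1 ⟨hω, h2⟩⟩
        · rintro ⟨j, rfl, hj⟩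
          exact (h3.2 hj).1
      -- The description by `B' m` is valid only for `m` large depending on `ω`, so the lower limit
      -- of these sets is taken.
      refine ⟨⋃ N, ⋂ m, ⋂ (_ : N ≤ m), B' m, .iUnion fun N => .iInter fun m => .iInter fun _ => hB' m,
        fun ω _ => ?_⟩
      simp only [Set.mem_iUnion, Set.mem_iInter]
      obtain ⟨N₀, hN₀⟩ := eventually_atTop.1 (hev ω)
      constructor
      · exact fun hω => ⟨N₀, fun m hm => (hN₀ m hm).1 hω⟩
      · rintro ⟨N, hN⟩
        exact (hN₀ (max N N₀) (le_max_right _ _)).2 (hN _ (le_max_left _ _)))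
  exact ⟨f, hf, fun ω => h ω trivial⟩

end IlliquidMarket

/-! ### A power function dominates the deterministic problem -/

/-- With `Y` the current wealth, the first term will be absorbed by the discount `δ` and the second
by the decrease of wealth. -/
theorem rpow_le_add_mul {γ Y c : ℝ} (hγ0 : 0 < γ) (hγ1 : γ < 1) (hY : 0 < Y) (hc : 0 ≤ c) :
    c ^ γ ≤ Y ^ γ + Y ^ (γ - 1) * c := by
  rcases le_total c Y with h | h
  · have := Real.rpow_le_rpow hc h hγ0.le
    have := mul_nonneg (Real.rpow_nonneg hY.le (γ - 1)) hc
    linarith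
  · have hc' : 0 < c := hY.trans_le h
    have h1 : c ^ γ = c ^ (γ - 1) * c := by
      rw [← Real.rpow_add_one hc'.ne']; ring_nf
    have h2 : c ^ (γ - 1) ≤ Y ^ (γ - 1) := Real.rpow_le_rpow_of_nonpos hY h (by linarith)
    have := mul_le_mul_of_nonneg_right h2 hc
    have := Real.rpow_nonneg hY.le γ
    linarith

/-- A verification argument: with wealth `y` and `y' = -g`, the decrease rate of `exp (-(δ + ν) s) K
(y + ε) ^ γ` dominates the integrand, because `K = K₁ (1 / δ + 1 / γ)` satisfies `K₁ ≤ K δ` and `K₁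
≤ K γ`. The shift `ε` avoids the singularity of `y ^ (γ - 1)` at zero wealth. -/
theorem setLIntegral_power_le {γ δ ν K₁ X ε T : ℝ} {g : ℝ → ℝ} (hγ0 : 0 < γ) (hγ1 : γ < 1)
    (hδ : 0 < δ) (hν : 0 ≤ ν) (hK₁ : 0 ≤ K₁) (hg : ∀ s, 0 ≤ g s) (hT : 0 ≤ T) (hε : 0 < ε)
    (hgi : IntegrableOn g (Set.Ioc 0 T)) (hy : ∀ s, 0 ≤ s → s ≤ T → ∫ u in Set.Ioc 0 s, g u ≤ X) :
    ∫⁻ s in Set.Ioc 0 T, ENNReal.ofReal (Real.exp (-(δ + ν) * s) * (K₁ * g s ^ γ +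
      ν * (K₁ * (1 / δ + 1 / γ)) * (X - ∫ u in Set.Ioc 0 s, g u) ^ γ)) ≤
      ENNReal.ofReal (K₁ * (1 / δ + 1 / γ) * (X + ε) ^ γ) := by
  set K := K₁ * (1 / δ + 1 / γ)
  have hK : 0 ≤ K := by positivity
  have hKδ : K₁ ≤ K * δ := by
    have : K * δ = K₁ + K₁ * δ / γ := by simp only [K]; field_simp
    have : 0 ≤ K₁ * δ / γ := by positivity
    linarith
  have hKγ : K₁ ≤ K * γ := by
    have : K * γ = K₁ + K₁ * γ / δ := by simp only [K]; field_simp; ring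
    have : 0 ≤ K₁ * γ / δ := by positivity
    linarith
  set y : ℝ → ℝ := fun s => X - ∫ u in (0 : ℝ)..s, g u
  have hyI : ∀ s, 0 ≤ s → X - ∫ u in Set.Ioc 0 s, g u = y s := fun s hs => by
    simp only [y]; rw [intervalIntegral.integral_of_le hs]
  have hy0 : ∀ s, 0 ≤ s → s ≤ T → 0 ≤ y s := fun s h0 h1 => by
    rw [← hyI s h0]; linarith [hy s h0 h1]
  have hya : ∀ s r, 0 ≤ s → s ≤ r → r ≤ T → y r ≤ y s := fun s r h0 h1 h2 => by
    rw [← hyI s h0, ← hyI r (h0.trans h1)]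
    have := setIntegral_mono_set (hgi.mono_set (Set.Ioc_subset_Ioc_right h2))
      (Eventually.of_forall fun u => hg u) (show Set.Ioc 0 s ⊆ Set.Ioc 0 r from
        Set.Ioc_subset_Ioc_right h1).eventuallyLE
    linarith
  -- `Ψ` is nondecreasing, so the integral of its derivative is at most its increment; absolute
  -- continuity is not required.
  set Ψ : ℝ → ℝ := fun s => -(Real.exp (-(δ + ν) * s) * (K * (y s + ε) ^ γ))
  have hΨ : MonotoneOn Ψ (Set.uIcc 0 T) := by
    rw [Set.uIcc_of_le hT]
    intro s hs r hr hsr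
    have h1 : Real.exp (-(δ + ν) * r) ≤ Real.exp (-(δ + ν) * s) :=
      Real.exp_le_exp.2 (by nlinarith)
    have h2 : (y r + ε) ^ γ ≤ (y s + ε) ^ γ :=
      Real.rpow_le_rpow (by linarith [hy0 r hr.1 hr.2]) (by linarith [hya s r hs.1 hsr hr.2]) hγ0.le
    have h3 : 0 ≤ (y r + ε) ^ γ := Real.rpow_nonneg (by linarith [hy0 r hr.1 hr.2]) _
    simp only [Ψ]
    refine neg_le_neg ?_
    gcongr
  have hint : IntegrableOn (deriv Ψ) (Set.Ioc 0 T) :=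
    (intervalIntegrable_iff_integrableOn_Ioc_of_le hT).1 hΨ.intervalIntegrable_deriv
  have hle : ∫ s in Set.Ioc 0 T, deriv Ψ s ≤ K * (X + ε) ^ γ := by
    have h1 := hΨ.intervalIntegral_deriv_mem_uIcc
    have h2 : Ψ 0 ≤ Ψ T := hΨ (by simp) (by simp) hT
    rw [Set.uIcc_of_le (by linarith), intervalIntegral.integral_of_le hT] at h1
    have h3 : 0 ≤ (y T + ε) ^ γ := Real.rpow_nonneg (by linarith [hy0 T hT le_rfl]) _
    have h4 : 0 ≤ Real.exp (-(δ + ν) * T) * (K * (y T + ε) ^ γ) := by positivity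
    have h5 : Ψ 0 = -(K * (X + ε) ^ γ) := by simp [Ψ, y]
    have h6 : Ψ T = -(Real.exp (-(δ + ν) * T) * (K * (y T + ε) ^ γ)) := rfl
    linarith [h1.2]
  have hpt : ∀ᵐ s ∂(volume.restrict (Set.Ioc 0 T)), Real.exp (-(δ + ν) * s) * (K₁ * g s ^ γ +
      ν * K * (X - ∫ u in Set.Ioc 0 s, g u) ^ γ) ≤ deriv Ψ s := by
    have hgI : IntervalIntegrable g volume 0 T :=
      (intervalIntegrable_iff_integrableOn_Ioc_of_le hT).2 hgi
    filter_upwards [ae_restrict_of_ae hgI.ae_hasDerivAt_integral, ae_restrict_mem measurableSet_Ioc]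
      with s hs hsm
    rw [Set.uIcc_of_le hT] at hs
    have hys : HasDerivAt y (-g s) s := (hs ⟨hsm.1.le, hsm.2⟩ 0 ⟨le_rfl, hT⟩).const_sub X
    have hY : 0 < y s + ε := by linarith [hy0 s hsm.1.le hsm.2]
    have hd : HasDerivAt Ψ (-(Real.exp (-(δ + ν) * s) * (-(δ + ν)) * (K * (y s + ε) ^ γ) +
        Real.exp (-(δ + ν) * s) * (K * (-g s * γ * (y s + ε) ^ (γ - 1))))) s := by
      have e1 : HasDerivAt (fun s => Real.exp (-(δ + ν) * s))
          (Real.exp (-(δ + ν) * s) * (-(δ + ν))) s := by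
        simpa using ((hasDerivAt_id s).const_mul (-(δ + ν))).exp
      have e2 : HasDerivAt (fun s => (y s + ε) ^ γ) (-g s * γ * (y s + ε) ^ (γ - 1)) s :=
        (hys.add_const ε).rpow_const (Or.inl hY.ne')
      exact (e1.mul (e2.const_mul K)).neg
    rw [hd.deriv, hyI s hsm.1.le]
    have h1 := rpow_le_add_mul hγ0 hγ1 hY (hg s)
    have h2 : y s ^ γ ≤ (y s + ε) ^ γ :=
      Real.rpow_le_rpow (hy0 s hsm.1.le hsm.2) (by linarith) hγ0.le
    have h3 := Real.rpow_nonneg hY.le γ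
    have h4 := mul_nonneg (Real.rpow_nonneg hY.le (γ - 1)) (hg s)
    have h5 := mul_le_mul_of_nonneg_left h1 hK₁
    have h6 := mul_le_mul_of_nonneg_right hKδ h3
    have h7 := mul_le_mul_of_nonneg_right hKγ h4
    have h8 := mul_le_mul_of_nonneg_left h2 (mul_nonneg hν hK)
    have h9 : K₁ * g s ^ γ + ν * K * y s ^ γ ≤
        (δ + ν) * (K * (y s + ε) ^ γ) + K * (g s * γ * (y s + ε) ^ (γ - 1)) := by linarith
    have h10 := mul_le_mul_of_nonneg_left h9 (Real.exp_pos (-(δ + ν) * s)).le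
    linarith
  have hnn : 0 ≤ᵐ[volume.restrict (Set.Ioc 0 T)] deriv Ψ := by
    filter_upwards [hpt, ae_restrict_mem measurableSet_Ioc] with s hs hsm
    refine le_trans ?_ hs
    rw [hyI s hsm.1.le]
    have h1 := Real.rpow_nonneg (hy0 s hsm.1.le hsm.2) γ
    have h2 := Real.rpow_nonneg (hg s) γ
    positivity
  calc _ ≤ ∫⁻ s in Set.Ioc 0 T, ENNReal.ofReal (deriv Ψ s) :=
        lintegral_mono_ae (hpt.mono fun s hs => ENNReal.ofReal_le_ofReal hs)
    _ = ENNReal.ofReal (∫ s in Set.Ioc 0 T, deriv Ψ s) :=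
        (ofReal_integral_eq_lintegral_ofReal hint hnn).symm
    _ ≤ _ := ENNReal.ofReal_le_ofReal hle

theorem setLIntegral_Ioi_le_of_Ioc {f : ℝ → ℝ≥0∞} {B : ℝ≥0∞}
    (h : ∀ T, 0 ≤ T → ∫⁻ s in Set.Ioc 0 T, f s ≤ B) : ∫⁻ s in Set.Ioi 0, f s ≤ B := by
  have h1 : (⋃ n : ℕ, Set.Ioc (0 : ℝ) n) = Set.Ioi 0 := by
    ext x
    simp only [Set.mem_iUnion, Set.mem_Ioc, Set.mem_Ioi]
    exact ⟨fun ⟨n, hn⟩ => hn.1, fun hx => (exists_nat_ge x).imp fun n hn => ⟨hx, hn⟩⟩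
  rw [← h1, setLIntegral_iUnion_of_directed]
  · exact iSup_le fun n => h n n.cast_nonneg
  · exact Monotone.directed_le fun m n hmn => Set.Ioc_subset_Ioc_right (Nat.cast_le.2 hmn)

theorem lintegral_power_le {γ δ ν K₁ X : ℝ} {g : ℝ → ℝ} (hγ0 : 0 < γ) (hγ1 : γ < 1)
    (hδ : 0 < δ) (hν : 0 ≤ ν) (hK₁ : 0 ≤ K₁) (hg : ∀ s, 0 ≤ g s)
    (hgi : ∀ T, 0 ≤ T → IntegrableOn g (Set.Ioc 0 T))
    (hy : ∀ s, 0 ≤ s → ∫ u in Set.Ioc 0 s, g u ≤ X) :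
    ∫⁻ s in Set.Ioi 0, ENNReal.ofReal (Real.exp (-(δ + ν) * s) * (K₁ * g s ^ γ +
      ν * (K₁ * (1 / δ + 1 / γ)) * (X - ∫ u in Set.Ioc 0 s, g u) ^ γ)) ≤
      ENNReal.ofReal (K₁ * (1 / δ + 1 / γ) * X ^ γ) := by
  refine setLIntegral_Ioi_le_of_Ioc fun T hT => ?_
  have hlim : Tendsto (fun ε => ENNReal.ofReal (K₁ * (1 / δ + 1 / γ) * (X + ε) ^ γ)) (𝓝[>] 0)
      (𝓝 (ENNReal.ofReal (K₁ * (1 / δ + 1 / γ) * X ^ γ))) := by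
    have hX : 0 ≤ X := by simpa using hy 0 le_rfl
    have hc : Continuous fun ε : ℝ => ENNReal.ofReal (K₁ * (1 / δ + 1 / γ) * (X + ε) ^ γ) :=
      ENNReal.continuous_ofReal.comp (continuous_const.mul
        ((continuous_const.add continuous_id).rpow_const fun _ => Or.inr hγ0.le))
    exact (hc.tendsto' 0 _ (by simp)).mono_left nhdsWithin_le_nhds
  refine ge_of_tendsto hlim ?_
  filter_upwards [self_mem_nhdsWithin] with ε hε
  exact setLIntegral_power_le hγ0 hγ1 hδ hν hK₁ hg hT hε (hgi T hT) fun s h0 _ => hy s h0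

/-! ### The distribution of the returns -/

namespace ReturnAssumption

variable {Ω : Type*} [MeasurableSpace Ω] {P : Measure Ω} {M : IlliquidMarket Ω} {p : Kernel ℝ ℝ}
  {zlo : ℝ} {zhi : EReal} {lam k b : ℝ} (hH : ReturnAssumption M P lam p zlo zhi k b)
include hH

/-- In the interval case, a support point beyond an end would put that end in the interior of the
support. -/
theorem mem_support_bounds {t z : ℝ} (ht : 0 < t) (hz : z ∈ (p t).support) :
    -zlo ≤ z ∧ (z : EReal) ≤ zhi := by
  have hlo := hH.zlo_pos
  rcases hH.support t ht with ⟨hc, hi⟩ | ⟨-, hl, r, hr, hg⟩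
  · have h0 : (0 : ℝ) ∈ interior (p t).support := by
      rw [hi]
      exact ⟨by linarith, hH.zhi_pos⟩
    constructor
    · by_contra! hlt
      have h1 : Set.Ioo z 0 ⊆ interior (p t).support :=
        interior_maximal (Set.Ioo_subset_Icc_self.trans (hc.out hz (interior_subset h0)))
          isOpen_Ioo
      have h2 := h1 (show -zlo ∈ Set.Ioo z 0 from ⟨hlt, by linarith⟩)
      rw [hi] at h2
      exact lt_irrefl _ h2.1
    · by_contra! hlt
      lift zhi to ℝ using ⟨ne_top_of_lt hlt, ne_bot_of_gt hH.zhi_pos⟩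
      have h1 : Set.Ioo 0 z ⊆ interior (p t).support :=
        interior_maximal (Set.Ioo_subset_Icc_self.trans (hc.out (interior_subset h0) hz))
          isOpen_Ioo
      have h2 := h1 (show zhi ∈ Set.Ioo 0 z from
        ⟨EReal.coe_pos.1 hH.zhi_pos, EReal.coe_lt_coe_iff.1 hlt⟩)
      rw [hi] at h2
      exact lt_irrefl _ h2.2
  · exact ⟨hl.2 hz, hr ▸ EReal.coe_le_coe_iff.2 (hg.2 hz)⟩

theorem neg_zlo_mem_support {t : ℝ} (ht : 0 < t) : -zlo ∈ (p t).support := by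
  have hlo := hH.zlo_pos
  rcases hH.support t ht with ⟨-, hi⟩ | ⟨-, hl, -⟩
  · have hsub : Set.Ioo (-zlo) 0 ⊆ (p t).support := fun z hz => by
      refine interior_subset ?_
      rw [hi]
      exact ⟨hz.1, (EReal.coe_lt_coe_iff.2 hz.2).trans hH.zhi_pos⟩
    have h1 := closure_minimal hsub Measure.isClosed_support
    rw [closure_Ioo (by linarith)] at h1
    exact h1 ⟨le_rfl, by linarith⟩
  · exact hl.1

theorem exists_pos_mem_support {t : ℝ} (ht : 0 < t) : ∃ z, 0 < z ∧ z ∈ (p t).support := by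
  rcases hH.support t ht with ⟨-, hi⟩ | ⟨-, -, r, hr, hg⟩
  · obtain ⟨z, hz0, hz⟩ := EReal.lt_iff_exists_real_btwn.1 hH.zhi_pos
    refine ⟨z, EReal.coe_pos.1 hz0, interior_subset ?_⟩
    rw [hi]
    exact ⟨by linarith [EReal.coe_pos.1 hz0, hH.zlo_pos], hz⟩
  · exact ⟨r, EReal.coe_pos.1 (hr ▸ hH.zhi_pos), hg.1⟩

/-- A position that almost surely leaves a nonnegative wealth is bounded by the initial wealth. -/
theorem mul_zlo_le_of_ae {t y a : ℝ} (ht : 0 < t) (h : ∀ᵐ z ∂(p t), 0 ≤ y + a * z) :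
    a * zlo ≤ y ∧ 0 ≤ y := by
  have hS : (p t).support ⊆ {z | 0 ≤ y + a * z} :=
    Measure.support_subset_of_isClosed
      (isClosed_le continuous_const (by fun_prop)) h
  have h1 : 0 ≤ y + a * -zlo := hS (hH.neg_zlo_mem_support ht)
  obtain ⟨z, hz0, hz⟩ := hH.exists_pos_mem_support ht
  have h2 : 0 ≤ y + a * z := hS hz
  have hlo := hH.zlo_pos
  refine ⟨by linarith, ?_⟩
  rcases le_total a 0 with ha | ha
  · nlinarith
  · nlinarith

theorem ae_nonneg_of_minWealth_le {t y a : ℝ} (ht : 0 < t) (ha : a ∈ investments zhi)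
    (hy : minWealth zlo zhi a ≤ y) : ∀ᵐ z ∂(p t), 0 ≤ y + a * z := by
  filter_upwards [Measure.support_mem_ae (μ := p t)] with z hz
  obtain ⟨h1, h2⟩ := hH.mem_support_bounds ht hz
  by_cases htop : zhi = ⊤
  · simp only [investments, minWealth, htop, if_true, Set.mem_Ici] at ha hy
    nlinarith
  · lift zhi to ℝ using ⟨htop, ne_bot_of_gt hH.zhi_pos⟩
    simp only [minWealth, EReal.coe_ne_top, if_false, EReal.toReal_coe, max_le_iff] at hy
    rw [EReal.coe_le_coe_iff] at h2
    rcases le_total a 0 with ha | ha <;> nlinarith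

theorem minWealth_nonneg (a : ℝ) (ha : a ∈ investments zhi) : 0 ≤ minWealth zlo zhi a :=
  (hH.mul_zlo_le_of_ae one_pos (hH.ae_nonneg_of_minWealth_le one_pos ha le_rfl)).2

/-- The mean return is nonnegative, so the worst case is the largest position `a = y / zlo`; `zlo ≤
1` then allows the factor `(1 + m) / zlo`. -/
theorem wealth_mean_le [IsMarkovKernel p] {t y a : ℝ} (ht : 0 ≤ t) (hy : 0 ≤ y)
    (ha : a * zlo ≤ y) :
    y + a * ∫ z, z ∂(p t) ≤ k * Real.exp (b * t) / zlo * y := by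
  have h1 := hH.mean_le t ht
  have h2 := hH.mean_nonneg t ht
  rw [integral_add (integrable_const _) (hH.integrable t ht)] at h1
  simp only [integral_const, probReal_univ, smul_eq_mul, mul_one] at h1
  have hlo := hH.zlo_pos
  have hlo1 := hH.zlo_le
  set m := ∫ z, z ∂(p t)
  have h3 : y + a * m ≤ (1 + m) / zlo * y := by
    rw [div_mul_eq_mul_div, le_div_iff₀ hlo]
    nlinarith [mul_le_mul_of_nonneg_right ha h2, mul_le_mul_of_nonneg_left hlo1 hy]
  refine h3.trans ?_
  gcongr

/-- Jensen's inequality for the concave power, followed by the bound on the mean wealth. -/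
theorem rpow_wealth [IsMarkovKernel p] {t y a γ : ℝ} (ht : 0 < t) (hγ0 : 0 < γ) (hγ1 : γ < 1)
    (h : ∀ᵐ z ∂(p t), 0 ≤ y + a * z) :
    Integrable (fun z => (y + a * z) ^ γ) (p t) ∧
      ∫ z, (y + a * z) ^ γ ∂(p t) ≤ k ^ γ / zlo ^ γ * Real.exp (b * γ * t) * y ^ γ := by
  obtain ⟨ha, hy⟩ := hH.mul_zlo_le_of_ae ht h
  have hi : Integrable (fun z => y + a * z) (p t) :=
    (integrable_const _).add ((hH.integrable t ht.le).const_mul a)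
  have hc : Continuous fun x : ℝ => x ^ γ := Real.continuous_rpow_const hγ0.le
  have hI : Integrable (fun z => (y + a * z) ^ γ) (p t) := by
    refine (hi.norm.add (integrable_const 1)).mono'
      (hc.comp (by fun_prop : Continuous fun z => y + a * z)).aestronglyMeasurable ?_
    filter_upwards [h] with z hz
    simp only [Pi.add_apply, Real.norm_eq_abs]
    rw [abs_of_nonneg hz, abs_of_nonneg (Real.rpow_nonneg hz _)]
    rcases le_total (y + a * z) 1 with h1 | h1
    · linarith [Real.rpow_le_one hz h1 hγ0.le]
    · linarith [Real.rpow_le_self_of_one_le h1 hγ1.le]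
  refine ⟨hI, ?_⟩
  refine ((Real.concaveOn_rpow hγ0.le hγ1.le).le_map_integral hc.continuousOn isClosed_Ici h
    hi hI).trans ?_
  rw [integral_add (integrable_const _) ((hH.integrable t ht.le).const_mul a), integral_const_mul]
  simp only [integral_const, probReal_univ, smul_eq_mul, one_mul]
  have h0 : 0 ≤ y + a * ∫ z, z ∂(p t) := by
    have := integral_nonneg_of_ae h
    rwa [integral_add (integrable_const _) ((hH.integrable t ht.le).const_mul a),
      integral_const_mul, integral_const, probReal_univ, one_smul] at this
  refine (Real.rpow_le_rpow h0 (hH.wealth_mean_le ht.le hy ha) hγ0.le).trans_eq ?_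
  have hk := hH.k_nonneg
  have hlo := hH.zlo_pos.le
  rw [Real.mul_rpow (by positivity) hy, Real.div_rpow (by positivity) hlo,
    Real.mul_rpow hk (by positivity), ← Real.exp_mul]
  ring_nf

end ReturnAssumption

/-! ### Exponential waiting times -/

theorem lintegral_expMeasure (lam : ℝ) (F : ℝ → ℝ≥0∞) :
    ∫⁻ T, F T ∂(expMeasure lam) =
      ∫⁻ T in Set.Ioi 0, ENNReal.ofReal (lam * Real.exp (-(lam * T))) * F T := by
  have h1 : expMeasure lam = volume.withDensity (exponentialPDF lam) := rfl
  have hm : Measurable (exponentialPDF lam) := (measurable_exponentialPDFReal lam).ennreal_ofReal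
  rw [h1, lintegral_withDensity_eq_lintegral_mul_non_measurable _ hm
    (Eventually.of_forall fun _ => ENNReal.ofReal_lt_top), ← setLIntegral_congr Ioi_ae_eq_Ici.symm,
    ← lintegral_indicator measurableSet_Ici]
  refine lintegral_congr fun T => ?_
  simp only [Pi.mul_apply, exponentialPDF_eq, Set.indicator_apply, Set.mem_Ici]
  split_ifs <;> simp

theorem ae_expMeasure_iff {lam : ℝ} (hlam : 0 < lam) {q : ℝ → Prop} :
    (∀ᵐ T ∂(expMeasure lam), q T) ↔ ∀ᵐ T ∂(volume.restrict (Set.Ioi 0)), q T := by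
  have h1 : expMeasure lam = volume.withDensity (exponentialPDF lam) := rfl
  have hm : Measurable (exponentialPDF lam) := (measurable_exponentialPDFReal lam).ennreal_ofReal
  rw [h1, ae_withDensity_iff hm, ← Measure.restrict_congr_set Ioi_ae_eq_Ici.symm,
    ae_restrict_iff' measurableSet_Ici]
  refine eventually_congr (Eventually.of_forall fun T => imp_congr_left ?_)
  rw [exponentialPDF_eq]
  simp only [ne_eq, ENNReal.ofReal_eq_zero, not_le, Set.mem_Ici]
  split_ifs with h
  · exact iff_of_true (by positivity) h
  · exact iff_of_false (by simp) h

theorem lintegral_Ici_exp {lam : ℝ} (hlam : 0 < lam) (s : ℝ) :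
    ∫⁻ T in Set.Ici s, ENNReal.ofReal (lam * Real.exp (-(lam * T))) =
      ENNReal.ofReal (Real.exp (-(lam * s))) := by
  rw [setLIntegral_congr Ioi_ae_eq_Ici.symm]
  have hi : IntegrableOn (fun T => lam * Real.exp (-lam * T)) (Set.Ioi s) :=
    (integrableOn_exp_mul_Ioi (by linarith) s).const_mul lam
  simp only [← neg_mul]
  rw [← ofReal_integral_eq_lintegral_ofReal hi
    (Eventually.of_forall fun T => by positivity), integral_const_mul,
    integral_exp_mul_Ioi (by linarith)]
  congr 1
  field_simp

/-- The discount produced by an exponential waiting time. -/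
theorem lintegral_expMeasure_setLIntegral {lam : ℝ} (hlam : 0 < lam) {φ : ℝ → ℝ≥0∞}
    (hφ : Measurable φ) :
    ∫⁻ T, (∫⁻ s in Set.Ioc 0 T, φ s) ∂(expMeasure lam) =
      ∫⁻ s in Set.Ioi 0, ENNReal.ofReal (Real.exp (-(lam * s))) * φ s := by
  have hE : Measurable fun T : ℝ => ENNReal.ofReal (lam * Real.exp (-(lam * T))) := by fun_prop
  have h1 : ∀ T, ENNReal.ofReal (lam * Real.exp (-(lam * T))) * ∫⁻ s in Set.Ioc 0 T, φ s =
      ∫⁻ s in Set.Ioi 0, {q : ℝ × ℝ | q.2 ≤ q.1}.indicator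
        (fun q => ENNReal.ofReal (lam * Real.exp (-(lam * q.1))) * φ q.2) (T, s) := fun T => by
    rw [← lintegral_const_mul _ hφ, ← lintegral_indicator measurableSet_Ioi,
      ← lintegral_indicator measurableSet_Ioc]
    refine lintegral_congr fun s => ?_
    by_cases h0 : 0 < s <;> by_cases hs : s ≤ T <;> simp [Set.indicator_apply, h0, hs]
  have hS : MeasurableSet {q : ℝ × ℝ | q.2 ≤ q.1} := measurableSet_le measurable_snd measurable_fst
  rw [lintegral_expMeasure]
  simp_rw [h1]
  rw [lintegral_lintegral_swap]
  · refine setLIntegral_congr_fun measurableSet_Ioi fun s hs => ?_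
    have h2 : ∀ T, {q : ℝ × ℝ | q.2 ≤ q.1}.indicator
        (fun q => ENNReal.ofReal (lam * Real.exp (-(lam * q.1))) * φ q.2) (T, s) =
        (Set.Ici s).indicator (fun T => ENNReal.ofReal (lam * Real.exp (-(lam * T))) * φ s) T :=
      fun T => by simp [Set.indicator_apply]
    simp_rw [h2]
    rw [lintegral_indicator measurableSet_Ici, Measure.restrict_restrict measurableSet_Ici,
      Set.inter_eq_left.2 (Set.Ici_subset_Ioi.2 hs), lintegral_mul_const _ hE,
      lintegral_Ici_exp hlam]
  · exact (((hE.comp measurable_fst).mul (hφ.comp measurable_snd)).indicator hS).aemeasurable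

/-! ### The one-period estimate -/

namespace ReturnAssumption

variable {Ω : Type*} [MeasurableSpace Ω] {P : Measure Ω} {M : IlliquidMarket Ω} {p : Kernel ℝ ℝ}
  {zlo : ℝ} {zhi : EReal} {lam k b : ℝ} (hH : ReturnAssumption M P lam p zlo zhi k b)
include hH

/-- Between two trading dates, the expected power utility of consumption and of the discounted
wealth does not exceed the power utility of the initial wealth. -/
theorem one_period [IsMarkovKernel p] {δ γ ρ K₁ X a : ℝ} {g : ℝ → ℝ} (hγ0 : 0 < γ) (hγ1 : γ < 1)
    (hδ : 0 < δ) (hρ : ρ = δ + b * γ + lam * (k ^ γ / zlo ^ γ - 1)) (hK₁ : 0 ≤ K₁)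
    (hgm : Measurable g) (hg : ∀ s, 0 ≤ g s)
    (hae : ∀ᵐ T ∂(expMeasure lam), IntegrableOn g (Set.Ioc 0 T) ∧
      ∀ᵐ z ∂(p T), 0 ≤ X - (∫ u in Set.Ioc 0 T, g u) + a * z) :
    ∫⁻ T, ((∫⁻ s in Set.Ioc 0 T, ENNReal.ofReal (Real.exp (-ρ * s) * (K₁ * g s ^ γ))) +
      ∫⁻ z, ENNReal.ofReal (Real.exp (-ρ * T) * (K₁ * (1 / δ + 1 / γ) *
        (X - (∫ u in Set.Ioc 0 T, g u) + a * z) ^ γ)) ∂(p T)) ∂(expMeasure lam) ≤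
      ENNReal.ofReal (K₁ * (1 / δ + 1 / γ) * X ^ γ) := by
  set K := K₁ * (1 / δ + 1 / γ) with hKdef
  have hK : 0 ≤ K := by positivity
  have hlam := hH.lam_pos
  have hlo := hH.zlo_pos
  have hk := hH.k_nonneg
  set κ := k ^ γ / zlo ^ γ
  have hκ : 0 ≤ κ := by positivity
  have hae' := (ae_expMeasure_iff hlam).1 hae
  -- The constraints are known only for almost every waiting time. A good `r` beyond any given `T`
  -- transfers them to all times, since spending is monotone.
  have hex : ∀ T : ℝ, 0 ≤ T → ∃ r, T < r ∧ IntegrableOn g (Set.Ioc 0 r) ∧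
      ∫ u in Set.Ioc 0 r, g u ≤ X := fun T hT => by
    have h1 : ∀ᵐ r ∂(volume.restrict (Set.Ioi T)), T < r ∧ 0 < r ∧ IntegrableOn g (Set.Ioc 0 r) ∧
        ∀ᵐ z ∂(p r), 0 ≤ X - (∫ u in Set.Ioc 0 r, g u) + a * z := by
      filter_upwards [ae_restrict_of_ae_restrict_of_subset (Set.Ioi_subset_Ioi hT) hae',
        ae_restrict_mem measurableSet_Ioi] with r hr hrT
      exact ⟨hrT, hT.trans_lt hrT, hr⟩
    have : (ae (volume.restrict (Set.Ioi T))).NeBot := by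
      rw [ae_neBot, Ne, Measure.restrict_eq_zero]
      simp
    obtain ⟨r, h2, h3, h4, h5⟩ := h1.exists
    exact ⟨r, h2, h4, by linarith [(hH.mul_zlo_le_of_ae h3 h5).2]⟩
  have hgi : ∀ T, 0 ≤ T → IntegrableOn g (Set.Ioc 0 T) := fun T hT => by
    obtain ⟨r, h1, h2, -⟩ := hex T hT
    exact h2.mono_set (Set.Ioc_subset_Ioc_right h1.le)
  have hy : ∀ s, 0 ≤ s → ∫ u in Set.Ioc 0 s, g u ≤ X := fun T hT => by
    obtain ⟨r, h1, h2, h3⟩ := hex T hT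
    exact (setIntegral_mono_set h2 (Eventually.of_forall hg) (show Set.Ioc 0 T ⊆ Set.Ioc 0 r from
      Set.Ioc_subset_Ioc_right h1.le).eventuallyLE).trans h3
  have hφ : Measurable fun s => ENNReal.ofReal (Real.exp (-ρ * s) * (K₁ * g s ^ γ)) := by
    fun_prop
  have hmono : Monotone fun T : ℝ =>
      ∫⁻ s in Set.Ioc 0 T, ENNReal.ofReal (Real.exp (-ρ * s) * (K₁ * g s ^ γ)) :=
    fun s r hsr => lintegral_mono_set (Set.Ioc_subset_Ioc_right hsr)
  have hstep : ∀ᵐ T ∂(expMeasure lam), ∫⁻ z, ENNReal.ofReal (Real.exp (-ρ * T) * (K *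
        (X - (∫ u in Set.Ioc 0 T, g u) + a * z) ^ γ)) ∂(p T) ≤
      ENNReal.ofReal (Real.exp (-ρ * T) * (K * (κ * Real.exp (b * γ * T) *
        (X - ∫ u in Set.Ioc 0 T, g u) ^ γ))) := by
    filter_upwards [hae, (ae_expMeasure_iff hlam).2 (ae_restrict_mem measurableSet_Ioi)]
      with T hT hT0
    obtain ⟨h1, h2⟩ := hH.rpow_wealth hT0 hγ0 hγ1 hT.2
    rw [← ofReal_integral_eq_lintegral_ofReal ((h1.const_mul _).const_mul _)
      (hT.2.mono fun z hz => mul_nonneg (Real.exp_pos _).le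
        (mul_nonneg hK (Real.rpow_nonneg hz _))), integral_const_mul, integral_const_mul]
    refine ENNReal.ofReal_le_ofReal ?_
    gcongr
  calc _ ≤ ∫⁻ T, ((∫⁻ s in Set.Ioc 0 T, ENNReal.ofReal (Real.exp (-ρ * s) * (K₁ * g s ^ γ))) +
        ENNReal.ofReal (Real.exp (-ρ * T) * (K * (κ * Real.exp (b * γ * T) *
        (X - ∫ u in Set.Ioc 0 T, g u) ^ γ)))) ∂(expMeasure lam) :=
      lintegral_mono_ae (hstep.mono fun T hT => add_le_add_right hT _)
    _ = ∫⁻ s in Set.Ioi 0, (ENNReal.ofReal (Real.exp (-(lam * s))) *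
          ENNReal.ofReal (Real.exp (-ρ * s) * (K₁ * g s ^ γ)) +
        ENNReal.ofReal (lam * Real.exp (-(lam * s))) *
          ENNReal.ofReal (Real.exp (-ρ * s) * (K * (κ * Real.exp (b * γ * s) *
        (X - ∫ u in Set.Ioc 0 s, g u) ^ γ)))) := by
      rw [lintegral_add_left hmono.measurable, lintegral_expMeasure_setLIntegral hlam hφ,
        lintegral_expMeasure, ← lintegral_add_left (by fun_prop)]
    _ ≤ ∫⁻ s in Set.Ioi 0, ENNReal.ofReal (Real.exp (-(δ + lam * κ) * s) * (K₁ * g s ^ γ +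
          (lam * κ) * (K₁ * (1 / δ + 1 / γ)) * (X - ∫ u in Set.Ioc 0 s, g u) ^ γ)) := by
      refine setLIntegral_mono' measurableSet_Ioi fun s hs => ?_
      have hs0 : 0 < s := hs
      have h1 : 0 ≤ (X - ∫ u in Set.Ioc 0 s, g u) ^ γ :=
        Real.rpow_nonneg (by linarith [hy s hs0.le]) _
      have h2 : 0 ≤ g s ^ γ := Real.rpow_nonneg (hg s) _
      rw [← ENNReal.ofReal_mul (by positivity), ← ENNReal.ofReal_mul (by positivity),
        ← ENNReal.ofReal_add (by positivity) (by positivity)]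
      refine ENNReal.ofReal_le_ofReal ?_
      -- Since `lam + ρ = δ + b * γ + lam * κ`, the utility term is bounded by dropping `exp (-b * γ
      -- * s)`; in the wealth term this factor cancels the growth `exp (b * γ * s)`.
      have e1 : Real.exp (-(lam * s)) * Real.exp (-ρ * s) ≤ Real.exp (-(δ + lam * κ) * s) := by
        rw [← Real.exp_add, Real.exp_le_exp, hρ]
        have := mul_nonneg (mul_nonneg hH.b_nonneg hγ0.le) hs0.le
        nlinarith
      have e2 : Real.exp (-(lam * s)) * Real.exp (-ρ * s) * Real.exp (b * γ * s) =
          Real.exp (-(δ + lam * κ) * s) := by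
        rw [← Real.exp_add, ← Real.exp_add, hρ]
        ring_nf
      calc _ = (Real.exp (-(lam * s)) * Real.exp (-ρ * s)) * (K₁ * g s ^ γ) +
            (Real.exp (-(lam * s)) * Real.exp (-ρ * s) * Real.exp (b * γ * s)) *
              ((lam * κ) * K * (X - ∫ u in Set.Ioc 0 s, g u) ^ γ) := by ring
        _ ≤ _ := by
          rw [e2, mul_add]
          gcongr
    _ ≤ _ := lintegral_power_le hγ0 hγ1 hδ (by positivity) hK₁ hg hgi hy

end ReturnAssumption

/-! ### The joint law of the past, the waiting time and the return -/

theorem IlliquidMarket.measurable_of_predictable {Ω : Type*} [MeasurableSpace Ω]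
    (M : IlliquidMarket Ω) {c : ℝ≥0 → Ω → ℝ}
    (hc : Measurable[M.obs.predictable] fun q : ℝ≥0 × Ω => c q.1 q.2) :
    Measurable fun q : ℝ≥0 × Ω => c q.1 q.2 := by
  refine hc.mono (MeasurableSpace.generateFrom_le ?_) le_rfl
  rintro _ (⟨A, hA, rfl⟩ | ⟨i, A, hA, rfl⟩)
  · exact (measurableSet_singleton _).prod (M.obs.le _ _ hA)
  · exact measurableSet_Ioi.prod (M.obs.le _ _ hA)

theorem lintegral_exp_expMeasure_lt_one {lam : ℝ} (hlam : 0 < lam) :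
    ∫⁻ T, ENNReal.ofReal (Real.exp (-T)) ∂(expMeasure lam) < 1 := by
  have hi : IntegrableOn (fun T => lam * Real.exp (-(lam + 1) * T)) (Set.Ioi 0) :=
    (integrableOn_exp_mul_Ioi (by linarith) 0).const_mul lam
  have h1 : ∀ T : ℝ, ENNReal.ofReal (lam * Real.exp (-(lam * T))) * ENNReal.ofReal (Real.exp (-T)) =
      ENNReal.ofReal (lam * Real.exp (-(lam + 1) * T)) := fun T => by
    rw [← ENNReal.ofReal_mul (by positivity), mul_assoc, ← Real.exp_add]
    ring_nf
  rw [lintegral_expMeasure]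
  simp_rw [h1]
  rw [← ofReal_integral_eq_lintegral_ofReal hi (Eventually.of_forall fun T => by positivity),
    integral_const_mul, integral_exp_mul_Ioi (by linarith), ENNReal.ofReal_lt_one]
  simp only [mul_zero, Real.exp_zero, neg_div_neg_eq]
  rw [mul_one_div, div_lt_one (by linarith)]
  linarith

namespace ReturnAssumption

variable {Ω : Type*} [MeasurableSpace Ω] {P : Measure Ω} [IsProbabilityMeasure P]
  {M : IlliquidMarket Ω} {p : Kernel ℝ ℝ}
  {zlo : ℝ} {zhi : EReal} {lam k b : ℝ} (hH : ReturnAssumption M P lam p zlo zhi k b)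
include hH

theorem map_history_wait (n : ℕ) :
    P.map (fun ω => (M.history n ω, M.wait n ω)) = (P.map (M.history n)).prod (expMeasure lam) := by
  have := isProbabilityMeasure_expMeasure hH.lam_pos
  rw [(indepFun_iff_map_prod_eq_prod_map_map (M.measurable_history n).aemeasurable
    (M.measurable_wait n).aemeasurable).1 (hH.wait_indep n), (hH.wait_law n).map_eq]

variable [IsMarkovKernel p]

theorem lintegral_period (n : ℕ) {F : (Fin (n + 1) → ℝ≥0 × ℝ) → ℝ → ℝ → ℝ≥0∞}
    (hF : Measurable fun q : ((Fin (n + 1) → ℝ≥0 × ℝ) × ℝ) × ℝ => F q.1.1 q.1.2 q.2) :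
    ∫⁻ ω, F (M.history n ω) (M.wait n ω) (M.Z (n + 1) ω) ∂P =
      ∫⁻ h, ∫⁻ T, ∫⁻ z, F h T z ∂(p T) ∂(expMeasure lam) ∂(P.map (M.history n)) := by
  have := isProbabilityMeasure_expMeasure hH.lam_pos
  have h1 : Measurable fun ω => ((M.history n ω, M.wait n ω), M.Z (n + 1) ω) :=
    ((M.measurable_history n).prodMk (M.measurable_wait n)).prodMk (M.measurable_Z _)
  have h2 := lintegral_map (μ := P) hF h1
  rw [← h2, (hH.return_law n).map_eq, Measure.lintegral_compProd hF, hH.map_history_wait,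
    lintegral_prod _ (Measurable.aemeasurable ?_)]
  · simp
  · exact Measurable.lintegral_kernel_prod_right (κ := p.prodMkLeft (Fin (n + 1) → ℝ≥0 × ℝ)) hF

theorem ae_period (n : ℕ) {q : (Fin (n + 1) → ℝ≥0 × ℝ) → ℝ → ℝ → Prop}
    (hq : MeasurableSet {r : ((Fin (n + 1) → ℝ≥0 × ℝ) × ℝ) × ℝ | q r.1.1 r.1.2 r.2})
    (h : ∀ᵐ ω ∂P, q (M.history n ω) (M.wait n ω) (M.Z (n + 1) ω)) :
    ∀ᵐ h ∂(P.map (M.history n)), ∀ᵐ T ∂(expMeasure lam), ∀ᵐ z ∂(p T), q h T z := by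
  have := isProbabilityMeasure_expMeasure hH.lam_pos
  have h1 : Measurable fun ω => ((M.history n ω, M.wait n ω), M.Z (n + 1) ω) :=
    ((M.measurable_history n).prodMk (M.measurable_wait n)).prodMk (M.measurable_Z _)
  have h2 := (ae_map_iff (μ := P) h1.aemeasurable hq).2 h
  rw [(hH.return_law n).map_eq, hH.map_history_wait] at h2
  exact Measure.ae_ae_of_ae_prod (Measure.ae_ae_of_ae_compProd h2)

/-- The waiting times are independent with a common law, so these expectations are geometric; their
ratio is below `1`, which forces the trading dates to infinity. -/
theorem lintegral_exp_τ (n : ℕ) : ∫⁻ ω, ENNReal.ofReal (Real.exp (-(M.τ n ω : ℝ))) ∂P =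
    (∫⁻ T, ENNReal.ofReal (Real.exp (-T)) ∂(expMeasure lam)) ^ n := by
  induction n with
  | zero => simp [M.τ_zero]
  | succ n ih =>
    have hp : Measurable fun h : Fin (n + 1) → ℝ≥0 × ℝ => h (Fin.last n) := measurable_pi_apply _
    have h1 : ∀ ω, ENNReal.ofReal (Real.exp (-(M.τ (n + 1) ω : ℝ))) =
        ENNReal.ofReal (Real.exp (-((M.history n ω (Fin.last n)).1 : ℝ))) *
          ENNReal.ofReal (Real.exp (-M.wait n ω)) := fun ω => by
      rw [← ENNReal.ofReal_mul (by positivity), ← Real.exp_add]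
      congr 2
      simp [IlliquidMarket.history, IlliquidMarket.wait]
      ring
    have hm : Measurable fun T : ℝ => ENNReal.ofReal (Real.exp (-T)) := by fun_prop
    have hm' : Measurable fun h : Fin (n + 1) → ℝ≥0 × ℝ =>
        ENNReal.ofReal (Real.exp (-((h (Fin.last n)).1 : ℝ))) :=
      hm.comp (measurable_coe_nnreal_real.comp hp.fst)
    simp_rw [h1]
    rw [hH.lintegral_period n (F := fun h T _ => ENNReal.ofReal (Real.exp (-((h (Fin.last n)).1 : ℝ)))
      * ENNReal.ofReal (Real.exp (-T)))]
    · simp only [lintegral_const, measure_univ, mul_one]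
      simp_rw [lintegral_const_mul _ hm]
      rw [lintegral_mul_const _ hm', lintegral_map hm' (M.measurable_history n), pow_succ, ← ih]
      simp [IlliquidMarket.history]
    · exact (hm'.comp measurable_fst.fst).mul (hm.comp measurable_fst.snd)

/-- The trading dates are unbounded. -/
theorem ae_exists_lt_τ : ∀ᵐ ω ∂P, ∀ B : ℝ, ∃ n, B < M.τ n ω := by
  have h1 : ∫⁻ ω, (⨅ n, ENNReal.ofReal (Real.exp (-(M.τ n ω : ℝ)))) ∂P = 0 := by
    refine le_antisymm (ge_of_tendsto' (ENNReal.tendsto_pow_atTop_nhds_zero_of_lt_one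
      (lintegral_exp_expMeasure_lt_one hH.lam_pos)) fun n => ?_) zero_le
    rw [← hH.lintegral_exp_τ n]
    exact lintegral_mono fun ω => iInf_le _ n
  have hm : Measurable fun ω => ⨅ n, ENNReal.ofReal (Real.exp (-(M.τ n ω : ℝ))) :=
    Measurable.iInf fun n => (M.measurable_τ n).coe_nnreal_real.neg.exp.ennreal_ofReal
  rw [lintegral_eq_zero_iff hm] at h1
  filter_upwards [h1] with ω hω B
  by_contra! hB
  have h2 : ENNReal.ofReal (Real.exp (-B)) ≤ ⨅ n, ENNReal.ofReal (Real.exp (-(M.τ n ω : ℝ))) :=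
    le_iInf fun n => ENNReal.ofReal_le_ofReal (Real.exp_le_exp.2 (by linarith [hB n]))
  rw [hω] at h2
  simp only [Pi.zero_apply, nonpos_iff_eq_zero, ENNReal.ofReal_eq_zero] at h2
  exact absurd (Real.exp_pos (-B)) (not_lt.2 h2)

theorem ae_iUnion_Ioc_τ : ∀ᵐ ω ∂P, ⋃ n, Set.Ioc (0 : ℝ) (M.τ n ω) = Set.Ioi 0 := by
  filter_upwards [hH.ae_exists_lt_τ] with ω hω
  ext t
  simp only [Set.mem_iUnion, Set.mem_Ioc, Set.mem_Ioi]
  exact ⟨fun ⟨n, hn⟩ => hn.1, fun ht => (hω t).imp fun n hn => ⟨ht, hn.le⟩⟩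

end ReturnAssumption

/-! ### The value function is bounded by a power -/

theorem measurable_setIntegral_Ioc {H : Type*} [MeasurableSpace H] {g : H → ℝ → ℝ}
    (hg : Measurable fun q : H × ℝ => g q.1 q.2) :
    Measurable fun q : H × ℝ => ∫ u in Set.Ioc 0 q.2, g q.1 u := by
  have hS : MeasurableSet {r : (H × ℝ) × ℝ | r.2 ∈ Set.Ioc 0 r.1.2} :=
    (measurableSet_lt measurable_const measurable_snd).inter
      (measurableSet_le measurable_snd measurable_fst.snd)
  have h1 : Measurable ({r : (H × ℝ) × ℝ | r.2 ∈ Set.Ioc 0 r.1.2}.indicator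
      fun r => g r.1.1 r.2) :=
    (hg.comp (measurable_fst.fst.prodMk measurable_snd)).indicator hS
  have h2 := (h1.stronglyMeasurable.integral_prod_right' (ν := volume)).measurable
  have h3 : (fun q : H × ℝ => ∫ u in Set.Ioc 0 q.2, g q.1 u) = fun q => ∫ u,
      {r : (H × ℝ) × ℝ | r.2 ∈ Set.Ioc 0 r.1.2}.indicator (fun r => g r.1.1 r.2) (q, u) := by
    ext q
    rw [← integral_indicator measurableSet_Ioc]
    rfl
  rwa [h3]

theorem measurable_setLIntegral_Ioc {H : Type*} [MeasurableSpace H] {g : H → ℝ → ℝ≥0∞}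
    (hg : Measurable fun q : H × ℝ => g q.1 q.2) :
    Measurable fun q : H × ℝ => ∫⁻ u in Set.Ioc 0 q.2, g q.1 u := by
  have hS : MeasurableSet {r : (H × ℝ) × ℝ | r.2 ∈ Set.Ioc 0 r.1.2} :=
    (measurableSet_lt measurable_const measurable_snd).inter
      (measurableSet_le measurable_snd measurable_fst.snd)
  have h1 : Measurable ({r : (H × ℝ) × ℝ | r.2 ∈ Set.Ioc 0 r.1.2}.indicator
      fun r => g r.1.1 r.2) :=
    (hg.comp (measurable_fst.fst.prodMk measurable_snd)).indicator hS
  have h3 : (fun q : H × ℝ => ∫⁻ u in Set.Ioc 0 q.2, g q.1 u) = fun q => ∫⁻ u,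
      {r : (H × ℝ) × ℝ | r.2 ∈ Set.Ioc 0 r.1.2}.indicator (fun r => g r.1.1 r.2) (q, u) := by
    ext q
    rw [← lintegral_indicator measurableSet_Ioc]
    rfl
  rw [h3]
  exact h1.lintegral_prod_right'

theorem measurableSet_integrableOn_Ioc {H : Type*} [MeasurableSpace H] {g : H → ℝ → ℝ}
    (hg : Measurable fun q : H × ℝ => g q.1 q.2) :
    MeasurableSet {q : H × ℝ | IntegrableOn (g q.1) (Set.Ioc 0 q.2)} := by
  have hS : MeasurableSet {r : (H × ℝ) × ℝ | r.2 ∈ Set.Ioc 0 r.1.2} :=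
    (measurableSet_lt measurable_const measurable_snd).inter
      (measurableSet_le measurable_snd measurable_fst.snd)
  have h1 : Measurable ({r : (H × ℝ) × ℝ | r.2 ∈ Set.Ioc 0 r.1.2}.indicator
      fun r => g r.1.1 r.2) :=
    (hg.comp (measurable_fst.fst.prodMk measurable_snd)).indicator hS
  have h2 := _root_.measurableSet_integrable (μ := volume)
    (f := fun (q : H × ℝ) u => (Set.Ioc 0 q.2).indicator (g q.1) u) h1.stronglyMeasurable
  simpa only [integrable_indicator_iff measurableSet_Ioc] using h2

theorem setLIntegral_Ioc_add (φ : ℝ → ℝ≥0∞) (a b : ℝ) :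
    ∫⁻ t in Set.Ioc a b, φ t = ∫⁻ s in Set.Ioc 0 (b - a), φ (a + s) := by
  rw [← (measurePreserving_add_left volume a).setLIntegral_comp_preimage_emb
    (measurableEmbedding_addLeft a) φ (Set.Ioc a b)]
  simp

/-! ### Consumption and wealth as functions of the past observations -/

namespace IlliquidMarket

variable {Ω : Type*} [MeasurableSpace Ω] (M : IlliquidMarket Ω)

theorem exists_period_rate (n : ℕ) {c : ℝ≥0 → Ω → ℝ}
    (hc : Measurable[M.obs.predictable] fun q : ℝ≥0 × Ω => c q.1 q.2) (h0 : ∀ t ω, 0 ≤ c t ω) :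
    ∃ g : (Fin (n + 1) → ℝ≥0 × ℝ) → ℝ → ℝ,
      Measurable (fun q : (Fin (n + 1) → ℝ≥0 × ℝ) × ℝ => g q.1 q.2) ∧ (∀ h s, 0 ≤ g h s) ∧
      ∀ ω, ∀ s ∈ Set.Ioc 0 (M.wait n ω),
        c ((M.τ n ω : ℝ) + s).toNNReal ω = g (M.history n ω) s := by
  obtain ⟨f, hf, hfc⟩ := M.exists_predictable_eq n hc
  have hp : Measurable fun h : Fin (n + 1) → ℝ≥0 × ℝ => h (Fin.last n) := measurable_pi_apply _
  -- `f` is only known to agree with `c` up to the next trading date; the truncation makes the rate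
  -- nonnegative everywhere.
  refine ⟨fun h s => max (f ((h (Fin.last n)).1 + s.toNNReal, h)) 0, ?_, fun h s => le_max_right _ _,
    fun ω s hs => ?_⟩
  · refine (hf.comp (Measurable.prodMk ?_ measurable_fst)).max measurable_const
    exact (hp.comp measurable_fst).fst.add measurable_snd.real_toNNReal
  · have h1 : ((M.τ n ω : ℝ) + s).toNNReal = M.τ n ω + s.toNNReal := by
      rw [Real.toNNReal_add (NNReal.coe_nonneg _) hs.1.le, Real.toNNReal_coe]
    have h2 : M.τ n ω + s.toNNReal ≤ M.τ (n + 1) ω := by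
      rw [← NNReal.coe_le_coe, NNReal.coe_add, Real.coe_toNNReal _ hs.1.le]
      have := hs.2
      simp only [wait] at this
      linarith
    have h3 := hfc (M.τ n ω + s.toNNReal) ω (lt_add_of_pos_right _ (Real.toNNReal_pos.2 hs.1)) h2
    have h4 : 0 ≤ f (M.τ n ω + s.toNNReal, M.history n ω) := h3 ▸ h0 _ _
    rw [h1, h3]
    exact (max_eq_left h4).symm

variable {M} {P : Measure Ω} {x : ℝ} {α : ℕ → Ω → ℝ} {c : ℝ≥0 → Ω → ℝ}

theorem wealth_zero (ω : Ω) : M.wealth x α c 0 ω = x := by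
  simp [wealth, M.τ_zero]

theorem wealth_succ {n : ℕ} {ω : Ω}
    (hi : IntegrableOn (fun t : ℝ => c t.toNNReal ω) (Set.Ioc 0 (M.τ (n + 1) ω : ℝ))) :
    M.wealth x α c (n + 1) ω = M.wealth x α c n ω -
      (∫ s in Set.Ioc 0 (M.wait n ω), c ((M.τ n ω : ℝ) + s).toNNReal ω) +
      α (n + 1) ω * M.Z (n + 1) ω := by
  have hle : (M.τ n ω : ℝ) ≤ M.τ (n + 1) ω :=
    NNReal.coe_le_coe.2 ((M.τ_strictMono ω).monotone n.le_succ)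
  have h1 : ∫ t in Set.Ioc 0 (M.τ (n + 1) ω : ℝ), c t.toNNReal ω =
      (∫ t in Set.Ioc 0 (M.τ n ω : ℝ), c t.toNNReal ω) +
        ∫ s in Set.Ioc 0 (M.wait n ω), c ((M.τ n ω : ℝ) + s).toNNReal ω := by
    have h2 := (measurePreserving_add_left volume (M.τ n ω : ℝ)).setIntegral_preimage_emb
      (measurableEmbedding_addLeft (M.τ n ω : ℝ)) (fun t : ℝ => c t.toNNReal ω)
      (Set.Ioc (M.τ n ω : ℝ) (M.τ (n + 1) ω))
    rw [Set.preimage_const_add_Ioc, sub_self] at h2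
    rw [wait, h2, ← Set.Ioc_union_Ioc_eq_Ioc (NNReal.coe_nonneg (M.τ n ω)) hle, setIntegral_union
      (Set.Ioc_disjoint_Ioc_of_le le_rfl) measurableSet_Ioc
      (hi.mono_set (Set.Ioc_subset_Ioc_right hle))
      (hi.mono_set (Set.Ioc_subset_Ioc_left (NNReal.coe_nonneg (M.τ n ω))))]
  rw [wealth, wealth, h1, Finset.sum_Icc_succ_top (by omega)]
  ring

namespace Admissible

theorem wealth_succ_eq (hA : M.Admissible P x α c) {n : ℕ}
    {g : (Fin (n + 1) → ℝ≥0 × ℝ) → ℝ → ℝ} (hgc : ∀ ω, ∀ s ∈ Set.Ioc 0 (M.wait n ω),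
        c ((M.τ n ω : ℝ) + s).toNNReal ω = g (M.history n ω) s) :
    ∀ᵐ ω ∂P, IntegrableOn (g (M.history n ω)) (Set.Ioc 0 (M.wait n ω)) ∧
      M.wealth x α c (n + 1) ω = M.wealth x α c n ω -
      (∫ s in Set.Ioc 0 (M.wait n ω), g (M.history n ω) s) + α (n + 1) ω * M.Z (n + 1) ω := by
  filter_upwards [hA.integrable_c (n + 1) (by omega)] with ω hi
  have hle : (M.τ n ω : ℝ) ≤ M.τ (n + 1) ω :=
    NNReal.coe_le_coe.2 ((M.τ_strictMono ω).monotone n.le_succ)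
  constructor
  · have h1 := (measurePreserving_add_left volume (M.τ n ω : ℝ)).integrableOn_comp_preimage
      (measurableEmbedding_addLeft (M.τ n ω : ℝ)) (f := fun t : ℝ => c t.toNNReal ω)
      (s := Set.Ioc (M.τ n ω : ℝ) (M.τ (n + 1) ω))
    rw [Set.preimage_const_add_Ioc, sub_self] at h1
    exact (h1.2 (hi.mono_set (Set.Ioc_subset_Ioc_left (NNReal.coe_nonneg (M.τ n ω))))).congr_fun
      (fun s hs => hgc ω s hs) measurableSet_Ioc
  · rw [wealth_succ hi, setIntegral_congr_fun measurableSet_Ioc fun s hs => hgc ω s hs]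

/-- The wealth at a trading date is a function of the past observations. -/
theorem exists_wealth_ae_eq (hA : M.Admissible P x α c) (n : ℕ) :
    ∃ ξ : (Fin (n + 1) → ℝ≥0 × ℝ) → ℝ, Measurable ξ ∧
      ∀ᵐ ω ∂P, M.wealth x α c n ω = ξ (M.history n ω) := by
  induction n with
  | zero => exact ⟨fun _ => x, measurable_const, Eventually.of_forall wealth_zero⟩
  | succ n ih =>
    obtain ⟨ξ, hξ, hξw⟩ := ih
    obtain ⟨g, hg, -, hgc⟩ := M.exists_period_rate n hA.predictable_c hA.nonneg_c
    obtain ⟨φ, hφ, hφα⟩ := M.exists_obsAt_eq n (hA.measurable_α n)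
    have hinit : Measurable fun (h : Fin (n + 1 + 1) → ℝ≥0 × ℝ) (i : Fin (n + 1)) =>
        h i.castSucc := measurable_pi_lambda _ fun i => measurable_pi_apply _
    have hp : ∀ i, Measurable fun h : Fin (n + 1 + 1) → ℝ≥0 × ℝ => h i :=
      fun i => measurable_pi_apply i
    refine ⟨fun h => ξ (fun i => h i.castSucc) - (∫ s in Set.Ioc 0
      (((h (Fin.last (n + 1))).1 : ℝ) - (h (Fin.last n).castSucc).1), g (fun i => h i.castSucc) s) +
      φ (fun i => h i.castSucc) * (h (Fin.last (n + 1))).2, ?_, ?_⟩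
    · exact ((hξ.comp hinit).sub ((measurable_setIntegral_Ioc hg).comp (hinit.prodMk
        ((hp _).fst.coe_nnreal_real.sub (hp _).fst.coe_nnreal_real)))).add
        ((hφ.comp hinit).mul (hp _).snd)
    · filter_upwards [hξw, hA.wealth_succ_eq hgc] with ω h1 h2
      rw [h2.2, h1, hφα]
      rfl

end Admissible

end IlliquidMarket

/-! ### Iteration over the trading dates -/

namespace ReturnAssumption

variable {Ω : Type*} [MeasurableSpace Ω] {P : Measure Ω} [IsProbabilityMeasure P]
  {M : IlliquidMarket Ω} {p : Kernel ℝ ℝ} [IsMarkovKernel p]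
  {zlo : ℝ} {zhi : EReal} {lam k b : ℝ} (hH : ReturnAssumption M P lam p zlo zhi k b)
  {δ γ ρ K₁ x : ℝ} {α : ℕ → Ω → ℝ} {c : ℝ≥0 → Ω → ℝ}
include hH

/-- This is `one_period` conditionally on the history and discounted at `τ n`. In expectation, the
discounted power of wealth plus accumulated power utility does not increase from one trading date to
the next. -/
theorem lintegral_period_le (hA : M.Admissible P x α c) (hγ0 : 0 < γ) (hγ1 : γ < 1)
    (hδ : 0 < δ) (hρ : ρ = δ + b * γ + lam * (k ^ γ / zlo ^ γ - 1)) (hK₁ : 0 ≤ K₁) (n : ℕ) :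
    ∫⁻ ω, ((∫⁻ t in Set.Ioc (M.τ n ω : ℝ) (M.τ (n + 1) ω),
        ENNReal.ofReal (Real.exp (-ρ * t) * (K₁ * c t.toNNReal ω ^ γ))) +
      ENNReal.ofReal (Real.exp (-ρ * M.τ (n + 1) ω) * (K₁ * (1 / δ + 1 / γ) *
        M.wealth x α c (n + 1) ω ^ γ))) ∂P ≤
    ∫⁻ ω, ENNReal.ofReal (Real.exp (-ρ * M.τ n ω) * (K₁ * (1 / δ + 1 / γ) *
        M.wealth x α c n ω ^ γ)) ∂P := by
  set K := K₁ * (1 / δ + 1 / γ) with hKdef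
  have hK : 0 ≤ K := by positivity
  obtain ⟨g, hg, hg0, hgc⟩ := M.exists_period_rate n hA.predictable_c hA.nonneg_c
  obtain ⟨φ, hφ, hφα⟩ := M.exists_obsAt_eq n (hA.measurable_α n)
  obtain ⟨ξ, hξ, hξw⟩ := hA.exists_wealth_ae_eq n
  have hp : Measurable fun h : Fin (n + 1) → ℝ≥0 × ℝ => ((h (Fin.last n)).1 : ℝ) :=
    measurable_coe_nnreal_real.comp (measurable_pi_apply (Fin.last n)).fst
  have hws := hA.wealth_succ_eq hgc
  have hC := measurable_setIntegral_Ioc hg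
  have hY : Measurable fun q : ((Fin (n + 1) → ℝ≥0 × ℝ) × ℝ) × ℝ =>
      ξ q.1.1 - (∫ s in Set.Ioc 0 q.1.2, g q.1.1 s) + φ q.1.1 * q.2 :=
    ((hξ.comp measurable_fst.fst).sub (hC.comp measurable_fst)).add
      ((hφ.comp measurable_fst.fst).mul measurable_snd)
  have hφg : Measurable fun q : (Fin (n + 1) → ℝ≥0 × ℝ) × ℝ =>
      ENNReal.ofReal (Real.exp (-ρ * q.2) * (K₁ * g q.1 q.2 ^ γ)) := by
    fun_prop
  let A : (Fin (n + 1) → ℝ≥0 × ℝ) → ℝ → ℝ≥0∞ := fun h T =>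
    ∫⁻ s in Set.Ioc 0 T, ENNReal.ofReal (Real.exp (-ρ * s) * (K₁ * g h s ^ γ))
  let B : (Fin (n + 1) → ℝ≥0 × ℝ) → ℝ → ℝ → ℝ≥0∞ := fun h T z =>
    ENNReal.ofReal (Real.exp (-ρ * T) * (K * (ξ h - (∫ s in Set.Ioc 0 T, g h s) + φ h * z) ^ γ))
  let D : (Fin (n + 1) → ℝ≥0 × ℝ) → ℝ≥0∞ := fun h =>
    ENNReal.ofReal (Real.exp (-ρ * (h (Fin.last n)).1))
  have hAm : Measurable fun q : (Fin (n + 1) → ℝ≥0 × ℝ) × ℝ => A q.1 q.2 :=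
    measurable_setLIntegral_Ioc (g := fun h s =>
      ENNReal.ofReal (Real.exp (-ρ * s) * (K₁ * g h s ^ γ))) hφg
  have hBm : Measurable fun q : ((Fin (n + 1) → ℝ≥0 × ℝ) × ℝ) × ℝ => B q.1.1 q.1.2 q.2 := by
    refine Measurable.ennreal_ofReal ((Measurable.exp ?_).mul ((hY.pow_const γ).const_mul K))
    exact measurable_fst.snd.const_mul (-ρ)
  have hDm : Measurable D := (hp.const_mul (-ρ)).exp.ennreal_ofReal
  have hae : ∀ᵐ h ∂(P.map (M.history n)), ∀ᵐ T ∂(expMeasure lam),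
      IntegrableOn (g h) (Set.Ioc 0 T) ∧
        ∀ᵐ z ∂(p T), 0 ≤ ξ h - (∫ s in Set.Ioc 0 T, g h s) + φ h * z := by
    have h1 := hH.ae_period n (q := fun h T z => IntegrableOn (g h) (Set.Ioc 0 T) volume ∧
        0 ≤ ξ h - (∫ s in Set.Ioc 0 T, g h s) + φ h * z)
      ((measurable_fst (measurableSet_integrableOn_Ioc hg)).inter
        (measurableSet_le measurable_const hY)) (by
          filter_upwards [hws, hA.wealth_nonneg (n + 1) (by omega), hξw] with ω h1 h2 h3
          refine ⟨h1.1, ?_⟩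
          rwa [h1.2, h3, hφα] at h2)
    filter_upwards [h1] with h h2
    filter_upwards [h2] with T h3
    -- Integrability does not involve the return, so one good `z` suffices.
    exact ⟨h3.exists.choose_spec.1, h3.mono fun z hz => hz.2⟩
  calc
    _ = ∫⁻ ω, D (M.history n ω) * (A (M.history n ω) (M.wait n ω) +
        B (M.history n ω) (M.wait n ω) (M.Z (n + 1) ω)) ∂P := by
      refine lintegral_congr_ae ?_
      filter_upwards [hws, hξw] with ω h1 h2
      have hD : D (M.history n ω) = ENNReal.ofReal (Real.exp (-ρ * M.τ n ω)) := rfl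
      have e1 : ∫⁻ t in Set.Ioc (M.τ n ω : ℝ) (M.τ (n + 1) ω),
          ENNReal.ofReal (Real.exp (-ρ * t) * (K₁ * c t.toNNReal ω ^ γ)) =
          D (M.history n ω) * A (M.history n ω) (M.wait n ω) := by
        rw [hD, setLIntegral_Ioc_add, ← lintegral_const_mul' _ _ ENNReal.ofReal_ne_top]
        refine setLIntegral_congr_fun measurableSet_Ioc fun s hs => ?_
        have e3 : Real.exp (-ρ * (M.τ n ω + s)) =
            Real.exp (-ρ * M.τ n ω) * Real.exp (-ρ * s) := by
          rw [← Real.exp_add]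
          ring_nf
        rw [hgc ω s hs, ← ENNReal.ofReal_mul (by positivity), e3, mul_assoc]
      have e2 : ENNReal.ofReal (Real.exp (-ρ * M.τ (n + 1) ω) *
          (K * M.wealth x α c (n + 1) ω ^ γ)) =
          D (M.history n ω) * B (M.history n ω) (M.wait n ω) (M.Z (n + 1) ω) := by
        have e3 : Real.exp (-ρ * M.τ (n + 1) ω) =
            Real.exp (-ρ * M.τ n ω) * Real.exp (-ρ * M.wait n ω) := by
          rw [← Real.exp_add, IlliquidMarket.wait]
          ring_nf
        simp only [hD, B]
        rw [← ENNReal.ofReal_mul (by positivity), e3, h1.2, h2, hφα, mul_assoc]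
      rw [e1, e2, mul_add]
    _ = ∫⁻ h, D h * ∫⁻ T, (A h T + ∫⁻ z, B h T z ∂(p T)) ∂(expMeasure lam)
          ∂(P.map (M.history n)) := by
      rw [hH.lintegral_period n (F := fun h T z => D h * (A h T + B h T z))
        ((hDm.comp measurable_fst.fst).mul ((hAm.comp measurable_fst).add hBm))]
      refine lintegral_congr fun h => ?_
      rw [← lintegral_const_mul' _ _ ENNReal.ofReal_ne_top]
      refine lintegral_congr fun T => ?_
      rw [lintegral_const_mul' _ _ ENNReal.ofReal_ne_top, lintegral_add_left measurable_const]
      simp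
    _ ≤ ∫⁻ h, D h * ENNReal.ofReal (K * ξ h ^ γ) ∂(P.map (M.history n)) := by
      refine lintegral_mono_ae ?_
      filter_upwards [hae] with h hh
      gcongr
      exact hH.one_period hγ0 hγ1 hδ hρ hK₁ (hg.comp measurable_prodMk_left) (hg0 h) hh
    _ = ∫⁻ ω, D (M.history n ω) * ENNReal.ofReal (K * ξ (M.history n ω) ^ γ) ∂P :=
      lintegral_map (hDm.mul ((hξ.pow_const γ).const_mul K).ennreal_ofReal) (M.measurable_history n)
    _ = _ := by
      refine lintegral_congr_ae ?_
      filter_upwards [hξw] with ω h1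
      rw [h1, ENNReal.ofReal_mul (Real.exp_pos _).le]
      rfl

theorem lintegral_Ioc_τ_le (hA : M.Admissible P x α c) (hγ0 : 0 < γ) (hγ1 : γ < 1)
    (hδ : 0 < δ) (hρ : ρ = δ + b * γ + lam * (k ^ γ / zlo ^ γ - 1)) (hK₁ : 0 ≤ K₁) (n : ℕ) :
    ∫⁻ ω, (∫⁻ t in Set.Ioc (0 : ℝ) (M.τ n ω),
        ENNReal.ofReal (Real.exp (-ρ * t) * (K₁ * c t.toNNReal ω ^ γ))) ∂P +
      ∫⁻ ω, ENNReal.ofReal (Real.exp (-ρ * M.τ n ω) * (K₁ * (1 / δ + 1 / γ) *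
        M.wealth x α c n ω ^ γ)) ∂P ≤ ENNReal.ofReal (K₁ * (1 / δ + 1 / γ) * x ^ γ) := by
  have hc : Measurable fun q : Ω × ℝ => c q.2.toNNReal q.1 :=
    (M.measurable_of_predictable hA.predictable_c).comp
      (measurable_snd.real_toNNReal.prodMk measurable_fst)
  have hφ : Measurable fun q : Ω × ℝ =>
      ENNReal.ofReal (Real.exp (-ρ * q.2) * (K₁ * c q.2.toNNReal q.1 ^ γ)) :=
    ((measurable_snd.const_mul (-ρ)).exp.mul ((hc.pow_const γ).const_mul K₁)).ennreal_ofReal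
  have hJ : ∀ n, Measurable fun ω => ∫⁻ t in Set.Ioc (0 : ℝ) (M.τ n ω),
        ENNReal.ofReal (Real.exp (-ρ * t) * (K₁ * c t.toNNReal ω ^ γ)) := fun n =>
    (measurable_setLIntegral_Ioc (g := fun ω t =>
      ENNReal.ofReal (Real.exp (-ρ * t) * (K₁ * c t.toNNReal ω ^ γ))) hφ).comp
      (measurable_id.prodMk (M.measurable_τ n).coe_nnreal_real)
  induction n with
  | zero => simp [M.τ_zero, IlliquidMarket.wealth_zero]
  | succ n ih =>
    refine le_trans ?_ ih
    rw [← lintegral_add_left (hJ (n + 1)), ← lintegral_add_left (hJ n)]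
    have h1 : ∀ ω, ∫⁻ t in Set.Ioc (0 : ℝ) (M.τ (n + 1) ω),
        ENNReal.ofReal (Real.exp (-ρ * t) * (K₁ * c t.toNNReal ω ^ γ)) =
        (∫⁻ t in Set.Ioc (0 : ℝ) (M.τ n ω),
          ENNReal.ofReal (Real.exp (-ρ * t) * (K₁ * c t.toNNReal ω ^ γ))) +
        ∫⁻ t in Set.Ioc (M.τ n ω : ℝ) (M.τ (n + 1) ω),
          ENNReal.ofReal (Real.exp (-ρ * t) * (K₁ * c t.toNNReal ω ^ γ)) := fun ω => by
      rw [← lintegral_union measurableSet_Ioc (Set.Ioc_disjoint_Ioc_of_le le_rfl),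
        Set.Ioc_union_Ioc_eq_Ioc (NNReal.coe_nonneg _)
          (NNReal.coe_le_coe.2 ((M.τ_strictMono ω).monotone n.le_succ))]
    simp_rw [h1, add_assoc]
    rw [lintegral_add_left (hJ n), lintegral_add_left (hJ n)]
    exact add_le_add le_rfl (hH.lintegral_period_le hA hγ0 hγ1 hδ hρ hK₁ n)

/-- The value function is bounded by a power of the initial capital. -/
theorem value_le {U : ℝ → ℝ} (hγ0 : 0 < γ) (hγ1 : γ < 1)
    (hδ : 0 < δ) (hρ : ρ = δ + b * γ + lam * (k ^ γ / zlo ^ γ - 1)) (hK₁ : 0 ≤ K₁)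
    (hU : ∀ x, 0 ≤ x → U x ≤ K₁ * x ^ γ) (x : ℝ) :
    M.value P ρ U x ≤ ENNReal.ofReal (K₁ * (1 / δ + 1 / γ) * x ^ γ) := by
  refine iSup_le fun α => iSup_le fun c => iSup_le fun hA => ?_
  have hc : Measurable fun q : Ω × ℝ => c q.2.toNNReal q.1 :=
    (M.measurable_of_predictable hA.predictable_c).comp
      (measurable_snd.real_toNNReal.prodMk measurable_fst)
  have hφ : Measurable fun q : Ω × ℝ =>
      ENNReal.ofReal (Real.exp (-ρ * q.2) * (K₁ * c q.2.toNNReal q.1 ^ γ)) :=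
    ((measurable_snd.const_mul (-ρ)).exp.mul ((hc.pow_const γ).const_mul K₁)).ennreal_ofReal
  have hJ : ∀ n, Measurable fun ω => ∫⁻ t in Set.Ioc (0 : ℝ) (M.τ n ω),
        ENNReal.ofReal (Real.exp (-ρ * t) * (K₁ * c t.toNNReal ω ^ γ)) := fun n =>
    (measurable_setLIntegral_Ioc (g := fun ω t =>
      ENNReal.ofReal (Real.exp (-ρ * t) * (K₁ * c t.toNNReal ω ^ γ))) hφ).comp
      (measurable_id.prodMk (M.measurable_τ n).coe_nnreal_real)
  calc
    _ ≤ ∫⁻ ω, (⨆ n, ∫⁻ t in Set.Ioc (0 : ℝ) (M.τ n ω),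
        ENNReal.ofReal (Real.exp (-ρ * t) * (K₁ * c t.toNNReal ω ^ γ))) ∂P := by
      refine lintegral_mono_ae ?_
      filter_upwards [hH.ae_iUnion_Ioc_τ] with ω hω
      rw [← hω, setLIntegral_iUnion_of_directed]
      · refine iSup_mono fun n => lintegral_mono fun t => ENNReal.ofReal_le_ofReal ?_
        exact mul_le_mul_of_nonneg_left (hU _ (hA.nonneg_c _ _)) (Real.exp_pos _).le
      · exact Monotone.directed_le fun m n hmn => Set.Ioc_subset_Ioc_right
          (NNReal.coe_le_coe.2 ((M.τ_strictMono ω).monotone hmn))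
    _ = ⨆ n, ∫⁻ ω, (∫⁻ t in Set.Ioc (0 : ℝ) (M.τ n ω),
        ENNReal.ofReal (Real.exp (-ρ * t) * (K₁ * c t.toNNReal ω ^ γ))) ∂P :=
      lintegral_iSup hJ fun m n hmn ω => lintegral_mono_set (Set.Ioc_subset_Ioc_right
        (NNReal.coe_le_coe.2 ((M.τ_strictMono ω).monotone hmn)))
    _ ≤ _ := iSup_le fun n =>
      le_self_add.trans (hH.lintegral_Ioc_τ_le hA hγ0 hγ1 hδ hρ hK₁ n)

end ReturnAssumption

/-! ### Regularity of the value function -/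

/-- Concavity towards `0` gives `f u ≥ u / (u + v) * f (u + v)`; the cases `u = x` and `u = y` are
added. -/
theorem ConcaveOn.map_add_le {f : ℝ → ℝ} (hf : ConcaveOn ℝ (Set.Ici 0) f) (h0 : 0 ≤ f 0)
    {x y : ℝ} (hx : 0 ≤ x) (hy : 0 ≤ y) : f (x + y) ≤ f x + f y := by
  rcases hx.eq_or_lt with rfl | hx
  · simpa using h0
  have key : ∀ u v : ℝ, 0 < u → 0 ≤ v → u / (u + v) * f (u + v) ≤ f u := fun u v hu hv => by
    have h1 := hf.2 (Set.mem_Ici.2 (by linarith : 0 ≤ u + v)) Set.self_mem_Ici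
      (show 0 ≤ u / (u + v) by positivity) (show 0 ≤ v / (u + v) by positivity)
      (by field_simp)
    simp only [smul_eq_mul, mul_zero, add_zero] at h1
    rw [div_mul_cancel₀ _ (by linarith)] at h1
    have := mul_nonneg (show 0 ≤ v / (u + v) by positivity) h0
    linarith
  rcases hy.eq_or_lt with rfl | hy
  · simpa using h0
  have h1 := key x y hx hy.le
  have h2 := key y x hy hx.le
  rw [add_comm y x] at h2
  have h3 : x / (x + y) * f (x + y) + y / (x + y) * f (x + y) = f (x + y) := by
    field_simp
  linarith

namespace IlliquidMarket

variable {Ω : Type*} [MeasurableSpace Ω] {M : IlliquidMarket Ω} {P : Measure Ω} {ρ x y : ℝ}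
  {U : ℝ → ℝ} {α α' : ℕ → Ω → ℝ} {c c' : ℝ≥0 → Ω → ℝ}

theorem Admissible.mono (hA : M.Admissible P x α c) (hxy : x ≤ y) : M.Admissible P y α c where
  measurable_α := hA.measurable_α
  predictable_c := hA.predictable_c
  nonneg_c := hA.nonneg_c
  integrable_c := hA.integrable_c
  wealth_nonneg k hk := (hA.wealth_nonneg k hk).mono fun ω hω => by
    simp only [wealth] at hω ⊢
    linarith

theorem Admissible.zero (hx : 0 ≤ x) : M.Admissible P x (fun _ _ => 0) fun _ _ => 0 where
  measurable_α _ := measurable_const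
  predictable_c := measurable_const
  nonneg_c _ _ := le_rfl
  integrable_c _ _ := Eventually.of_forall fun _ => integrableOn_zero
  wealth_nonneg _ _ := Eventually.of_forall fun _ => by simpa [wealth] using hx

theorem Admissible.mix (hA : M.Admissible P x α c) (hA' : M.Admissible P y α' c') {θ θ' : ℝ}
    (hθ : 0 ≤ θ) (hθ' : 0 ≤ θ') :
    M.Admissible P (θ * x + θ' * y) (fun k ω => θ * α k ω + θ' * α' k ω)
      (fun t ω => θ * c t ω + θ' * c' t ω) where
  measurable_α k := ((hA.measurable_α k).const_mul θ).add ((hA'.measurable_α k).const_mul θ')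
  predictable_c := (hA.predictable_c.const_mul θ).add (hA'.predictable_c.const_mul θ')
  nonneg_c t ω := add_nonneg (mul_nonneg hθ (hA.nonneg_c t ω)) (mul_nonneg hθ' (hA'.nonneg_c t ω))
  integrable_c k hk := by
    filter_upwards [hA.integrable_c k hk, hA'.integrable_c k hk] with ω h1 h2
    exact (h1.const_mul θ).add (h2.const_mul θ')
  wealth_nonneg k hk := by
    filter_upwards [hA.integrable_c k hk, hA'.integrable_c k hk, hA.wealth_nonneg k hk,
      hA'.wealth_nonneg k hk] with ω h1 h2 h3 h4
    have h5 := add_nonneg (mul_nonneg hθ h3) (mul_nonneg hθ' h4)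
    refine h5.trans_eq ?_
    simp only [wealth]
    rw [integral_add (h1.const_mul θ) (h2.const_mul θ'), integral_const_mul, integral_const_mul]
    simp only [add_mul, Finset.sum_add_distrib, mul_assoc, ← Finset.mul_sum]
    ring

theorem value_eq_iSup : M.value P ρ U x =
    ⨆ π : {π : (ℕ → Ω → ℝ) × (ℝ≥0 → Ω → ℝ) // M.Admissible P x π.1 π.2},
      ∫⁻ ω, (∫⁻ t in Set.Ioi (0 : ℝ),
        ENNReal.ofReal (Real.exp (-ρ * t) * U (π.1.2 t.toNNReal ω))) ∂P := by
  rw [value, iSup_subtype, iSup_prod]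

theorem value_mono : Monotone (M.value P ρ U) := fun _ _ hxy =>
  iSup_mono fun _ => iSup_mono fun _ => iSup_mono' fun hA => ⟨hA.mono hxy, le_rfl⟩

theorem value_mix (hU : ConcaveOn ℝ (Set.Ici 0) U) (hU0 : ∀ c, 0 ≤ c → 0 ≤ U c)
    (hx : 0 ≤ x) (hy : 0 ≤ y) {θ θ' : ℝ} (hθ : 0 ≤ θ) (hθ' : 0 ≤ θ') (h1 : θ + θ' = 1) :
    ENNReal.ofReal θ * M.value P ρ U x + ENNReal.ofReal θ' * M.value P ρ U y ≤
      M.value P ρ U (θ * x + θ' * y) := by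
  have : Nonempty {π : (ℕ → Ω → ℝ) × (ℝ≥0 → Ω → ℝ) // M.Admissible P x π.1 π.2} :=
    ⟨⟨(fun _ _ => 0, fun _ _ => 0), .zero hx⟩⟩
  have : Nonempty {π : (ℕ → Ω → ℝ) × (ℝ≥0 → Ω → ℝ) // M.Admissible P y π.1 π.2} :=
    ⟨⟨(fun _ _ => 0, fun _ _ => 0), .zero hy⟩⟩
  rw [value_eq_iSup (x := x), value_eq_iSup (x := y), ENNReal.mul_iSup, ENNReal.mul_iSup]
  refine ENNReal.iSup_add_iSup_le fun π π' => ?_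
  obtain ⟨⟨α, c⟩, hA⟩ := π
  obtain ⟨⟨α', c'⟩, hA'⟩ := π'
  refine le_trans ?_ (le_iSup_of_le _ (le_iSup_of_le _ (le_iSup_of_le (hA.mix hA' hθ hθ') le_rfl)))
  -- Only the superadditivity of the lower integral is used, for which no measurability is needed.
  refine (add_le_add (lintegral_const_mul_le _ _) (lintegral_const_mul_le _ _)).trans
    ((le_lintegral_add _ _).trans (lintegral_mono fun ω => ?_))
  refine (add_le_add (lintegral_const_mul_le _ _) (lintegral_const_mul_le _ _)).trans
    ((le_lintegral_add _ _).trans (lintegral_mono fun t => ?_))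
  have hc := hA.nonneg_c t.toNNReal ω
  have hc' := hA'.nonneg_c t.toNNReal ω
  have hE := (Real.exp_pos (-ρ * t)).le
  rw [← ENNReal.ofReal_mul hθ, ← ENNReal.ofReal_mul hθ', ← ENNReal.ofReal_add
    (mul_nonneg hθ (mul_nonneg hE (hU0 _ hc))) (mul_nonneg hθ' (mul_nonneg hE (hU0 _ hc')))]
  refine ENNReal.ofReal_le_ofReal ?_
  have h2 := mul_le_mul_of_nonneg_left (hU.2 hc hc' hθ hθ' h1) hE
  simp only [smul_eq_mul] at h2
  linarith

variable (M P ρ U) in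
/-- The value function as a real function, extended by its value at `0` to negative capitals. -/
def realValue (y : ℝ) : ℝ := (M.value P ρ U (max y 0)).toReal

theorem realValue_nonneg (y : ℝ) : 0 ≤ M.realValue P ρ U y := ENNReal.toReal_nonneg

theorem realValue_mono (hfin : ∀ x, M.value P ρ U x ≠ ⊤) : Monotone (M.realValue P ρ U) :=
  fun _ _ hxy => ENNReal.toReal_mono (hfin _) (value_mono (max_le_max_right 0 hxy))

theorem ofReal_realValue (hfin : ∀ x, M.value P ρ U x ≠ ⊤) (hy : 0 ≤ y) :
    ENNReal.ofReal (M.realValue P ρ U y) = M.value P ρ U y := by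
  rw [realValue, max_eq_left hy, ENNReal.ofReal_toReal (hfin y)]

theorem realValue_concaveOn (hfin : ∀ x, M.value P ρ U x ≠ ⊤)
    (hU : ConcaveOn ℝ (Set.Ici 0) U) (hU0 : ∀ c, 0 ≤ c → 0 ≤ U c) :
    ConcaveOn ℝ (Set.Ici 0) (M.realValue P ρ U) := by
  refine ⟨convex_Ici 0, fun x hx y hy θ θ' hθ hθ' h1 => ?_⟩
  have hx' : (0 : ℝ) ≤ x := hx
  have hy' : (0 : ℝ) ≤ y := hy
  have hz : 0 ≤ θ * x + θ' * y := by positivity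
  have h2 := ENNReal.toReal_mono (hfin _) (value_mix (M := M) (P := P) (ρ := ρ) hU hU0 hx hy hθ hθ' h1)
  rw [ENNReal.toReal_add (ENNReal.mul_ne_top ENNReal.ofReal_ne_top (hfin _))
    (ENNReal.mul_ne_top ENNReal.ofReal_ne_top (hfin _)), ENNReal.toReal_mul, ENNReal.toReal_mul,
    ENNReal.toReal_ofReal hθ, ENNReal.toReal_ofReal hθ'] at h2
  simpa only [realValue, smul_eq_mul, max_eq_left hx', max_eq_left hy', max_eq_left hz] using h2

theorem realValue_le {K γ : ℝ} (hK : 0 ≤ K)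
    (hle : ∀ x, M.value P ρ U x ≤ ENNReal.ofReal (K * x ^ γ)) (y : ℝ) :
    M.realValue P ρ U y ≤ K * (max y 0) ^ γ :=
  ENNReal.toReal_le_of_le_ofReal (mul_nonneg hK (Real.rpow_nonneg (le_max_right _ _) _)) (hle _)

/-- A nonnegative concave function on `[0, ∞)` is subadditive, so an increment is at most the value
at the increment, hence at most `K |y - z| ^ γ`. -/
theorem abs_realValue_sub_le {K γ : ℝ} (hK : 0 ≤ K)
    (hle : ∀ x, M.value P ρ U x ≤ ENNReal.ofReal (K * x ^ γ))
    (hU : ConcaveOn ℝ (Set.Ici 0) U) (hU0 : ∀ c, 0 ≤ c → 0 ≤ U c) (y z : ℝ) :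
    |M.realValue P ρ U y - M.realValue P ρ U z| ≤ K * |y - z| ^ γ := by
  have hfin : ∀ x, M.value P ρ U x ≠ ⊤ := fun x =>
    ne_top_of_le_ne_top ENNReal.ofReal_ne_top (hle x)
  have hconc := realValue_concaveOn hfin hU hU0
  wlog hyz : z ≤ y generalizing y z
  · rw [abs_sub_comm, abs_sub_comm y]
    exact this z y (le_of_not_ge hyz)
  rw [abs_of_nonneg (sub_nonneg.2 (realValue_mono hfin hyz)), abs_of_nonneg (sub_nonneg.2 hyz)]
  have hm : ∀ u, M.realValue P ρ U u = M.realValue P ρ U (max u 0) := fun u => by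
    simp [realValue]
  have h1 : max y 0 ≤ max z 0 + (y - z) := by
    refine max_le ?_ ?_
    · linarith [le_max_left z 0]
    · linarith [le_max_right z 0]
  have h2 := realValue_mono hfin h1
  have h3 := hconc.map_add_le (realValue_nonneg 0) (le_max_right z 0) (sub_nonneg.2 hyz)
  have h4 := realValue_le hK hle (y - z)
  rw [max_eq_left (sub_nonneg.2 hyz)] at h4
  rw [hm y, hm z]
  linarith

end IlliquidMarket

namespace UtilityAssumption

variable {U : ℝ → ℝ} {ρ lam zlo k b γ : ℝ} (hU : UtilityAssumption U ρ lam zlo k b γ)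
include hU

theorem nonneg {c : ℝ} (hc : 0 ≤ c) : 0 ≤ U c :=
  hU.map_zero.symm.le.trans (hU.strictMono.monotoneOn Set.self_mem_Ici hc hc)

theorem exists_value_le {Ω : Type*} [MeasurableSpace Ω] {P : Measure Ω} [IsProbabilityMeasure P]
    {M : IlliquidMarket Ω} {p : Kernel ℝ ℝ} [IsMarkovKernel p] {zhi : EReal}
    (hH : ReturnAssumption M P lam p zlo zhi k b) :
    ∃ K : ℝ, 0 ≤ K ∧ ∀ x, M.value P ρ U x ≤ ENNReal.ofReal (K * x ^ γ) := by
  obtain ⟨K₁, hK₁, hg⟩ := hU.growth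
  have hγ := hU.γ_pos
  have hδ : 0 < ρ - (b * γ + lam * (k ^ γ / zlo ^ γ - 1)) := sub_pos.2 hU.discount
  exact ⟨K₁ * (1 / (ρ - (b * γ + lam * (k ^ γ / zlo ^ γ - 1))) + 1 / γ), by positivity,
    hH.value_le hγ hU.γ_lt_one hδ (by ring) hK₁.le hg⟩

end UtilityAssumption

/-! ### The expected value at the next trading date -/

theorem IlliquidMarket.continuous_realValue {Ω : Type*} [MeasurableSpace Ω] {M : IlliquidMarket Ω}
    {P : Measure Ω} {ρ K γ : ℝ} {U : ℝ → ℝ} (hγ : 0 < γ)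
    (h : ∀ y z, |M.realValue P ρ U y - M.realValue P ρ U z| ≤ K * |y - z| ^ γ) :
    Continuous (M.realValue P ρ U) := by
  refine continuous_iff_continuousAt.2 fun z => tendsto_iff_dist_tendsto_zero.2 ?_
  have hc : Continuous fun y => K * |y - z| ^ γ :=
    continuous_const.mul ((by fun_prop : Continuous fun y => |y - z|).rpow_const
      fun _ => Or.inr hγ.le)
  exact squeeze_zero (fun y => dist_nonneg) (fun y => h y z)
    (hc.tendsto' z 0 (by simp [Real.zero_rpow hγ.ne']))

/-- The rate `λ ∫ v (y + a z) p(s, dz)` of the expected value at the next trading date, extended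
to all times and wealths. -/
def continuationValue {Ω : Type*} [MeasurableSpace Ω] (M : IlliquidMarket Ω) (P : Measure Ω)
    (ρ lam : ℝ) (U : ℝ → ℝ) (p : Kernel ℝ ℝ) (l a s y : ℝ) : ℝ :=
  lam * ∫ z, M.realValue P ρ U (max y l + a * z) ∂(p (max s 0))

namespace UtilityAssumption

variable {Ω : Type*} [MeasurableSpace Ω] {P : Measure Ω} [IsProbabilityMeasure P]
  {M : IlliquidMarket Ω} {p : Kernel ℝ ℝ} [IsMarkovKernel p]
  {zlo : ℝ} {zhi : EReal} {lam k b ρ γ : ℝ} {U : ℝ → ℝ}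
  (hU : UtilityAssumption U ρ lam zlo k b γ) (hH : ReturnAssumption M P lam p zlo zhi k b)
include hU hH

theorem value_ne_top (x : ℝ) : M.value P ρ U x ≠ ⊤ := by
  obtain ⟨K, -, hle⟩ := hU.exists_value_le hH
  exact ne_top_of_le_ne_top ENNReal.ofReal_ne_top (hle x)

theorem exists_realValue_bounds : ∃ K : ℝ, 0 ≤ K ∧
    (∀ y z, |M.realValue P ρ U y - M.realValue P ρ U z| ≤ K * |y - z| ^ γ) ∧
    ∀ y, M.realValue P ρ U y ≤ K * (max y 0) ^ γ := by
  obtain ⟨K, hK, hle⟩ := hU.exists_value_le hH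
  exact ⟨K, hK, IlliquidMarket.abs_realValue_sub_le hK hle hU.strictConcave.concaveOn
    fun c hc => hU.nonneg hc, IlliquidMarket.realValue_le hK hle⟩

theorem continuous_realValue : Continuous (M.realValue P ρ U) := by
  obtain ⟨K, -, h, -⟩ := hU.exists_realValue_bounds hH
  exact IlliquidMarket.continuous_realValue hU.γ_pos h

theorem exists_realValue_linear (Y a : ℝ) :
    ∃ C : ℝ, ∀ z, |M.realValue P ρ U (Y + a * z)| ≤ C * (1 + |z|) := by
  obtain ⟨K, hK, -, h⟩ := hU.exists_realValue_bounds hH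
  refine ⟨K * (1 + |Y| + |a|), fun z => ?_⟩
  rw [abs_of_nonneg (IlliquidMarket.realValue_nonneg _)]
  refine (h _).trans ?_
  rw [mul_assoc]
  gcongr
  have h0 : 0 ≤ max (Y + a * z) 0 := le_max_right _ _
  have h1 : max (Y + a * z) 0 ≤ |Y| + |a| * |z| := by
    refine max_le ((le_abs_self _).trans ((abs_add_le _ _).trans_eq ?_)) (by positivity)
    rw [abs_mul]
  have h2 : (max (Y + a * z) 0) ^ γ ≤ 1 + max (Y + a * z) 0 := by
    rcases le_total (max (Y + a * z) 0) 1 with h | h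
    · linarith [Real.rpow_le_one h0 h hU.γ_pos.le]
    · linarith [Real.rpow_le_self_of_one_le h hU.γ_lt_one.le]
  have := abs_nonneg Y
  have := abs_nonneg a
  have := abs_nonneg z
  nlinarith [mul_nonneg (abs_nonneg Y) (abs_nonneg z)]

theorem integrable_realValue {t : ℝ} (ht : 0 ≤ t) (Y a : ℝ) :
    Integrable (fun z => M.realValue P ρ U (Y + a * z)) (p t) := by
  obtain ⟨C, hC⟩ := hU.exists_realValue_linear hH Y a
  refine (((integrable_const (1 : ℝ)).add (hH.integrable t ht).norm).const_mul C).mono'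
    ((hU.continuous_realValue hH).comp (by fun_prop : Continuous fun z => Y + a * z)
      ).aestronglyMeasurable (Eventually.of_forall fun z => ?_)
  exact hC z

/-- Continuity in time at fixed wealth is the assumption on the kernel; the Hölder bound in wealth
is uniform in time, and the two combine. -/
theorem continuous_continuationValue (l a : ℝ) :
    Continuous fun q : ℝ × ℝ => continuationValue M P ρ lam U p l a q.1 q.2 := by
  obtain ⟨K, hK, hd, -⟩ := hU.exists_realValue_bounds hH
  have hlam := hH.lam_pos
  have hs : ∀ y, Continuous fun s => continuationValue M P ρ lam U p l a s y := fun y => by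
    refine continuous_const.mul (continuous_iff_continuousAt.2 fun s => ?_)
    refine (hH.continuity (fun z => M.realValue P ρ U (max y l + a * z))
      ((hU.continuous_realValue hH).comp (by fun_prop)) (hU.exists_realValue_linear hH _ a)
      (max s 0) (le_max_right _ _)).comp (f := fun s : ℝ => max s 0)
      (tendsto_nhdsWithin_iff.2 ⟨?_, Eventually.of_forall fun r => le_max_right r 0⟩)
    exact (by fun_prop : Continuous fun s : ℝ => max s 0).tendsto s
  have hy : ∀ s y y', |continuationValue M P ρ lam U p l a s y -
      continuationValue M P ρ lam U p l a s y'| ≤ lam * (K * |max y l - max y' l| ^ γ) :=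
    fun s y y' => by
      simp only [continuationValue]
      rw [← mul_sub, abs_mul, abs_of_pos hlam, ← integral_sub
        (hU.integrable_realValue hH (le_max_right s 0) _ a)
        (hU.integrable_realValue hH (le_max_right s 0) _ a)]
      refine mul_le_mul_of_nonneg_left ?_ hlam.le
      have h1 : ∀ z, ‖M.realValue P ρ U (max y l + a * z) -
          M.realValue P ρ U (max y' l + a * z)‖ ≤ K * |max y l - max y' l| ^ γ := fun z => by
        simpa using hd (max y l + a * z) (max y' l + a * z)
      have h2 := norm_integral_le_of_norm_le_const (μ := p (max s 0)) (Eventually.of_forall h1)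
      rwa [probReal_univ, mul_one] at h2
  refine continuous_iff_continuousAt.2 fun ⟨s₀, y₀⟩ => ?_
  have h1 : Tendsto (fun q : ℝ × ℝ => continuationValue M P ρ lam U p l a q.1 y₀) (𝓝 (s₀, y₀))
      (𝓝 (continuationValue M P ρ lam U p l a s₀ y₀)) := ((hs y₀).comp continuous_fst).tendsto _
  have h2 : Tendsto (fun q : ℝ × ℝ => continuationValue M P ρ lam U p l a q.1 q.2 -
      continuationValue M P ρ lam U p l a q.1 y₀) (𝓝 (s₀, y₀)) (𝓝 0) := by
    have hc : Continuous fun q : ℝ × ℝ => lam * (K * |max q.2 l - max y₀ l| ^ γ) :=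
      continuous_const.mul (continuous_const.mul
        ((by fun_prop : Continuous fun q : ℝ × ℝ => |max q.2 l - max y₀ l|).rpow_const
          fun _ => Or.inr hU.γ_pos.le))
    exact squeeze_zero_norm (fun q => hy q.1 q.2 y₀)
      (hc.tendsto' _ _ (by simp [Real.zero_rpow hU.γ_pos.ne']))
  simpa [ContinuousAt] using h1.add h2

theorem consumptionProblem {a : ℝ} (ha : a ∈ investments zhi) :
    ConsumptionProblem U (continuationValue M P ρ lam U p (minWealth zlo zhi a) a) (ρ + lam)
      (minWealth zlo zhi a) := by
  set l := minWealth zlo zhi a with hl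
  have hlam := hH.lam_pos
  have hρ := hU.ρ_pos
  have hγ := hU.γ_pos
  have hγ1 := hU.γ_lt_one
  have hlo := hH.zlo_pos
  have hk := hH.k_nonneg
  have hcont := hU.continuous_continuationValue hH l a
  have hpos : ∀ {s y : ℝ}, 0 < s → l ≤ y → ∀ᵐ z ∂(p s), 0 ≤ y + a * z := fun hs hy =>
    hH.ae_nonneg_of_minWealth_le hs ha hy
  obtain ⟨K₁, hK₁, hg⟩ := hU.growth
  obtain ⟨K, hK, -, hKb⟩ := hU.exists_realValue_bounds hH
  refine
    { β_pos := by linarith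
      strictMono := hU.strictMono
      concave := hU.strictConcave.concaveOn
      map_zero := hU.map_zero
      contDiff := hU.contDiff
      inada := hU.inada_zero
      tendsto_zero := ?_
      sublinear := ?_
      continuous_G := hcont
      G_nonneg := fun s y =>
        mul_nonneg hlam.le (integral_nonneg fun z => IlliquidMarket.realValue_nonneg _)
      G_mono := fun s y y' hyy => ?_
      G_concave := fun s => ⟨convex_Ici l, fun y hy y' hy' θ θ' hθ hθ' h1 => ?_⟩
      G_growth := ⟨b * γ, ?_, fun y => ?_⟩ }
  · have hc : Continuous fun c : ℝ => K₁ * c ^ γ :=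
      continuous_const.mul (Real.continuous_rpow_const hγ.le)
    refine tendsto_of_tendsto_of_tendsto_of_le_of_le' tendsto_const_nhds
      ((hc.tendsto' 0 0 (by simp [Real.zero_rpow hγ.ne'])).mono_left nhdsWithin_le_nhds) ?_ ?_
    · filter_upwards [self_mem_nhdsWithin] with c hc using hU.nonneg (le_of_lt hc)
    · filter_upwards [self_mem_nhdsWithin] with c hc using hg c (le_of_lt hc)
  · have h1 : Tendsto (fun c : ℝ => K₁ * c ^ (-(1 - γ))) atTop (𝓝 (K₁ * 0)) :=
      (tendsto_rpow_neg_atTop (by linarith)).const_mul K₁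
    rw [mul_zero] at h1
    refine tendsto_of_tendsto_of_tendsto_of_le_of_le' tendsto_const_nhds h1 ?_ ?_
    · filter_upwards [eventually_gt_atTop 0] with c hc using
        div_nonneg (hU.nonneg hc.le) hc.le
    · filter_upwards [eventually_gt_atTop 0] with c hc
      rw [div_le_iff₀ hc, mul_assoc, ← Real.rpow_add_one hc.ne']
      simpa using hg c hc.le
  · refine mul_le_mul_of_nonneg_left (integral_mono
      (hU.integrable_realValue hH (le_max_right s 0) _ a)
      (hU.integrable_realValue hH (le_max_right s 0) _ a) fun z => ?_) hlam.le
    exact IlliquidMarket.realValue_mono (hU.value_ne_top hH)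
      (add_le_add (max_le_max_right l hyy) le_rfl)
  · have hconc := IlliquidMarket.realValue_concaveOn (hU.value_ne_top hH)
      hU.strictConcave.concaveOn fun c hc => hU.nonneg hc
    have hy0 : l ≤ y := hy
    have hy0' : l ≤ y' := hy'
    have hmix : l ≤ θ * y + θ' * y' := by
      have h2 := mul_le_mul_of_nonneg_left hy0 hθ
      have h3 := mul_le_mul_of_nonneg_left hy0' hθ'
      have h4 : θ * l + θ' * l = l := by rw [← add_mul, h1, one_mul]
      linarith
    simp only [smul_eq_mul]
    have key : ∀ r, 0 < r → θ * continuationValue M P ρ lam U p l a r y +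
        θ' * continuationValue M P ρ lam U p l a r y' ≤
        continuationValue M P ρ lam U p l a r (θ * y + θ' * y') := fun r hr => by
      simp only [continuationValue, max_eq_left hy0, max_eq_left hy0', max_eq_left hmix,
        max_eq_left hr.le]
      have i1 := hU.integrable_realValue hH hr.le y a
      have i2 := hU.integrable_realValue hH hr.le y' a
      have h5 : θ * ∫ z, M.realValue P ρ U (y + a * z) ∂(p r) +
          θ' * ∫ z, M.realValue P ρ U (y' + a * z) ∂(p r) ≤
          ∫ z, M.realValue P ρ U (θ * y + θ' * y' + a * z) ∂(p r) := by
        rw [← integral_const_mul, ← integral_const_mul,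
          ← integral_add (i1.const_mul θ) (i2.const_mul θ')]
        refine integral_mono_ae ((i1.const_mul θ).add (i2.const_mul θ'))
          (hU.integrable_realValue hH hr.le _ a) ?_
        filter_upwards [hpos hr hy0, hpos hr hy0'] with z hz hz'
        have h6 := hconc.2 hz hz' hθ hθ' h1
        simp only [smul_eq_mul] at h6
        refine h6.trans_eq (congrArg _ ?_)
        linear_combination (a * z) * h1
      have := mul_le_mul_of_nonneg_left h5 hlam.le
      linarith
    -- The support of `p t` is known only for `t > 0`. At nonpositive times the extension is frozen
    -- at `0`, where concavity follows by letting `r` decrease to `0`.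
    rcases lt_or_ge 0 s with hs | hs
    · exact key s hs
    · have hz : ∀ y, continuationValue M P ρ lam U p l a s y =
          continuationValue M P ρ lam U p l a 0 y := fun y => by
        simp [continuationValue, max_eq_right hs]
      rw [hz, hz, hz]
      have hcs : ∀ y, Tendsto (fun r => continuationValue M P ρ lam U p l a r y) (𝓝[>] 0)
          (𝓝 (continuationValue M P ρ lam U p l a 0 y)) := fun y =>
        ((hcont.comp (by fun_prop : Continuous fun r : ℝ => (r, y))).tendsto 0).mono_left
          nhdsWithin_le_nhds
      refine le_of_tendsto_of_tendsto (((hcs y).const_mul θ).add ((hcs y').const_mul θ'))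
        (hcs _) ?_
      filter_upwards [self_mem_nhdsWithin] with r hr using key r hr
  · have h1 := hU.discount
    have h2 : 0 ≤ lam * (k ^ γ / zlo ^ γ) := by positivity
    linarith
  · set Y := max y l
    have hY : l ≤ Y := le_max_right _ _
    have hl0 : 0 ≤ Y := (hH.minWealth_nonneg a ha).trans hY
    -- The first term comes from `rpow_wealth`, which needs a positive time; the second covers `s =
    -- 0`.
    refine ⟨lam * (K * (k ^ γ / zlo ^ γ * Y ^ γ)) + continuationValue M P ρ lam U p l a 0 y,
      fun s hs => ?_⟩
    have h0 : 0 ≤ continuationValue M P ρ lam U p l a 0 y :=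
      mul_nonneg hlam.le (integral_nonneg fun z => IlliquidMarket.realValue_nonneg _)
    rcases hs.eq_or_lt with rfl | hs
    · have : 0 ≤ lam * (K * (k ^ γ / zlo ^ γ * Y ^ γ)) := by positivity
      simpa using this
    · obtain ⟨i1, h1⟩ := hH.rpow_wealth hs hγ hγ1 (hpos hs hY)
      have h2 : ∫ z, M.realValue P ρ U (Y + a * z) ∂(p s) ≤
          K * ∫ z, (Y + a * z) ^ γ ∂(p s) := by
        rw [← integral_const_mul]
        refine integral_mono_ae (hU.integrable_realValue hH hs.le Y a) (i1.const_mul K) ?_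
        filter_upwards [hpos hs hY] with z hz
        simpa only [max_eq_left hz] using hKb (Y + a * z)
      have h3 : continuationValue M P ρ lam U p l a s y ≤
          lam * (K * (k ^ γ / zlo ^ γ * Y ^ γ)) * Real.exp (b * γ * s) := by
        simp only [continuationValue, max_eq_left hs.le]
        calc _ ≤ lam * (K * (k ^ γ / zlo ^ γ * Real.exp (b * γ * s) * Y ^ γ)) := by
              refine mul_le_mul_of_nonneg_left (h2.trans ?_) hlam.le
              exact mul_le_mul_of_nonneg_left h1 hK
          _ = _ := by ring
      have h4 := mul_nonneg h0 (Real.exp_pos (b * γ * s)).le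
      linarith

/-- The auxiliary value function is the value of a deterministic consumption problem. -/
theorem auxValue_eq_iSup {a t x : ℝ} (ha : a ∈ investments zhi) (ht : 0 ≤ t) :
    auxValue M P ρ lam U p zlo zhi t x a =
      ⨆ c : {c // IsConsumption (minWealth zlo zhi a) t x c}, ENNReal.ofReal
        (reward U (continuationValue M P ρ lam U p (minWealth zlo zhi a) a) (ρ + lam) t x c.1) := by
  have hC := hU.consumptionProblem hH ha
  have hlam := hH.lam_pos
  rw [auxValue, iSup_subtype']
  refine iSup_congr fun c => ?_
  have hc : IsConsumption (minWealth zlo zhi a) t x c.1 := c.2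
  rw [reward, ofReal_integral_eq_lintegral_ofReal (hC.integrableOn_rewardRate ht hc)
    (Eventually.of_forall fun s => hC.rewardRate_nonneg hc s)]
  refine setLIntegral_congr_fun measurableSet_Ioi fun s hs => ?_
  have hts : t < s := hs
  have hs0 : 0 < s := ht.trans_lt hts
  set Y := x - ∫ u in Set.Ioc t s, c.1 u with hY
  have hlY : minWealth zlo zhi a ≤ Y := by linarith [hc.spent_le hts.le]
  have h1 : ∫⁻ z, M.value P ρ U (Y + a * z) ∂(p s) =
      ENNReal.ofReal (∫ z, M.realValue P ρ U (Y + a * z) ∂(p s)) := by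
    rw [ofReal_integral_eq_lintegral_ofReal (hU.integrable_realValue hH hs0.le Y a)
      (Eventually.of_forall fun z => IlliquidMarket.realValue_nonneg _)]
    refine lintegral_congr_ae ?_
    filter_upwards [hH.ae_nonneg_of_minWealth_le hs0 ha hlY] with z hz
    exact (IlliquidMarket.ofReal_realValue (hU.value_ne_top hH) hz).symm
  have h2 : 0 ≤ ∫ z, M.realValue P ρ U (Y + a * z) ∂(p s) :=
    integral_nonneg fun z => IlliquidMarket.realValue_nonneg _
  have h3 := hU.nonneg (hc.nonneg s)
  simp only [rewardRate, continuationValue]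
  rw [← hY, h1, max_eq_left hlY, max_eq_left hs0.le, ← ENNReal.ofReal_mul hlam.le,
    ← ENNReal.ofReal_add h3 (mul_nonneg hlam.le h2), ← ENNReal.ofReal_mul (Real.exp_pos _).le]

theorem auxValue_ne_top {a t x : ℝ} (ha : a ∈ investments zhi) (ht : 0 ≤ t) :
    auxValue M P ρ lam U p zlo zhi t x a ≠ ⊤ := by
  obtain ⟨B, hB⟩ := (hU.consumptionProblem hH ha).bddAbove_reward ht (x := x)
  rw [hU.auxValue_eq_iSup hH ha ht]
  exact ne_top_of_le_ne_top ENNReal.ofReal_ne_top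
    (iSup_le fun c => ENNReal.ofReal_le_ofReal (hB ⟨c, rfl⟩))

theorem toReal_auxValue {a t x : ℝ} (ha : a ∈ investments zhi) (ht : 0 ≤ t) :
    (auxValue M P ρ lam U p zlo zhi t x a).toReal = maxReward U
      (continuationValue M P ρ lam U p (minWealth zlo zhi a) a) (ρ + lam)
      (minWealth zlo zhi a) t x := by
  rw [hU.auxValue_eq_iSup hH ha ht, ENNReal.toReal_iSup fun c => ENNReal.ofReal_ne_top, maxReward]
  exact iSup_congr fun c =>
    ENNReal.toReal_ofReal ((hU.consumptionProblem hH ha).reward_nonneg c.2)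

end UtilityAssumption

end

theorem mainTheorem4 {Ω : Type*} [MeasurableSpace Ω] (P : Measure Ω) [IsProbabilityMeasure P]
    (M : IlliquidMarket Ω) (p : Kernel ℝ ℝ) [IsMarkovKernel p]
    (zlo : ℝ) (zhi : EReal) (lam k b ρ γ : ℝ) (U : ℝ → ℝ)
    (hH : ReturnAssumption M P lam p zlo zhi k b)
    (hU : UtilityAssumption U ρ lam zlo k b γ)
    (hp : SemiconcavityAssumption lam p zlo zhi)
    (a : ℝ) (ha : a ∈ investments zhi) :
    (∀ t x : ℝ, 0 ≤ t → minWealth zlo zhi a ≤ x →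
      auxValue M P ρ lam U p zlo zhi t x a ≠ ⊤) ∧
    ContDiffOn ℝ 1 (fun q : ℝ × ℝ => (auxValue M P ρ lam U p zlo zhi q.1 q.2 a).toReal)
      (Set.Ici 0 ×ˢ Set.Ioi (minWealth zlo zhi a)) ∧
    ∀ t : ℝ, 0 ≤ t →
      Tendsto (deriv fun x => (auxValue M P ρ lam U p zlo zhi t x a).toReal)
        (𝓝[>] (minWealth zlo zhi a)) atTop := by
  have hC := hU.consumptionProblem hH ha
  refine ⟨fun t x ht _ => hU.auxValue_ne_top hH ha ht, ?_, fun t ht => ?_⟩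
  · exact hC.contDiffOn_maxReward.congr fun q hq => hU.toReal_auxValue hH ha hq.1
  · have h : (fun x => (auxValue M P ρ lam U p zlo zhi t x a).toReal) = maxReward U
        (continuationValue M P ρ lam U p (minWealth zlo zhi a) a) (ρ + lam)
        (minWealth zlo zhi a) t := funext fun x => hU.toReal_auxValue hH ha ht
    rw [h]
    exact hC.tendsto_deriv_maxReward ht
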